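/- **Conventions.** Let $(M,g)$ be a smooth Riemannian (positive definite) manifold of dimension $n>3$, with Levi-Civita connection $\nabla$. Its curvature tensor is normalised by $(\nabla_j\nabla_k-\nabla_k\nabla_j)V_l=R_{jkl}{}^mV_m$, and $R_{kl}=-R_{mkl}{}^m$, $R=g^{kl}R_{kl}$. Let $\phi$ be a smooth function on $M$ and $Z_{kl}=R_{kl}+\phi\,g_{kl}$. Suppose that $M$ is weakly $Z$ symmetric, i.e. there are smooth covector fields $A,B,D$ on $M$ with $$\nabla_kZ_{jl}=A_kZ_{jl}+B_jZ_{kl}+D_lZ_{kj},$$ and put $\omega_k=A_k-B_k$. **Theorem.** Suppose that $M$ is conformally flat, i.e. the conformal curvature tensor $$C_{jkl}{}^m=R_{jkl}{}^m+\tfrac1{n-2}\left(\delta_j{}^mR_{kl}-\delta_k{}^mR_{jl}+R_j{}^mg_{kl}-R_k{}^mg_{jl}\right)-\tfrac{R}{(n-1)(n-2)}\left(\delta_j{}^mg_{kl}-\delta_k{}^mg_{jl}\right)$$ vanishes on $M$, that $Z_{kl}$ is non-singular at every point of $M$, and that $(\omega_j\nabla_k-\omega_k\nabla_j)\phi=0$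 on $M$. Then for every point $p\in M$ with $\omega(p)\neq0$ the following hold. 1. Near $p$, $M$ is a warped product $1\times e^qM^*$ with $M^*$ Einstein: there are smooth coordinates $(x^1,\dots,x^n)$ on an open neighbourhood of $p$, with image $I\times U$ for an open interval $I\subseteq\mathbb R$ and an open set $U\subseteq\mathbb R^{n-1}$, a smooth function $q$ on $I$ and a smooth Riemannian metric $g^*$ on $U$ with $\mathrm{Ric}(g^*)=c\,g^*$ for some constant $c\in\mathbb R$, such that $$ds^2=(dx^1)^2+e^{q(x^1)}\,g^*_{\alpha\beta}(x^2,\dots,x^n)\,dx^\alpha dx^\beta,\qquad \alpha,\beta=2,\dots,n.$$ 2. Near $p$, $M$ is subprojective in the sense of Kagan: there are smooth coordinates on an open neighbourhood of $p$, with values in $\mathbb R^n$, in which every geodesic of $M$ contained in this neighbourhood lies in some two-dimensional linear subspace of $\mathbb R^n$ (a plane through the origin). In particular both conclusions hold near every point of $M$ if $\omega$ vanishes nowhere. -/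

import Mathlib

open scoped Manifold ContDiff

noncomputable section

namespace WeaklyZ

/-! ### Tensor calculus in local coordinates

A covariant 2-tensor on an open subset of `ℝⁿ` is given by its matrix of components
`G : ℝⁿ → Matrix (Fin n) (Fin n) ℝ`, a covector field by `w : ℝⁿ → Fin n → ℝ`. -/

/-- The partial derivative `∂_i f` at `x`. -/
def pd {n : ℕ} (i : Fin n) (f : EuclideanSpace ℝ (Fin n) → ℝ) (x : EuclideanSpace ℝ (Fin n)) : ℝ :=
  fderiv ℝ f x (EuclideanSpace.single i 1)

/-- The Christoffel symbols `Γ^k_{ij}` of the metric with components `G`. -/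
def christoffel {n : ℕ} (G : EuclideanSpace ℝ (Fin n) → Matrix (Fin n) (Fin n) ℝ)
    (k i j : Fin n) (x : EuclideanSpace ℝ (Fin n)) : ℝ :=
  (1 / 2) * ∑ p, (G x)⁻¹ k p *
    (pd i (fun y => G y j p) x + pd j (fun y => G y i p) x - pd p (fun y => G y i j) x)

/-- The curvature tensor `R_{jkl}{}^m`, normalised by
`(∇_j ∇_k - ∇_k ∇_j) V_l = R_{jkl}{}^m V_m`. -/
def riemann {n : ℕ} (G : EuclideanSpace ℝ (Fin n) → Matrix (Fin n) (Fin n) ℝ)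
    (j k l m : Fin n) (x : EuclideanSpace ℝ (Fin n)) : ℝ :=
  pd k (christoffel G m j l) x - pd j (christoffel G m k l) x
    + ∑ p, (christoffel G m k p x * christoffel G p j l x
        - christoffel G m j p x * christoffel G p k l x)

/-- The Ricci tensor `R_{kl} = - R_{mkl}{}^m` (it is positive on round spheres). -/
def ricci {n : ℕ} (G : EuclideanSpace ℝ (Fin n) → Matrix (Fin n) (Fin n) ℝ)
    (x : EuclideanSpace ℝ (Fin n)) : Matrix (Fin n) (Fin n) ℝ :=
  fun k l => - ∑ m, riemann G m k l m x

/-- The scalar curvature `R = g^{kl} R_{kl}`. -/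
def scalarCurv {n : ℕ} (G : EuclideanSpace ℝ (Fin n) → Matrix (Fin n) (Fin n) ℝ)
    (x : EuclideanSpace ℝ (Fin n)) : ℝ :=
  ∑ k, ∑ l, (G x)⁻¹ k l * ricci G x k l

/-- The conformal (Weyl) curvature tensor `C_{jkl}{}^m`; here `R_j{}^m = R_{jp} g^{pm}` and
`δ_j{}^m` is the identity matrix. -/
def weyl {n : ℕ} (G : EuclideanSpace ℝ (Fin n) → Matrix (Fin n) (Fin n) ℝ)
    (j k l m : Fin n) (x : EuclideanSpace ℝ (Fin n)) : ℝ :=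
  let δ : Matrix (Fin n) (Fin n) ℝ := 1
  let Ric := ricci G x
  let RicUp : Matrix (Fin n) (Fin n) ℝ := Ric * (G x)⁻¹
  riemann G j k l m x
    + 1 / ((n : ℝ) - 2) *
        (δ j m * Ric k l - δ k m * Ric j l + RicUp j m * G x k l - RicUp k m * G x j l)
    - scalarCurv G x / (((n : ℝ) - 1) * ((n : ℝ) - 2)) * (δ j m * G x k l - δ k m * G x j l)

/-- The covariant derivative `∇_k S_{jl}` of a covariant 2-tensor `S`. -/
def covDeriv {n : ℕ} (G S : EuclideanSpace ℝ (Fin n) → Matrix (Fin n) (Fin n) ℝ)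
    (k j l : Fin n) (x : EuclideanSpace ℝ (Fin n)) : ℝ :=
  pd k (fun y => S y j l) x
    - ∑ p, (christoffel G p k j x * S x p l + christoffel G p k l x * S x j p)

/-- The generalized `Z` tensor `Z_{kl} = R_{kl} + φ g_{kl}`. -/
def zTensor {n : ℕ} (G : EuclideanSpace ℝ (Fin n) → Matrix (Fin n) (Fin n) ℝ)
    (f : EuclideanSpace ℝ (Fin n) → ℝ) (x : EuclideanSpace ℝ (Fin n)) :
    Matrix (Fin n) (Fin n) ℝ :=
  ricci G x + f x • G x

/-- `G` is (the component matrix of) a smooth Riemannian metric on the set `U ⊆ ℝⁿ`. -/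
def IsMetricOn {n : ℕ} (U : Set (EuclideanSpace ℝ (Fin n)))
    (G : EuclideanSpace ℝ (Fin n) → Matrix (Fin n) (Fin n) ℝ) : Prop :=
  (∀ i j, ContDiffOn ℝ ∞ (fun y => G y i j) U) ∧ ∀ y ∈ U, (G y).PosDef

/-- `G` is an Einstein metric on `U`: `Ric = c g` for a constant `c`. -/
def IsEinsteinOn {n : ℕ} (U : Set (EuclideanSpace ℝ (Fin n)))
    (G : EuclideanSpace ℝ (Fin n) → Matrix (Fin n) (Fin n) ℝ) : Prop :=
  ∃ c : ℝ, ∀ y ∈ U, ricci G y = c • G y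

/-- `γ` is an (affinely parametrized) geodesic on the open set `J ⊆ ℝ` of parameters:
`γ̈^k + Γ^k_{ij} γ̇^i γ̇^j = 0`. -/
def IsGeodesicOn {n : ℕ} (G : EuclideanSpace ℝ (Fin n) → Matrix (Fin n) (Fin n) ℝ)
    (γ : ℝ → EuclideanSpace ℝ (Fin n)) (J : Set ℝ) : Prop :=
  ContDiffOn ℝ 2 γ J ∧ ∀ t ∈ J, ∀ k,
    deriv (deriv γ) t k
      + ∑ i, ∑ j, christoffel G k i j (γ t) * deriv γ t i * deriv γ t j = 0

/-! ### Riemannian manifolds -/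

variable {n : ℕ} {M : Type*} [TopologicalSpace M] [ChartedSpace (EuclideanSpace ℝ (Fin n)) M]
  [IsManifold (𝓡 n) ∞ M]

/-- Smooth Riemannian metrics on the `n`-dimensional smooth manifold `M`. -/
abbrev Metric (n : ℕ) (M : Type*) [TopologicalSpace M]
    [ChartedSpace (EuclideanSpace ℝ (Fin n)) M] [IsManifold (𝓡 n) ∞ M] :=
  Bundle.ContMDiffRiemannianMetric (𝓡 n) ∞ (EuclideanSpace ℝ (Fin n))
    (fun p : M => TangentSpace (𝓡 n) p)

/-- Smooth covector fields (1-forms) on `M`. -/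
abbrev Covector (n : ℕ) (M : Type*) [TopologicalSpace M]
    [ChartedSpace (EuclideanSpace ℝ (Fin n)) M] [IsManifold (𝓡 n) ∞ M] :=
  ContMDiffSection (𝓡 n) (EuclideanSpace ℝ (Fin n) →L[ℝ] ℝ) ∞
    (fun p : M => TangentSpace (𝓡 n) p →L[ℝ] ℝ)

/-- The `i`-th coordinate vector field of the chart `e`, at the point with coordinates `x`. -/
def coordVec (e : OpenPartialHomeomorph M (EuclideanSpace ℝ (Fin n)))
    (x : EuclideanSpace ℝ (Fin n)) (i : Fin n) : TangentSpace (𝓡 n) (e.symm x) :=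
  mfderiv (𝓡 n) (𝓡 n) e.symm x (EuclideanSpace.single i (1 : ℝ) : EuclideanSpace ℝ (Fin n))

/-- The components `g_{ij}` of the metric in the chart `e`. -/
def metricIn (g : Metric n M) (e : OpenPartialHomeomorph M (EuclideanSpace ℝ (Fin n)))
    (x : EuclideanSpace ℝ (Fin n)) : Matrix (Fin n) (Fin n) ℝ :=
  fun i j => g.inner (e.symm x) (coordVec e x i) (coordVec e x j)

/-- The components `A_i` of the covector field `A` in the chart `e`. -/
def covectorIn (A : Covector n M) (e : OpenPartialHomeomorph M (EuclideanSpace ℝ (Fin n)))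
    (x : EuclideanSpace ℝ (Fin n)) (i : Fin n) : ℝ :=
  A (e.symm x) (coordVec e x i)

/-- The scalar function `f` expressed in the chart `e`. -/
def scalarIn (f : M → ℝ) (e : OpenPartialHomeomorph M (EuclideanSpace ℝ (Fin n)))
    (x : EuclideanSpace ℝ (Fin n)) : ℝ :=
  f (e.symm x)

/-- The set of all smooth charts of `M`. Tensor equations on `M` are required in all of them. -/
abbrev charts (n : ℕ) (M : Type*) [TopologicalSpace M]
    [ChartedSpace (EuclideanSpace ℝ (Fin n)) M] :
    Set (OpenPartialHomeomorph M (EuclideanSpace ℝ (Fin n))) :=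
  IsManifold.maximalAtlas (𝓡 n) ∞ M

/-- The conformal curvature tensor vanishes: `C_{jkl}{}^m = 0`. -/
def IsConformallyFlat (g : Metric n M) : Prop :=
  ∀ e ∈ charts n M, ∀ x ∈ e.target, ∀ j k l m, weyl (metricIn g e) j k l m x = 0

/-- `∇_k Z_{jl} = A_k Z_{jl} + B_j Z_{kl} + D_l Z_{kj}` for the tensor `Z = Ric + φ g`: the manifold
is weakly `Z` symmetric with associated covectors `A`, `B`, `D`. -/
def IsWeaklyZSymmetric (g : Metric n M) (φ : M → ℝ) (A B D : Covector n M) : Prop :=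
  ∀ e ∈ charts n M, ∀ x ∈ e.target, ∀ k j l,
    let Z := zTensor (metricIn g e) (scalarIn φ e)
    covDeriv (metricIn g e) Z k j l x =
      covectorIn A e x k * Z x j l + covectorIn B e x j * Z x k l + covectorIn D e x l * Z x k j

/-- The tensor `Z = Ric + φ g` is non-singular at every point. -/
def ZNonsingular (g : Metric n M) (φ : M → ℝ) : Prop :=
  ∀ e ∈ charts n M, ∀ x ∈ e.target, (zTensor (metricIn g e) (scalarIn φ e) x).det ≠ 0

/-- `(w_j ∇_k - w_k ∇_j) φ = 0`. -/
def GradientParallel (w : Covector n M) (φ : M → ℝ) : Prop :=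
  ∀ e ∈ charts n M, ∀ x ∈ e.target, ∀ j k,
    covectorIn w e x j * pd k (scalarIn φ e) x - covectorIn w e x k * pd j (scalarIn φ e) x = 0

/-- The last `m` coordinates of a point of `ℝ^{m+1}`. -/
def fiberCoord {m : ℕ} (x : EuclideanSpace ℝ (Fin (m + 1))) : EuclideanSpace ℝ (Fin m) :=
  WithLp.toLp 2 (fun a => x a.succ)

/-- Near `p` the manifold is a warped product `1 ×_{e^q} M*` with Einstein fibre: there are a chart
around `p` with image `(a, b) × U`, a smooth function `q` on `(a, b)` and an Einstein metric `g*` on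
`U` such that `ds² = (dx¹)² + e^{q(x¹)} g*_{αβ}(x², …, xⁿ) dx^α dx^β` in this chart. -/
def IsWarpedEinsteinNear {m : ℕ} {M : Type*} [TopologicalSpace M]
    [ChartedSpace (EuclideanSpace ℝ (Fin (m + 1))) M] [IsManifold (𝓡 (m + 1)) ∞ M]
    (g : Metric (m + 1) M) (p : M) : Prop :=
  ∃ e ∈ charts (m + 1) M, p ∈ e.source ∧
  ∃ (a b : ℝ) (U : Set (EuclideanSpace ℝ (Fin m))) (q : ℝ → ℝ)
    (G : EuclideanSpace ℝ (Fin m) → Matrix (Fin m) (Fin m) ℝ),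
    IsOpen U ∧ e.target = {x | x 0 ∈ Set.Ioo a b ∧ fiberCoord x ∈ U} ∧
    ContDiffOn ℝ ∞ q (Set.Ioo a b) ∧ IsMetricOn U G ∧ IsEinsteinOn U G ∧
    ∀ x ∈ e.target,
      metricIn g e x 0 0 = 1 ∧
      (∀ α : Fin m, metricIn g e x 0 α.succ = 0 ∧ metricIn g e x α.succ 0 = 0) ∧
      ∀ α β : Fin m,
        metricIn g e x α.succ β.succ = Real.exp (q (x 0)) * G (fiberCoord x) α β

/-- Near `p` the manifold is subprojective in the sense of Kagan: there is a chart around `p` in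
which every geodesic lies in a two-dimensional plane through one fixed point, which is taken as the
origin of the coordinates. -/
def IsSubprojectiveNear (g : Metric n M) (p : M) : Prop :=
  ∃ e ∈ charts n M, p ∈ e.source ∧
    ∀ (J : Set ℝ) (γ : ℝ → EuclideanSpace ℝ (Fin n)),
      IsOpen J → IsPreconnected J → (∀ t ∈ J, γ t ∈ e.target) →
      IsGeodesicOn (metricIn g e) γ J →
      ∃ P : Submodule ℝ (EuclideanSpace ℝ (Fin n)), Module.finrank ℝ P = 2 ∧ ∀ t ∈ J, γ t ∈ P

end WeaklyZ

end

/-!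
Everything is local, so the argument is carried out in one chart, with tensors written index-free as
(multi)linear maps depending on a point of `ℝⁿ` (`IsLeviCivita`, `curv`, `nablaForm`); section
"Components and index-free tensors" translates between these and the component formulas.

*Algebra.* Vanishing of the Weyl tensor says that the curvature is the Kulkarni-Nomizu product of
the metric with the Schouten tensor `P`, and for `n ≥ 4` the second Bianchi identity makes `P` a
Codazzi tensor (`IsLeviCivita.codazzi_schouten`). Since `Z = (n - 2) P + ψ g` for a function `ψ`,
antisymmetrizing weak `Z` symmetry gives `ω ∧ Z = dψ ∧ g`, hence `Z = λ g + ν u ⊗ u` where `u` is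
the unit covector along `ω` (`eq_of_wedge_eq`); non-singularity gives `λ ≠ 0`. Inserting this into
weak `Z` symmetry again yields `∇u = H (g - u ⊗ u)` wherever `ν ≠ 0`, together with a linear
equation `dν = ν θ`, so that `ν` either vanishes identically near the point or not at all. In the
first case the metric has constant curvature and a unit field with the same property comes from a
solution of a flat linear system. In both cases there is a unit field `U` with
`∇_X U = H (X - u(X) U)` and `P = a g + b u ⊗ u` (`IsConcircular`, `IsLeviCivita.exists_isConcircular`);
the Codazzi equation and the Ricci identity then give `da = b H u` and `dH = -(H² + 2a + b) u`.

*Coordinates.* These relations are the integrability conditions of two linear systems, solved by the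
Frobenius theorem `exists_solution_total_differential`: `dρ = u`, and the Hessian equation
`∇dw = -H (u ⊗ dw + dw ⊗ u) - (2a + H²) w (g - u ⊗ u)`, `dw(U) = 0` of `IsFibreFunction`, which has
an `n`-dimensional space of solutions `w_0, …, w_{n-1}`.

*Warped product.* In the coordinates `(ρ, w_α / w_0)` the field `U` is the first coordinate field.
The leaves `ρ = const` are orthogonal to it, umbilical with the function `H` of `ρ` alone as mean
curvature, and therefore homothetic to each other along the flow of `U`; this gives the warped
product. By the Gauss equation (`curv_of_leaf`) a leaf has constant curvature, so the fibre is
Einstein.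

*Subprojectivity.* Along a geodesic all fibre functions solve one and the same scalar equation
`W'' = α W' + β W`, so the vector `(w_0, …, w_{n-1})` stays in a plane through the origin
(`exists_plane_of_linear_ode`), and so does its multiple `e^ρ (w_0, …, w_{n-1})`, which serves as a
system of coordinates.
-/

open scoped Manifold ContDiff

noncomputable section

set_option maxSynthPendingDepth 3

namespace WeaklyZ

/-! ### Linear total differential equations -/

section TotalDifferential

open Metric Set

variable {E W : Type*} [NormedAddCommGroup E] [NormedSpace ℝ E]
  [NormedAddCommGroup W] [NormedSpace ℝ W]

/-- First order Taylor estimate for a map with Lipschitz derivative. -/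
theorem norm_sub_sub_fderiv_le {f : E → W} {s : Set E} (hs : Convex ℝ s) (hso : IsOpen s)
    (hf : ContDiffOn ℝ 1 f s) {L : ℝ} (hL : ∀ x ∈ s, ∀ y ∈ s,
      ‖fderiv ℝ f y - fderiv ℝ f x‖ ≤ L * ‖y - x‖) (hL0 : 0 ≤ L) {x y : E} (hx : x ∈ s) (hy : y ∈ s) :
    ‖f y - f x - fderiv ℝ f x (y - x)‖ ≤ L * ‖y - x‖ * ‖y - x‖ := by
  have hsub : segment ℝ x y ⊆ s := hs.segment_subset hx hy
  refine Convex.norm_image_sub_le_of_norm_hasFDerivWithin_le' (s := segment ℝ x y)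
    (f' := fun z => fderiv ℝ f z) (fun z hz => ?_) (fun z hz => ?_) (convex_segment x y)
    (left_mem_segment ℝ x y) (right_mem_segment ℝ x y)
  · exact ((hf.differentiableOn (by simp)).differentiableAt
      (hso.mem_nhds (hsub hz))).hasFDerivAt.hasFDerivWithinAt
  · refine (hL x hx z (hsub hz)).trans (mul_le_mul_of_nonneg_left ?_ hL0)
    obtain ⟨a, b, ha, hb, hab, rfl⟩ := hz
    have : a • x + b • y - x = b • (y - x) := by
      rw [← sub_eq_iff_eq_add.2 hab.symm]; module
    rw [this, norm_smul, Real.norm_of_nonneg hb]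
    exact mul_le_of_le_one_left (norm_nonneg _) (by linarith)

/-- Along every ray from `x₀` the equation becomes a linear ordinary differential equation, solvable
up to time `1` over a small ball. -/
theorem exists_radial_solution [CompleteSpace W] (A : E → E →L[ℝ] W →L[ℝ] W) {x₀ : E} {r C : ℝ}
    (hA : ContinuousOn A (ball x₀ r)) (hC : ∀ x ∈ ball x₀ r, ‖A x‖ ≤ C) (hC0 : 0 ≤ C)
    (hCr : C * r ≤ 1 / 2) (w₀ : W) {x : E} (hx : x ∈ ball x₀ r) :
    ∃ f : ℝ → W, f 0 = w₀ ∧ ∀ t ∈ Icc (0 : ℝ) 1, HasDerivWithinAt f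
      (A (x₀ + t • (x - x₀)) (x - x₀) (f t)) (Icc 0 1) t := by
  have hxr : ‖x - x₀‖ < r := by simpa [dist_eq_norm] using hx
  have hpath : ∀ t ∈ Icc (0 : ℝ) 1, x₀ + t • (x - x₀) ∈ ball x₀ r := by
    intro t ht
    simp only [mem_ball, dist_eq_norm, add_sub_cancel_left, norm_smul, Real.norm_of_nonneg ht.1]
    exact (mul_le_of_le_one_left (norm_nonneg _) ht.2).trans_lt hxr
  have hop : ∀ t ∈ Icc (0 : ℝ) 1, ‖A (x₀ + t • (x - x₀)) (x - x₀)‖ ≤ 1 / 2 := by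
    intro t ht
    refine ((A _).le_opNorm _).trans (le_trans ?_ hCr)
    exact mul_le_mul (hC _ (hpath t ht)) hxr.le (norm_nonneg _) hC0
  have hPL : IsPicardLindelof (fun t w => A (x₀ + t • (x - x₀)) (x - x₀) w)
      (⟨0, by simp⟩ : Icc (0 : ℝ) 1) w₀ (‖w₀‖₊ + 1) 0 (‖w₀‖₊ + 1) 1 := by
    refine ⟨fun t ht => ?_, fun w hw => ?_, fun t ht w hw => ?_, ?_⟩
    · refine LipschitzOnWith.of_dist_le_mul fun v hv w hw => ?_
      rw [dist_eq_norm, dist_eq_norm, ← map_sub]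
      refine ((A _ _).le_opNorm _).trans ?_
      have := hop t ht
      exact mul_le_mul_of_nonneg_right (this.trans (by norm_num)) (norm_nonneg _)
    · have h1 : ContinuousOn (fun t : ℝ => A (x₀ + t • (x - x₀))) (Icc 0 1) :=
        hA.comp (by fun_prop) hpath
      exact (h1.clm_apply continuousOn_const).clm_apply continuousOn_const
    · have hw' : ‖w‖ ≤ 2 * ‖w₀‖ + 1 := by
        have h1 : ‖w - w₀‖ ≤ ‖w₀‖ + 1 := by simpa [dist_eq_norm] using hw
        have h2 := norm_le_norm_add_norm_sub' w w₀
        linarith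
      refine ((A _ _).le_opNorm _).trans ?_
      have := mul_le_mul (hop t ht) hw' (norm_nonneg _) (by norm_num)
      refine this.trans ?_
      simp only [NNReal.coe_add, coe_nnnorm, NNReal.coe_one]
      linarith
    · simp
  obtain ⟨f, hf0, hf⟩ := hPL.exists_eq_forall_mem_Icc_hasDerivWithinAt₀
  exact ⟨f, hf0, hf⟩

/-- If the radial solution `f x` over the point `x` of a ball around `x₀` is compared with the one
over `y`, the candidate differential `A x (y - x) (f x 1)` is correct up to an error of second
order. Flatness says that it solves the linearized equation. -/
theorem radial_solution_taylor (A : E → E →L[ℝ] W →L[ℝ] W) {x₀ : E} {r C L : ℝ}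
    (hr1 : r ≤ 1) (hA : ContDiffOn ℝ 1 A (ball x₀ r))
    (hC : ∀ x ∈ ball x₀ r, ‖A x‖ ≤ C) (hC0 : 0 ≤ C) (hCr : C * r ≤ 1 / 2) (hL0 : 0 ≤ L)
    (hL1 : ∀ x ∈ ball x₀ r, ∀ y ∈ ball x₀ r, ‖A y - A x‖ ≤ L * ‖y - x‖)
    (hL2 : ∀ x ∈ ball x₀ r, ∀ y ∈ ball x₀ r, ‖fderiv ℝ A y - fderiv ℝ A x‖ ≤ L * ‖y - x‖)
    (hflat : ∀ x ∈ ball x₀ r, ∀ X Y w, fderiv ℝ A x X Y w + A x Y (A x X w)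
      = fderiv ℝ A x Y X w + A x X (A x Y w)) {w₀ : W} {f : E → ℝ → W}
    (hf0 : ∀ x ∈ ball x₀ r, f x 0 = w₀)
    (hf : ∀ x ∈ ball x₀ r, ∀ t ∈ Icc (0 : ℝ) 1, HasDerivWithinAt (f x)
      (A (x₀ + t • (x - x₀)) (x - x₀) (f x t)) (Icc 0 1) t) {x : E} (hx : x ∈ ball x₀ r) :
    ∃ D : ℝ, ∀ y ∈ ball x₀ r,
      ‖f y 1 - f x 1 - A x (y - x) (f x 1)‖ ≤ D * ‖y - x‖ ^ 2 := by
  have hpath : ∀ x ∈ ball x₀ r, ∀ t ∈ Icc (0 : ℝ) 1, x₀ + t • (x - x₀) ∈ ball x₀ r := by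
    intro x hx t ht
    have hxr : ‖x - x₀‖ < r := by simpa [dist_eq_norm] using hx
    simp only [mem_ball, dist_eq_norm, add_sub_cancel_left, norm_smul, Real.norm_of_nonneg ht.1]
    exact (mul_le_of_le_one_left (norm_nonneg _) ht.2).trans_lt hxr
  have hfc : ∀ x ∈ ball x₀ r, ContinuousOn (f x) (Icc 0 1) := fun x hx t ht =>
    (hf x hx t ht).continuousWithinAt
  obtain ⟨M, hM⟩ := isCompact_Icc.exists_bound_of_continuousOn (hfc x hx)
  have hM0 : 0 ≤ M := (norm_nonneg _).trans (hM 0 (by simp))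
  set D := (L + L + (L + C) * C) * M with hD
  refine ⟨D * (Real.exp 1 - 1), fun y hy => ?_⟩
  set h := y - x with hh
  have hxr : ‖x - x₀‖ ≤ 1 := by
    have : ‖x - x₀‖ < r := by simpa [dist_eq_norm] using hx
    linarith
  have hyr : ‖y - x₀‖ ≤ r := by
    have : ‖y - x₀‖ < r := by simpa [dist_eq_norm] using hy
    linarith
  let px : ℝ → E := fun t => x₀ + t • (x - x₀)
  let py : ℝ → E := fun t => x₀ + t • (y - x₀)
  have hpp : ∀ t, py t - px t = t • h := fun t => by simp only [px, py, hh]; module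
  let V : ℝ → W := fun t => A (px t) (t • h) (f x t)
  let e : ℝ → W := fun t => f y t - f x t - V t
  let V' : ℝ → W := fun t => fderiv ℝ A (px t) (x - x₀) (t • h) (f x t) + A (px t) h (f x t)
    + A (px t) (t • h) (A (px t) (x - x₀) (f x t))
  let e' : ℝ → W := fun t => A (py t) (y - x₀) (f y t) - A (px t) (x - x₀) (f x t) - V' t
  have hV : ∀ t ∈ Icc (0 : ℝ) 1, HasDerivWithinAt V (V' t) (Icc 0 1) t := by
    intro t ht
    have hAd : HasFDerivAt A (fderiv ℝ A (px t)) (px t) :=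
      ((hA.differentiableOn (by simp)).differentiableAt
        (isOpen_ball.mem_nhds (hpath x hx t ht))).hasFDerivAt
    have hp : HasDerivWithinAt px (x - x₀) (Icc 0 1) t := by
      have := ((hasDerivAt_id t).smul_const (x - x₀)).const_add x₀
      simpa [px] using this.hasDerivWithinAt
    have h1 : HasDerivWithinAt (fun t => A (px t)) (fderiv ℝ A (px t) (x - x₀)) (Icc 0 1) t :=
      HasFDerivAt.comp_hasDerivWithinAt (f := px) t hAd hp
    have h2 : HasDerivWithinAt (fun t : ℝ => t • h) h (Icc 0 1) t := by
      simpa using ((hasDerivAt_id t).smul_const h).hasDerivWithinAt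
    have := (h1.clm_apply h2).clm_apply (hf x hx t ht)
    simpa [V, V', px] using this
  have he : ∀ t ∈ Icc (0 : ℝ) 1, HasDerivWithinAt e (e' t) (Icc 0 1) t := fun t ht =>
    ((hf y hy t ht).sub (hf x hx t ht)).sub (hV t ht)
  have key : ∀ t ∈ Icc (0 : ℝ) 1, ‖e' t‖ ≤ 1 * ‖e t‖ + D * ‖h‖ ^ 2 := by
    intro t ht
    have hpx := hpath x hx t ht
    have hpy := hpath y hy t ht
    change px t ∈ _ at hpx
    change py t ∈ _ at hpy
    have hth : ‖t • h‖ ≤ ‖h‖ := by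
      rw [norm_smul, Real.norm_of_nonneg ht.1]
      exact mul_le_of_le_one_left (norm_nonneg _) ht.2
    have hfl := hflat (px t) hpx (x - x₀) (t • h) (f x t)
    have hV'eq : V' t = fderiv ℝ A (px t) (t • h) (x - x₀) (f x t) + A (px t) h (f x t)
        + A (px t) (x - x₀) (V t) := by
      simp only [V', V]
      rw [add_right_comm, hfl, add_right_comm]
    have hyx : y - x₀ = (x - x₀) + h := by simp only [hh]; abel
    have hsplit : e' t = A (py t) (y - x₀) (e t)
        + ((A (py t) - A (px t) - fderiv ℝ A (px t) (t • h)) (x - x₀) (f x t)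
          + (A (py t) - A (px t)) h (f x t))
        + ((A (py t) - A (px t)) (x - x₀) (V t) + A (py t) h (V t)) := by
      simp only [e', e, hV'eq, hyx, map_add, map_sub, add_apply,
        sub_apply]
      abel
    have hft := hM t ht
    have b1 : ‖A (py t) (y - x₀) (e t)‖ ≤ 1 * ‖e t‖ := by
      refine ((A _ _).le_opNorm _).trans (mul_le_mul_of_nonneg_right ?_ (norm_nonneg _))
      refine ((A _).le_opNorm _).trans ?_
      exact (mul_le_mul (hC _ hpy) hyr (norm_nonneg _) hC0).trans (hCr.trans (by norm_num))
    have hAd : ‖A (py t) - A (px t)‖ ≤ L * ‖h‖ := by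
      refine (hL1 _ hpx _ hpy).trans ?_
      rw [hpp]; gcongr
    have b2 : ‖(A (py t) - A (px t) - fderiv ℝ A (px t) (t • h)) (x - x₀) (f x t)‖
        ≤ L * ‖h‖ * ‖h‖ * 1 * M := by
      refine ((ContinuousLinearMap.le_opNorm _ _)).trans ?_
      gcongr
      refine ((ContinuousLinearMap.le_opNorm _ _)).trans ?_
      gcongr
      have := norm_sub_sub_fderiv_le (convex_ball x₀ r) isOpen_ball hA hL2 hL0 hpx hpy
      rw [hpp] at this
      refine this.trans ?_
      gcongr
    have b3 : ‖(A (py t) - A (px t)) h (f x t)‖ ≤ L * ‖h‖ * ‖h‖ * M := by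
      refine ((ContinuousLinearMap.le_opNorm _ _)).trans ?_
      gcongr
      exact ((ContinuousLinearMap.le_opNorm _ _)).trans (by gcongr)
    have bV : ‖V t‖ ≤ C * ‖h‖ * M := by
      refine ((ContinuousLinearMap.le_opNorm _ _)).trans ?_
      gcongr
      refine ((ContinuousLinearMap.le_opNorm _ _)).trans ?_
      gcongr
      exact hC _ hpx
    have b4 : ‖(A (py t) - A (px t)) (x - x₀) (V t)‖ ≤ L * ‖h‖ * 1 * (C * ‖h‖ * M) := by
      refine ((ContinuousLinearMap.le_opNorm _ _)).trans ?_
      gcongr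
      exact ((ContinuousLinearMap.le_opNorm _ _)).trans (by gcongr)
    have b5 : ‖A (py t) h (V t)‖ ≤ C * ‖h‖ * (C * ‖h‖ * M) := by
      refine ((ContinuousLinearMap.le_opNorm _ _)).trans ?_
      gcongr
      refine ((ContinuousLinearMap.le_opNorm _ _)).trans ?_
      gcongr
      exact hC _ hpy
    rw [hsplit]
    refine (norm_add₃_le).trans ?_
    have n1 := norm_add_le ((A (py t) - A (px t) - fderiv ℝ A (px t) (t • h)) (x - x₀) (f x t))
      ((A (py t) - A (px t)) h (f x t))
    have n2 := norm_add_le ((A (py t) - A (px t)) (x - x₀) (V t)) (A (py t) h (V t))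
    have : D * ‖h‖ ^ 2 = L * ‖h‖ * ‖h‖ * 1 * M + L * ‖h‖ * ‖h‖ * M
      + (L * ‖h‖ * 1 * (C * ‖h‖ * M) + C * ‖h‖ * (C * ‖h‖ * M)) := by rw [hD]; ring
    linarith
  have hgr := norm_le_gronwallBound_of_norm_deriv_right_le (f := e) (f' := e') (δ := 0) (K := 1)
    (ε := D * ‖h‖ ^ 2) (a := 0) (b := 1) (fun t ht => (he t ht).continuousWithinAt)
    (fun t ht => (he t (Ico_subset_Icc_self ht)).mono_of_mem_nhdsWithin
      (Icc_mem_nhdsGE_of_mem ht))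
    (by simp [e, V, hf0 x hx, hf0 y hy]) (fun t ht => key t (Ico_subset_Icc_self ht))
    1 (by simp)
  rw [gronwallBound_of_K_ne_0 one_ne_zero] at hgr
  have h1 : e 1 = f y 1 - f x 1 - A x h (f x 1) := by simp [e, V, px]
  rw [h1] at hgr
  refine hgr.trans (le_of_eq ?_)
  simp; ring

/-- **Frobenius theorem for linear total differential equations.** If the connection form `A` is
flat, then `dΦ = A Φ` has a smooth solution with arbitrary value at `x₀`, on a ball not depending on
that value. -/
theorem exists_solution_total_differential [CompleteSpace W] (A : E → E →L[ℝ] W →L[ℝ] W)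
    {Ω : Set E} (hΩ : IsOpen Ω) (hA : ContDiffOn ℝ ∞ A Ω) {x₀ : E} (hx₀ : x₀ ∈ Ω)
    (hflat : ∀ x ∈ Ω, ∀ X Y w, fderiv ℝ A x X Y w + A x Y (A x X w)
      = fderiv ℝ A x Y X w + A x X (A x Y w)) :
    ∃ r > 0, ball x₀ r ⊆ Ω ∧ ∀ w₀ : W, ∃ Φ : E → W, Φ x₀ = w₀ ∧ ContDiffOn ℝ ∞ Φ (ball x₀ r) ∧
      ∀ x ∈ ball x₀ r, ∀ X, fderiv ℝ Φ x X = A x X (Φ x) := by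
  have hAt : ContDiffAt ℝ ∞ A x₀ := hA.contDiffAt (hΩ.mem_nhds hx₀)
  obtain ⟨K1, s1, hs1, hK1⟩ := (hAt.of_le (m := 1) (by simp)).exists_lipschitzOnWith
  obtain ⟨K2, s2, hs2, hK2⟩ :=
    (hAt.fderiv_right (m := 1) (by norm_cast)).exists_lipschitzOnWith
  have hnb : ∀ᶠ x in nhds x₀, ‖A x‖ < ‖A x₀‖ + 1 :=
    hAt.continuousAt.norm.eventually_lt continuousAt_const (by simp)
  obtain ⟨r0, hr0, hball⟩ := Metric.mem_nhds_iff.1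
    (Filter.inter_mem (Filter.inter_mem hs1 hs2) (Filter.inter_mem hnb (hΩ.mem_nhds hx₀)))
  set C := ‖A x₀‖ + 1 with hCdef
  have hC0 : 0 < C := by positivity
  set r := min r0 (min 1 (1 / (2 * C))) with hr
  have hrpos : 0 < r := by positivity
  have hsub : ball x₀ r ⊆ ball x₀ r0 := ball_subset_ball (min_le_left _ _)
  have hCr : C * r ≤ 1 / 2 := by
    have : r ≤ 1 / (2 * C) := (min_le_right _ _).trans (min_le_right _ _)
    calc C * r ≤ C * (1 / (2 * C)) := by gcongr
      _ = 1 / 2 := by field_simp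
  have hr1 : r ≤ 1 := (min_le_right _ _).trans (min_le_left _ _)
  have hrΩ : ball x₀ r ⊆ Ω := fun x hx => (hball (hsub hx)).2.2
  have hC : ∀ x ∈ ball x₀ r, ‖A x‖ ≤ C := fun x hx => (hball (hsub hx)).2.1.le
  have hAr := hA.mono hrΩ
  refine ⟨r, hrpos, hrΩ, fun w₀ => ?_⟩
  choose! f hf0 hf using fun x (hx : x ∈ ball x₀ r) =>
    exists_radial_solution A hAr.continuousOn hC hC0.le hCr w₀ hx
  have hder : ∀ x ∈ ball x₀ r, HasFDerivAt (fun y => f y 1) ((A x).flip (f x 1)) x := by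
    intro x hx
    obtain ⟨D, hD⟩ := radial_solution_taylor A (L := max K1 K2) hr1 (hAr.of_le (by simp)) hC
      hC0.le hCr (le_max_of_le_left K1.2)
      (fun x hx y hy => by
        have := hK1.norm_sub_le (hball (hsub hy)).1.1 (hball (hsub hx)).1.1
        exact this.trans (by gcongr; exact le_max_left _ _))
      (fun x hx y hy => by
        have := hK2.norm_sub_le (hball (hsub hy)).1.2 (hball (hsub hx)).1.2
        exact this.trans (by gcongr; exact le_max_right _ _))
      (fun x hx => hflat x (hrΩ hx)) hf0 hf hx
    refine HasFDerivAt.of_isLittleO ?_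
    have hO : (fun y => f y 1 - f x 1 - (A x).flip (f x 1) (y - x)) =O[nhds x]
        fun y => ‖y - x‖ ^ 2 := by
      refine Asymptotics.IsBigO.of_bound D ?_
      filter_upwards [isOpen_ball.mem_nhds hx] with y hy
      simpa using hD y hy
    refine hO.trans_isLittleO ?_
    have h2 : (fun h : E => ‖h‖ ^ 2) =o[nhds 0] fun h : E => h :=
      Asymptotics.isLittleO_norm_pow_id one_lt_two
    have h3 : Filter.Tendsto (fun y => y - x) (nhds x) (nhds 0) := by
      have : ContinuousAt (fun y => y - x) x := by fun_prop
      simpa [ContinuousAt] using this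
    exact h2.comp_tendsto h3
  refine ⟨fun y => f y 1, ?_, ?_, fun x hx X => by rw [(hder x hx).fderiv]; rfl⟩
  · have h0 := mem_ball_self (x := x₀) hrpos
    have hconst : ∀ t ∈ Ico (0 : ℝ) 1, HasDerivWithinAt (f x₀) 0 (Ici t) t := by
      intro t ht
      have := hf x₀ h0 t (Ico_subset_Icc_self ht)
      simp only [sub_self, map_zero, zero_apply] at this
      exact this.mono_of_mem_nhdsWithin (Icc_mem_nhdsGE_of_mem ht)
    have := constant_of_has_deriv_right_zero
      (fun t ht => (hf x₀ h0 t ht).continuousWithinAt) hconst 1 (by simp)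
    exact this.trans (hf0 x₀ h0)
  · -- the equation itself gains one derivative at a time
    refine contDiffOn_infty.2 fun k => ?_
    induction k with
    | zero =>
      exact contDiffOn_zero.2 fun x hx => (hder x hx).continuousAt.continuousWithinAt
    | succ k ih =>
      have hk : ((k + 1 : ℕ) : ℕ∞ω) = (k : ℕ∞ω) + 1 := by norm_cast
      rw [hk, contDiffOn_succ_iff_fderiv_of_isOpen isOpen_ball]
      refine ⟨fun x hx => (hder x hx).differentiableAt.differentiableWithinAt, by simp, ?_⟩
      have h1 : ContDiffOn ℝ k (fun x => (A x).flip (f x 1)) (ball x₀ r) := by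
        have : ContDiffOn ℝ k (fun x => ContinuousLinearMap.flipₗᵢ ℝ E W W (A x)) (ball x₀ r) :=
          (ContinuousLinearMap.flipₗᵢ ℝ E W W).contDiff.comp_contDiffOn
            (hAr.of_le (by exact_mod_cast le_top))
        exact this.clm_apply ih
      exact h1.congr fun x hx => (hder x hx).fderiv

/-- Uniqueness for linear ordinary differential equations with continuous coefficients. -/
theorem eq_zero_of_linear_ode {f : ℝ → W} {L : ℝ → W →L[ℝ] W} {J : Set ℝ}
    (hJc : IsPreconnected J) (hL : ContinuousOn L J) (hf : ∀ t ∈ J, HasDerivAt f (L t (f t)) t)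
    {t₀ : ℝ} (ht₀ : t₀ ∈ J) (h0 : f t₀ = 0) {t : ℝ} (ht : t ∈ J) : f t = 0 := by
  rcases le_total t₀ t with hle | hle
  · have hsub : Icc t₀ t ⊆ J := hJc.Icc_subset ht₀ ht
    obtain ⟨K, hK⟩ := isCompact_Icc.exists_bound_of_continuousOn (hL.mono hsub)
    refine eq_zero_of_abs_deriv_le_mul_abs_self_of_eq_zero_right (f' := fun s => L s (f s)) (K := K)
      (fun s hs => (hf s (hsub hs)).continuousAt.continuousWithinAt)
      (fun s hs => (hf s (hsub (Ico_subset_Icc_self hs))).hasDerivWithinAt) h0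
      (fun s hs => ?_) t ⟨hle, le_rfl⟩
    exact ((L s).le_opNorm _).trans
      (mul_le_mul_of_nonneg_right (hK s (Ico_subset_Icc_self hs)) (norm_nonneg _))
  · have hsub : Icc t t₀ ⊆ J := hJc.Icc_subset ht ht₀
    obtain ⟨K, hK⟩ := isCompact_Icc.exists_bound_of_continuousOn (hL.mono hsub)
    have hneg : ∀ s ∈ Icc (-t₀) (-t), -s ∈ Icc t t₀ := fun s hs => ⟨by linarith [hs.2],
      by linarith [hs.1]⟩
    have hd : ∀ s ∈ Icc (-t₀) (-t),
        HasDerivAt (fun s => f (-s)) (-(L (-s) (f (-s)))) s := by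
      intro s hs
      simpa [Function.comp_def] using (hf (-s) (hsub (hneg s hs))).scomp s (hasDerivAt_neg s)
    have := eq_zero_of_abs_deriv_le_mul_abs_self_of_eq_zero_right (f := fun s => f (-s))
      (f' := fun s => -(L (-s) (f (-s)))) (K := K)
      (fun s hs => (hd s hs).continuousAt.continuousWithinAt)
      (fun s hs => (hd s (Ico_subset_Icc_self hs)).hasDerivWithinAt) (by simpa using h0)
      (fun s hs => ?_) (-t) ⟨by linarith, le_rfl⟩
    · simpa using this
    · rw [norm_neg]
      exact ((L _).le_opNorm _).trans
        (mul_le_mul_of_nonneg_right (hK _ (hneg s (Ico_subset_Icc_self hs))) (norm_nonneg _))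

/-- A function with `dν = ν θ` on a ball vanishes identically as soon as it vanishes at the
centre. -/
theorem eq_zero_of_fderiv_eq_mul {ν : E → ℝ} {θ : E → E →L[ℝ] ℝ} {x₀ : E} {r : ℝ}
    (hν : DifferentiableOn ℝ ν (ball x₀ r)) (hθ : ContinuousOn θ (ball x₀ r))
    (h : ∀ x ∈ ball x₀ r, ∀ X, fderiv ℝ ν x X = ν x * θ x X) (h0 : ν x₀ = 0) {x : E}
    (hx : x ∈ ball x₀ r) : ν x = 0 := by
  let p : ℝ → E := fun t => x₀ + t • (x - x₀)
  have hp : Continuous p := by fun_prop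
  have hpl : p = AffineMap.lineMap x₀ x := by
    ext t; simp [p, AffineMap.lineMap_apply, add_comm]
  have hconv : Convex ℝ (p ⁻¹' ball x₀ r) := by
    rw [hpl]; exact (convex_ball x₀ r).affine_preimage _
  have hr : 0 < r := by
    have := dist_nonneg.trans_lt (mem_ball.1 hx); exact this
  have h1 : ν (p 1) = 0 := by
    refine eq_zero_of_linear_ode (f := fun t => ν (p t))
      (L := fun t => (θ (p t) (x - x₀)) • ContinuousLinearMap.id ℝ ℝ)
      hconv.isPreconnected ?_ (fun t ht => ?_) (t₀ := 0)
      (by simp [p, hr]) (by simp [p, h0]) (by simpa [p] using hx)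
    · exact (((hθ.comp hp.continuousOn fun t ht => ht).clm_apply
        continuousOn_const)).smul continuousOn_const
    · have hd : HasDerivAt p (x - x₀) t := by
        simpa [p] using (hasDerivAt_id t).smul_const (x - x₀)
      have hfd := (hν.differentiableAt (isOpen_ball.mem_nhds ht)).hasFDerivAt
      have := hfd.comp_hasDerivAt t hd
      rw [h _ ht] at this
      simpa [mul_comm, Function.comp_def] using this
  simpa [p] using h1

end TotalDifferential

/-! ### Index-free tensor calculus on an open set -/

section Calculus

variable {E : Type*} [NormedAddCommGroup E] [NormedSpace ℝ E]
  {F : Type*} [NormedAddCommGroup F] [NormedSpace ℝ F]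

/-- Derivative of a map along the line `t ↦ x + t W`; all differentiations of tensor fields applied
to constant vectors below are carried out along such lines. -/
theorem hasDerivAt_along {A : E → F} {x : E} (h : DifferentiableAt ℝ A x) (W : E) :
    HasDerivAt (fun t : ℝ => A (x + t • W)) (fderiv ℝ A x W) 0 := by
  have hl : HasDerivAt (fun t : ℝ => x + t • W) W 0 := by
    simpa using (hasDerivAt_id (0 : ℝ)).smul_const W
  have hA : HasFDerivAt A (fderiv ℝ A x) (x + (0 : ℝ) • W) := by simpa using h.hasFDerivAt
  exact HasFDerivAt.comp_hasDerivAt (f := fun t : ℝ => x + t • W) 0 hA hl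

theorem eventually_along {Ω : Set E} (hΩ : IsOpen Ω) {x : E} (hx : x ∈ Ω) (W : E) :
    ∀ᶠ t : ℝ in nhds 0, x + t • W ∈ Ω := by
  have : ContinuousAt (fun t : ℝ => x + t • W) 0 := by fun_prop
  exact this.eventually_mem (by simpa using hΩ.mem_nhds hx)

/-- Two functions which agree on an open set have the same derivatives along lines there. -/
theorem deriv_along_unique {f f' : E → F} {d d' : F} {Ω : Set E} (hΩ : IsOpen Ω) {x : E}
    (hx : x ∈ Ω) {W : E} (h : HasDerivAt (fun t : ℝ => f (x + t • W)) d 0)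
    (h' : HasDerivAt (fun t : ℝ => f' (x + t • W)) d' 0) (heq : ∀ y ∈ Ω, f y = f' y) : d = d' := by
  refine (h.congr_of_eventuallyEq ?_).unique h'
  filter_upwards [eventually_along hΩ hx W] with t ht
  exact (heq _ ht).symm

/-- A metric `g` on the open set `Ω`, together with its Levi-Civita connection `∇ = d + Γ`: the
bilinear map `Γ x` is the contraction with the Christoffel symbols at `x`. -/
structure IsLeviCivita (Ω : Set E) (g : E → E →L[ℝ] E →L[ℝ] ℝ)
    (Γ : E → E →L[ℝ] E →L[ℝ] E) : Prop where
  isOpen : IsOpen Ω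
  smooth_metric : ContDiffOn ℝ ∞ g Ω
  smooth_conn : ContDiffOn ℝ ∞ Γ Ω
  symm : ∀ x ∈ Ω, ∀ X Y, g x X Y = g x Y X
  pos : ∀ x ∈ Ω, ∀ X, X ≠ 0 → 0 < g x X X
  torsion_free : ∀ x ∈ Ω, ∀ X Y, Γ x X Y = Γ x Y X
  compat : ∀ x ∈ Ω, ∀ X Y Z, fderiv ℝ g x X Y Z = g x (Γ x X Y) Z + g x Y (Γ x X Z)

/-- The curvature of `∇ = d + Γ`, with the sign for which `(∇_X ∇_Y - ∇_Y ∇_X) V = V ∘ curv X Y`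
on covector fields `V`; on vector fields the commutator is `-curv X Y`. -/
def curv (Γ : E → E →L[ℝ] E →L[ℝ] E) (x X Y Z : E) : E :=
  fderiv ℝ Γ x Y X Z - fderiv ℝ Γ x X Y Z + Γ x Y (Γ x X Z) - Γ x X (Γ x Y Z)

/-- The covariant derivative `∇_X V` of a vector field. -/
def nablaVec (Γ : E → E →L[ℝ] E →L[ℝ] E) (V : E → E) (x X : E) : E :=
  fderiv ℝ V x X + Γ x X (V x)

/-- The covariant derivative `(∇_X S)(Y, Z)` of a bilinear form. -/
def nablaForm (Γ : E → E →L[ℝ] E →L[ℝ] E) (S : E → E →L[ℝ] E →L[ℝ] ℝ) (x X Y Z : E) : ℝ :=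
  fderiv ℝ S x X Y Z - S x (Γ x X Y) Z - S x Y (Γ x X Z)

/-- `P` is a Schouten tensor: the curvature is minus the Kulkarni-Nomizu product of `P` and `g`.
In dimension at least three this says that the Weyl tensor vanishes. -/
def IsSchouten (Ω : Set E) (g : E → E →L[ℝ] E →L[ℝ] ℝ) (Γ : E → E →L[ℝ] E →L[ℝ] E)
    (P : E → E →L[ℝ] E →L[ℝ] ℝ) : Prop :=
  ∀ x ∈ Ω, ∀ X Y Z V, g x (curv Γ x X Y Z) V =
    -(P x Y Z * g x X V - P x X Z * g x Y V + g x Y Z * P x X V - g x X Z * P x Y V)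

variable {Ω : Set E} {g : E → E →L[ℝ] E →L[ℝ] ℝ} {Γ : E → E →L[ℝ] E →L[ℝ] E}

namespace IsLeviCivita

theorem mono (h : IsLeviCivita Ω g Γ) {Ω' : Set E} (h' : IsOpen Ω') (hs : Ω' ⊆ Ω) :
    IsLeviCivita Ω' g Γ :=
  ⟨h', h.smooth_metric.mono hs, h.smooth_conn.mono hs, fun x hx => h.symm x (hs hx),
    fun x hx => h.pos x (hs hx), fun x hx => h.torsion_free x (hs hx),
    fun x hx => h.compat x (hs hx)⟩

variable (h : IsLeviCivita Ω g Γ)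
include h

theorem metricAt {x : E} (hx : x ∈ Ω) : DifferentiableAt ℝ g x :=
  (h.smooth_metric.differentiableOn (by simp)).differentiableAt (h.isOpen.mem_nhds hx)

theorem connAt {x : E} (hx : x ∈ Ω) : DifferentiableAt ℝ Γ x :=
  (h.smooth_conn.differentiableOn (by simp)).differentiableAt (h.isOpen.mem_nhds hx)

theorem fderiv_connAt {x : E} (hx : x ∈ Ω) : DifferentiableAt ℝ (fderiv ℝ Γ) x :=
  ((h.smooth_conn.contDiffAt (h.isOpen.mem_nhds hx)).fderiv_right (m := 1)
    (by norm_cast)).differentiableAt (by simp)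

/-- Nondegeneracy. -/
theorem eq_of_inner {x : E} (hx : x ∈ Ω) {X Y : E} (hXY : ∀ V, g x X V = g x Y V) : X = Y := by
  by_contra hne
  have := h.pos x hx (X - Y) (sub_ne_zero.2 hne)
  simp only [map_sub, sub_apply] at this
  rw [hXY X, hXY Y] at this
  simp at this

theorem fderiv_conn_symm {x : E} (hx : x ∈ Ω) (X Y Z : E) :
    fderiv ℝ Γ x X Y Z = fderiv ℝ Γ x X Z Y := by
  have h1 := ((hasDerivAt_along (h.connAt hx) X).clm_apply (hasDerivAt_const 0 Y)).clm_apply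
    (hasDerivAt_const 0 Z)
  have h2 := ((hasDerivAt_along (h.connAt hx) X).clm_apply (hasDerivAt_const 0 Z)).clm_apply
    (hasDerivAt_const 0 Y)
  have := deriv_along_unique (f := fun y => Γ y Y Z) (f' := fun y => Γ y Z Y) h.isOpen hx h1 h2
    (fun y hy => h.torsion_free y hy Y Z)
  simpa using this

/-- The first Bianchi identity. -/
theorem bianchi_one {x : E} (hx : x ∈ Ω) (X Y Z : E) :
    curv Γ x X Y Z + curv Γ x Y Z X + curv Γ x Z X Y = 0 := by
  simp only [curv]
  rw [h.fderiv_conn_symm hx X Y Z, h.fderiv_conn_symm hx Y X Z, h.fderiv_conn_symm hx Z X Y,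
    h.torsion_free x hx X Y, h.torsion_free x hx X Z, h.torsion_free x hx Y Z]
  abel

theorem hasDerivAt_curv {x : E} (hx : x ∈ Ω) (W X Y Z : E) :
    HasDerivAt (fun t : ℝ => curv Γ (x + t • W) X Y Z)
      (fderiv ℝ (fderiv ℝ Γ) x W Y X Z - fderiv ℝ (fderiv ℝ Γ) x W X Y Z
        + (fderiv ℝ Γ x W Y (Γ x X Z) + Γ x Y (fderiv ℝ Γ x W X Z))
        - (fderiv ℝ Γ x W X (Γ x Y Z) + Γ x X (fderiv ℝ Γ x W Y Z))) 0 := by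
  have dG := hasDerivAt_along (h.connAt hx) W
  have dD := hasDerivAt_along (h.fderiv_connAt hx) W
  have c := fun v : E => hasDerivAt_const (0 : ℝ) v
  have := ((((dD.clm_apply (c Y)).clm_apply (c X)).clm_apply (c Z)).sub
    (((dD.clm_apply (c X)).clm_apply (c Y)).clm_apply (c Z))).add
    ((dG.clm_apply (c Y)).clm_apply ((dG.clm_apply (c X)).clm_apply (c Z))) |>.sub
    ((dG.clm_apply (c X)).clm_apply ((dG.clm_apply (c Y)).clm_apply (c Z)))
  exact this.congr_deriv (by simp)

/-- The second Bianchi identity. -/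
theorem bianchi_two {x : E} (hx : x ∈ Ω) (W X Y Z : E) {dX dY dW : E}
    (hW : HasDerivAt (fun t : ℝ => curv Γ (x + t • W) X Y Z) dW 0)
    (hX : HasDerivAt (fun t : ℝ => curv Γ (x + t • X) Y W Z) dX 0)
    (hY : HasDerivAt (fun t : ℝ => curv Γ (x + t • Y) W X Z) dY 0) :
    (dW + Γ x W (curv Γ x X Y Z) - curv Γ x X Y (Γ x W Z))
      + (dX + Γ x X (curv Γ x Y W Z) - curv Γ x Y W (Γ x X Z))
      + (dY + Γ x Y (curv Γ x W X Z) - curv Γ x W X (Γ x Y Z)) = 0 := by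
  have hs : ∀ A B, fderiv ℝ (fderiv ℝ Γ) x A B = fderiv ℝ (fderiv ℝ Γ) x B A := fun A B =>
    ((h.smooth_conn.contDiffAt (h.isOpen.mem_nhds hx)).isSymmSndFDerivAt
      (by simp only [minSmoothness_of_isRCLikeNormedField]; exact WithTop.coe_le_coe.2 le_top)).eq A B
  rw [hW.unique (h.hasDerivAt_curv hx W X Y Z), hX.unique (h.hasDerivAt_curv hx X Y W Z),
    hY.unique (h.hasDerivAt_curv hx Y W X Z), hs X W, hs Y W, hs Y X]
  simp only [curv, map_add, map_sub]
  abel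

/-- The derivative along `W` of the relation between curvature and Schouten tensor. -/
theorem hasDerivAt_schouten {P : E → E →L[ℝ] E →L[ℝ] ℝ} (hP : IsSchouten Ω g Γ P)
    (hPs : ContDiffOn ℝ ∞ P Ω) {x : E} (hx : x ∈ Ω) (W X Y Z V : E) {dW : E}
    (dC : HasDerivAt (fun t : ℝ => curv Γ (x + t • W) X Y Z) dW 0) :
    g x dW V = -(g x (Γ x W (curv Γ x X Y Z)) V + g x (curv Γ x X Y Z) (Γ x W V)) -
        ((fderiv ℝ P x W Y Z * g x X V + P x Y Z * (g x (Γ x W X) V + g x X (Γ x W V)))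
        - (fderiv ℝ P x W X Z * g x Y V + P x X Z * (g x (Γ x W Y) V + g x Y (Γ x W V)))
        + ((g x (Γ x W Y) Z + g x Y (Γ x W Z)) * P x X V + g x Y Z * fderiv ℝ P x W X V)
        - ((g x (Γ x W X) Z + g x X (Γ x W Z)) * P x Y V + g x X Z * fderiv ℝ P x W Y V)) := by
  have hPd : DifferentiableAt ℝ P x :=
    (hPs.differentiableOn (by simp)).differentiableAt (h.isOpen.mem_nhds hx)
  have dg := hasDerivAt_along (h.metricAt hx) W
  have dP := hasDerivAt_along hPd W
  have d1 : HasDerivAt (fun t : ℝ => g (x + t • W) (curv Γ (x + t • W) X Y Z) V)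
      (fderiv ℝ g x W (curv Γ x X Y Z) V + g x dW V) 0 :=
    ((dg.clm_apply dC).clm_apply (hasDerivAt_const 0 V)).congr_deriv (by simp)
  have a : ∀ A B : E, HasDerivAt (fun t : ℝ => g (x + t • W) A B) (fderiv ℝ g x W A B) 0 :=
    fun A B => ((dg.clm_apply (hasDerivAt_const 0 A)).clm_apply
      (hasDerivAt_const 0 B)).congr_deriv (by simp)
  have b : ∀ A B : E, HasDerivAt (fun t : ℝ => P (x + t • W) A B) (fderiv ℝ P x W A B) 0 :=
    fun A B => ((dP.clm_apply (hasDerivAt_const 0 A)).clm_apply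
      (hasDerivAt_const 0 B)).congr_deriv (by simp)
  have d2 := ((((b Y Z).mul (a X V)).sub ((b X Z).mul (a Y V))).add
    ((a Y Z).mul (b X V)) |>.sub ((a X Z).mul (b Y V))).neg
  have := deriv_along_unique (f := fun y => g y (curv Γ y X Y Z) V)
    (f' := fun y => -(P y Y Z * g y X V - P y X Z * g y Y V + g y Y Z * P y X V
      - g y X Z * P y Y V)) h.isOpen hx d1 d2 (fun y hy => hP y hy X Y Z V)
  simp only [zero_smul, add_zero, h.compat x hx] at this
  linear_combination this

set_option maxHeartbeats 2000000 in
/-- The second Bianchi identity expressed through the Cotton tensor `∇_X P(Y, Z) - ∇_Y P(X, Z)`. -/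
theorem cotton_cyclic {P : E → E →L[ℝ] E →L[ℝ] ℝ} (hP : IsSchouten Ω g Γ P)
    (hPs : ContDiffOn ℝ ∞ P Ω) {x : E} (hx : x ∈ Ω) (W X Y Z V : E) :
    g x X V * (nablaForm Γ P x W Y Z - nablaForm Γ P x Y W Z)
      + g x Y V * (nablaForm Γ P x X W Z - nablaForm Γ P x W X Z)
      + g x W V * (nablaForm Γ P x Y X Z - nablaForm Γ P x X Y Z)
      + g x Y Z * (nablaForm Γ P x W X V - nablaForm Γ P x X W V)
      + g x W Z * (nablaForm Γ P x X Y V - nablaForm Γ P x Y X V)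
      + g x X Z * (nablaForm Γ P x Y W V - nablaForm Γ P x W Y V) = 0 := by
  have hW := h.hasDerivAt_curv hx W X Y Z
  have hX := h.hasDerivAt_curv hx X Y W Z
  have hY := h.hasDerivAt_curv hx Y W X Z
  have hb := h.bianchi_two hx W X Y Z hW hX hY
  have eW := h.hasDerivAt_schouten hP hPs hx W X Y Z V hW
  have eX := h.hasDerivAt_schouten hP hPs hx X Y W Z V hX
  have eY := h.hasDerivAt_schouten hP hPs hx Y W X Z V hY
  clear hW hX hY
  generalize fderiv ℝ (fderiv ℝ Γ) x W Y X Z - fderiv ℝ (fderiv ℝ Γ) x W X Y Z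
        + (fderiv ℝ Γ x W Y (Γ x X Z) + Γ x Y (fderiv ℝ Γ x W X Z))
        - (fderiv ℝ Γ x W X (Γ x Y Z) + Γ x X (fderiv ℝ Γ x W Y Z)) = dW at hb eW
  generalize fderiv ℝ (fderiv ℝ Γ) x X W Y Z - fderiv ℝ (fderiv ℝ Γ) x X Y W Z
        + (fderiv ℝ Γ x X W (Γ x Y Z) + Γ x W (fderiv ℝ Γ x X Y Z))
        - (fderiv ℝ Γ x X Y (Γ x W Z) + Γ x Y (fderiv ℝ Γ x X W Z)) = dX at hb eX
  generalize fderiv ℝ (fderiv ℝ Γ) x Y X W Z - fderiv ℝ (fderiv ℝ Γ) x Y W X Z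
        + (fderiv ℝ Γ x Y X (Γ x W Z) + Γ x X (fderiv ℝ Γ x Y W Z))
        - (fderiv ℝ Γ x Y W (Γ x X Z) + Γ x W (fderiv ℝ Γ x Y X Z)) = dY at hb eY
  have hb' := congrArg (fun v => g x v V) hb
  simp only [map_add, map_sub, add_apply, sub_apply, map_zero, zero_apply] at hb'
  rw [eW, eX, eY] at hb'
  have p1 := hP x hx X Y Z (Γ x W V)
  have p2 := hP x hx Y W Z (Γ x X V)
  have p3 := hP x hx W X Z (Γ x Y V)
  have p4 := hP x hx X Y (Γ x W Z) V
  have p5 := hP x hx Y W (Γ x X Z) V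
  have p6 := hP x hx W X (Γ x Y Z) V
  have t1 := h.torsion_free x hx X W
  have t2 := h.torsion_free x hx Y W
  have t3 := h.torsion_free x hx Y X
  clear hb hP
  simp only [nablaForm]
  -- only the algebra of the components is left
  generalize g x = G at *
  generalize P x = Q at *
  generalize Γ x = C at *
  generalize fderiv ℝ P x = D at *
  rw [t1, t2, t3] at *
  clear eW eX eY t1 t2 t3
  linear_combination -(hb' + p1 + p2 + p3 + p4 + p5 + p6)

end IsLeviCivita

end Calculus

/-! ### The Cotton tensor of a conformally flat metric -/

section Cotton

variable {E : Type*} [NormedAddCommGroup E] [NormedSpace ℝ E]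

theorem exists_ne_zero_orthogonal [FiniteDimensional ℝ E] (hE : 4 ≤ Module.finrank ℝ E)
    (b : E →L[ℝ] E →L[ℝ] ℝ) (hsymm : ∀ X Y, b X Y = b Y X) (A B C : E) :
    ∃ V, V ≠ 0 ∧ b V A = 0 ∧ b V B = 0 ∧ b V C = 0 := by
  let f : E →ₗ[ℝ] (Fin 3 → ℝ) := LinearMap.pi
    ![(b A : E →ₗ[ℝ] ℝ), (b B : E →ₗ[ℝ] ℝ), (b C : E →ₗ[ℝ] ℝ)]
  have hker : LinearMap.ker f ≠ ⊥ := by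
    apply LinearMap.ker_ne_bot_of_finrank_lt
    simp only [Module.finrank_fin_fun]; omega
  obtain ⟨V, hV, hV0⟩ := Submodule.exists_mem_ne_zero_of_ne_bot hker
  have h := LinearMap.mem_ker.1 hV
  refine ⟨V, hV0, ?_, ?_, ?_⟩
  · rw [hsymm]; simpa [f] using congrFun h 0
  · rw [hsymm]; simpa [f] using congrFun h 1
  · rw [hsymm]; simpa [f] using congrFun h 2

/-- In dimension at least four, the cyclic identity for the Cotton tensor makes it vanish: test it on
mutually orthogonal vectors. -/
theorem eq_zero_of_cotton_cyclic [FiniteDimensional ℝ E] (hE : 4 ≤ Module.finrank ℝ E)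
    (b : E →L[ℝ] E →L[ℝ] ℝ) (hsymm : ∀ X Y, b X Y = b Y X) (hpos : ∀ X, X ≠ 0 → 0 < b X X)
    (c : E → E → E → ℝ) (hc : ∀ X Y Z, c X Y Z = -c Y X Z)
    (hc2 : ∀ X Y Y' Z (t : ℝ), c X (Y + t • Y') Z = c X Y Z + t * c X Y' Z)
    (hc3 : ∀ X Y Z Z' (t : ℝ), c X Y (Z + t • Z') = c X Y Z + t * c X Y Z')
    (h : ∀ W X Y Z V, b X V * c W Y Z + b Y V * c X W Z + b W V * c Y X Z + b Y Z * c W X V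
      + b W Z * c X Y V + b X Z * c Y W V = 0) (X Y Z : E) : c X Y Z = 0 := by
  have hc0 : ∀ X Z, c X X Z = 0 := fun X Z => by linarith [hc X X Z]
  have hcz : ∀ X Z, c X 0 Z = 0 := fun X Z => by
    have := hc2 X 0 0 Z 1
    simp only [smul_zero, add_zero] at this; linarith
  -- the three indices mutually orthogonal, or the last one orthogonal to the others
  have ha : ∀ W Y Z, b Z W = 0 → b Z Y = 0 → c W Y Z = 0 := by
    intro W Y Z h1 h2
    obtain ⟨V, hV, v1, v2, v3⟩ := exists_ne_zero_orthogonal hE b hsymm W Y Z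
    have := h W V Y Z V
    rw [hsymm Y V, hsymm W V, hsymm Y Z, hsymm W Z, v1, v2, v3, h1, h2] at this
    have hp := hpos V hV
    simp only [zero_mul, add_zero] at this
    exact (mul_eq_zero.1 this).resolve_left hp.ne'
  -- a repeated index
  have hb1 : ∀ W X Y, b X W = 0 → b X Y = 0 → b Y W = 0 →
      b X X * c W Y Y + b Y Y * c W X X = 0 := by
    intro W X Y h1 h2 h3
    have := h W X Y Y X
    rw [hsymm Y X, hsymm W X, hsymm W Y, h1, h2, h3] at this
    linarith
  have hb : ∀ W Y, b W Y = 0 → c W Y Y = 0 := by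
    intro W Y hWY
    by_cases hY : Y = 0
    · rw [hY, hcz]
    obtain ⟨V, hV, v1, v2, -⟩ := exists_ne_zero_orthogonal hE b hsymm W Y Y
    obtain ⟨V', hV', v1', v2', v3'⟩ := exists_ne_zero_orthogonal hE b hsymm W Y V
    have e1 := hb1 W V Y v1 v2 (by rw [hsymm, hWY])
    have e2 := hb1 W V' Y v1' v2' (by rw [hsymm, hWY])
    have e3 := hb1 W V' V v1' v3' v1
    have p1 := hpos Y hY
    have p2 := hpos V hV
    have p3 := hpos V' hV'
    have : 2 * (b V V * b V' V') * c W Y Y = 0 := by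
      linear_combination b V' V' * e1 + b V V * e2 - b Y Y * e3
    have hne : 2 * (b V V * b V' V') ≠ 0 := by positivity
    exact (mul_eq_zero.1 this).resolve_left hne
  have hd : ∀ W Y Z, b W Y = 0 → c W Y Z = 0 := by
    intro W Y Z hWY
    by_cases hW : W = 0
    · rw [hW, hc, hcz, neg_zero]
    by_cases hY : Y = 0
    · rw [hY, hcz]
    have p1 := hpos W hW
    have p2 := hpos Y hY
    set s := b Z W / b W W with hs
    set t := b Z Y / b Y Y with ht
    have e0 : c W Y (Z + (-s) • W + (-t) • Y) = 0 := by
      apply ha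
      · simp only [map_add, map_smul, add_apply, smul_apply, smul_eq_mul, hsymm Y W, hWY, hs]
        field_simp; ring
      · simp only [map_add, map_smul, add_apply, smul_apply, smul_eq_mul, hWY, ht]
        field_simp; ring
    rw [hc3, hc3, hb W Y hWY, hc W Y W, hb Y W (by rw [hsymm, hWY])] at e0
    linarith
  by_cases hX : X = 0
  · rw [hX, hc, hcz, neg_zero]
  have p1 := hpos X hX
  have e0 := hd X (Y + (-(b Y X / b X X)) • X) Z (by
    simp only [map_add, map_smul, smul_eq_mul, hsymm X Y]
    field_simp; ring)
  rw [hc2, hc0] at e0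
  linarith

variable {Ω : Set E} {g : E → E →L[ℝ] E →L[ℝ] ℝ} {Γ : E → E →L[ℝ] E →L[ℝ] E}

/-- The Schouten tensor of a conformally flat metric in dimension at least four is a Codazzi
tensor. -/
theorem IsLeviCivita.codazzi_schouten [FiniteDimensional ℝ E] (h : IsLeviCivita Ω g Γ)
    (hE : 4 ≤ Module.finrank ℝ E) {P : E → E →L[ℝ] E →L[ℝ] ℝ} (hP : IsSchouten Ω g Γ P)
    (hPs : ContDiffOn ℝ ∞ P Ω) {x : E} (hx : x ∈ Ω) (X Y Z : E) :
    nablaForm Γ P x X Y Z = nablaForm Γ P x Y X Z := by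
  have := eq_zero_of_cotton_cyclic hE (g x) (h.symm x hx) (h.pos x hx)
    (fun X Y Z => nablaForm Γ P x X Y Z - nablaForm Γ P x Y X Z) (fun X Y Z => by ring)
    (fun X Y Y' Z t => by
      simp only [nablaForm, map_add, map_smul, add_apply, smul_apply, smul_eq_mul]; ring)
    (fun X Y Z Z' t => by
      simp only [nablaForm, map_add, map_smul, smul_eq_mul]; ring)
    (fun W X Y Z V => h.cotton_cyclic hP hPs hx W X Y Z V) X Y Z
  linarith

end Cotton

/-! ### Concircular unit fields on a conformally flat manifold -/

section Concircular

variable {E : Type*} [NormedAddCommGroup E] [NormedSpace ℝ E]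
variable {Ω : Set E} {g : E → E →L[ℝ] E →L[ℝ] ℝ} {Γ : E → E →L[ℝ] E →L[ℝ] E}

/-- The covariant derivative of a tensor of the form `λ g + ν u ⊗ u` with `u = g(U, ·)`. -/
theorem IsLeviCivita.nablaForm_of_eq (h : IsLeviCivita Ω g Γ) {T : E → E →L[ℝ] E →L[ℝ] ℝ}
    {U : E → E} {l ν : E → ℝ} {x : E} (hx : x ∈ Ω) (hT : DifferentiableAt ℝ T x)
    (hU : DifferentiableAt ℝ U x) (hl : DifferentiableAt ℝ l x) (hν : DifferentiableAt ℝ ν x)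
    (hTe : ∀ y ∈ Ω, ∀ Y Z, T y Y Z = l y * g y Y Z + ν y * (g y (U y) Y * g y (U y) Z))
    (X Y Z : E) :
    nablaForm Γ T x X Y Z = fderiv ℝ l x X * g x Y Z
      + fderiv ℝ ν x X * (g x (U x) Y * g x (U x) Z)
      + ν x * (g x (nablaVec Γ U x X) Y * g x (U x) Z
        + g x (U x) Y * g x (nablaVec Γ U x X) Z) := by
  have dT := ((hasDerivAt_along hT X).clm_apply (hasDerivAt_const 0 Y)).clm_apply
    (hasDerivAt_const 0 Z)
  have dg := hasDerivAt_along (h.metricAt hx) X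
  have dU := hasDerivAt_along hU X
  have dl := hasDerivAt_along hl X
  have dν := hasDerivAt_along hν X
  have a : HasDerivAt (fun t : ℝ => g (x + t • X) Y Z) (fderiv ℝ g x X Y Z) 0 :=
    ((dg.clm_apply (hasDerivAt_const 0 Y)).clm_apply
      (hasDerivAt_const 0 Z)).congr_deriv (by simp)
  have du : ∀ A : E, HasDerivAt (fun t : ℝ => g (x + t • X) (U (x + t • X)) A)
      (fderiv ℝ g x X (U x) A + g x (fderiv ℝ U x X) A) 0 := fun A =>
    ((dg.clm_apply dU).clm_apply (hasDerivAt_const 0 A)).congr_deriv (by simp)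
  have := deriv_along_unique (f := fun y => T y Y Z) (f' := fun y => l y * g y Y Z
    + ν y * (g y (U y) Y * g y (U y) Z)) h.isOpen hx dT
    ((dl.mul a).add (dν.mul ((du Y).mul (du Z)))) (fun y hy => hTe y hy Y Z)
  simp only [zero_smul, add_zero, map_zero, h.compat x hx] at this
  simp only [nablaForm, nablaVec, hTe x hx, map_add, add_apply]
  linear_combination this

/-- A unit vector field `U` with `∇_X U = H (X - g(U, X) U)` on a conformally flat manifold whose
Schouten tensor is `a g + b u ⊗ u`, where `u = g(U, ·)`. Geometrically, the metric is a warped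
product over the flow lines of `U`. -/
structure IsConcircular (Ω : Set E) (g : E → E →L[ℝ] E →L[ℝ] ℝ) (Γ : E → E →L[ℝ] E →L[ℝ] E)
    (U : E → E) (H a b : E → ℝ) : Prop where
  smooth_field : ContDiffOn ℝ ∞ U Ω
  smooth_H : ContDiffOn ℝ ∞ H Ω
  smooth_a : ContDiffOn ℝ ∞ a Ω
  smooth_b : ContDiffOn ℝ ∞ b Ω
  unit : ∀ x ∈ Ω, g x (U x) (U x) = 1
  nabla : ∀ x ∈ Ω, ∀ X, nablaVec Γ U x X = H x • (X - g x (U x) X • U x)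
  schouten : ∃ P, ContDiffOn ℝ ∞ P Ω ∧ IsSchouten Ω g Γ P ∧
    ∀ x ∈ Ω, ∀ X Y, P x X Y = a x * g x X Y + b x * (g x (U x) X * g x (U x) Y)

namespace IsConcircular

variable {U : E → E} {H a b : E → ℝ}

variable (h : IsLeviCivita Ω g Γ) (c : IsConcircular Ω g Γ U H a b)
include h c

theorem fieldAt {x : E} (hx : x ∈ Ω) : DifferentiableAt ℝ U x :=
  (c.smooth_field.differentiableOn (by simp)).differentiableAt (h.isOpen.mem_nhds hx)

theorem HAt {x : E} (hx : x ∈ Ω) : DifferentiableAt ℝ H x :=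
  (c.smooth_H.differentiableOn (by simp)).differentiableAt (h.isOpen.mem_nhds hx)

theorem aAt {x : E} (hx : x ∈ Ω) : DifferentiableAt ℝ a x :=
  (c.smooth_a.differentiableOn (by simp)).differentiableAt (h.isOpen.mem_nhds hx)

theorem bAt {x : E} (hx : x ∈ Ω) : DifferentiableAt ℝ b x :=
  (c.smooth_b.differentiableOn (by simp)).differentiableAt (h.isOpen.mem_nhds hx)

omit h in
theorem fderiv_field {x : E} (hx : x ∈ Ω) (X : E) :
    fderiv ℝ U x X = H x • (X - g x (U x) X • U x) - Γ x X (U x) := by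
  rw [← c.nabla x hx X, nablaVec]; abel

/-- The derivative of the 1-form `u = g(U, ·)` applied to a constant vector. -/
theorem hasDerivAt_dual {x : E} (hx : x ∈ Ω) (X Y : E) :
    HasDerivAt (fun t : ℝ => g (x + t • X) (U (x + t • X)) Y)
      (g x (U x) (Γ x X Y) + H x * (g x X Y - g x (U x) X * g x (U x) Y)) 0 := by
  refine (((hasDerivAt_along (h.metricAt hx) X).clm_apply
    (hasDerivAt_along (c.fieldAt h hx) X)).clm_apply (hasDerivAt_const 0 Y)).congr_deriv ?_
  simp only [zero_smul, add_zero, map_zero, add_apply, h.compat x hx, c.fderiv_field hx,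
    map_sub, map_smul, sub_apply, smul_apply, smul_eq_mul]
  ring

/-- The curvature, as the Kulkarni-Nomizu product of the metric with `P = a g + b u ⊗ u`. -/
theorem curv_eq {x : E} (hx : x ∈ Ω) (X Y Z : E) :
    curv Γ x X Y Z = -((2 * a x) • (g x Y Z • X - g x X Z • Y)
      + b x • ((g x (U x) Y * g x (U x) Z) • X - (g x (U x) X * g x (U x) Z) • Y
        + (g x Y Z * g x (U x) X - g x X Z * g x (U x) Y) • U x)) := by
  obtain ⟨P, -, hP, hPe⟩ := c.schouten
  refine h.eq_of_inner hx fun V => ?_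
  rw [hP x hx]
  simp only [hPe x hx, map_neg, map_add, map_sub, map_smul, neg_apply, add_apply, sub_apply,
    smul_apply, smul_eq_mul]
  ring

variable [FiniteDimensional ℝ E]

/-- The equation `da = b H u`, obtained from the Codazzi equation for `P = a g + b u ⊗ u`. -/
theorem fderiv_a (hE : 4 ≤ Module.finrank ℝ E) {x : E} (hx : x ∈ Ω) (X : E) :
    fderiv ℝ a x X = b x * H x * g x (U x) X := by
  obtain ⟨P, hPs, hP, hPe⟩ := c.schouten
  have hPd : DifferentiableAt ℝ P x :=
    (hPs.differentiableOn (by simp)).differentiableAt (h.isOpen.mem_nhds hx)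
  have key : ∀ X Y Z, fderiv ℝ a x X * g x Y Z
      + fderiv ℝ b x X * (g x (U x) Y * g x (U x) Z)
      + b x * (H x * (g x X Y - g x (U x) X * g x (U x) Y) * g x (U x) Z
        + g x (U x) Y * (H x * (g x X Z - g x (U x) X * g x (U x) Z)))
      = fderiv ℝ a x Y * g x X Z + fderiv ℝ b x Y * (g x (U x) X * g x (U x) Z)
      + b x * (H x * (g x Y X - g x (U x) Y * g x (U x) X) * g x (U x) Z
        + g x (U x) X * (H x * (g x Y Z - g x (U x) Y * g x (U x) Z))) := by
    intro X Y Z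
    have := h.codazzi_schouten hE hP hPs hx X Y Z
    rw [h.nablaForm_of_eq hx hPd (c.fieldAt h hx) (c.aAt h hx) (c.bAt h hx) hPe,
      h.nablaForm_of_eq hx hPd (c.fieldAt h hx) (c.aAt h hx) (c.bAt h hx) hPe] at this
    simpa only [c.nabla x hx, map_smul, map_sub, sub_apply, smul_apply, smul_eq_mul] using this
  obtain ⟨Y, hY, y1, y2, -⟩ := exists_ne_zero_orthogonal hE (g x) (h.symm x hx) (U x) X X
  have hp := h.pos x hx Y hY
  have := key X Y Y
  rw [h.symm x hx (U x) Y, y1, h.symm x hx X Y, y2] at this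
  have h2 : (fderiv ℝ a x X - b x * H x * g x (U x) X) * g x Y Y = 0 := by linear_combination this
  have := (mul_eq_zero.1 h2).resolve_right hp.ne'
  linarith

/-- The Ricci identity for `U`, paired with a vector orthogonal to `U` and to the direction of
differentiation. -/
theorem fderiv_H (hE : 4 ≤ Module.finrank ℝ E) {x : E} (hx : x ∈ Ω) (X : E) :
    fderiv ℝ H x X = -(H x ^ 2 + 2 * a x + b x) * g x (U x) X := by
  have hs : ∀ A B, fderiv ℝ (fderiv ℝ U) x A B = fderiv ℝ (fderiv ℝ U) x B A := fun A B =>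
    ((c.smooth_field.contDiffAt (h.isOpen.mem_nhds hx)).isSymmSndFDerivAt
      (by simp only [minSmoothness_of_isRCLikeNormedField]; exact WithTop.coe_le_coe.2 le_top)).eq
      A B
  have hD : DifferentiableAt ℝ (fderiv ℝ U) x :=
    ((c.smooth_field.contDiffAt (h.isOpen.mem_nhds hx)).fderiv_right (m := 1)
      (by norm_cast)).differentiableAt (by simp)
  have second : ∀ A B, fderiv ℝ (fderiv ℝ U) x A B =
      fderiv ℝ H x A • (B - g x (U x) B • U x)
      - H x • ((g x (U x) (Γ x A B) + H x * (g x A B - g x (U x) A * g x (U x) B)) • U x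
        + g x (U x) B • fderiv ℝ U x A)
      - (fderiv ℝ Γ x A B (U x) + Γ x B (fderiv ℝ U x A)) := by
    intro A B
    have d1 := (hasDerivAt_along hD A).clm_apply (hasDerivAt_const 0 B)
    have dU := hasDerivAt_along (c.fieldAt h hx) A
    have dH := hasDerivAt_along (c.HAt h hx) A
    have du := c.hasDerivAt_dual h hx A B
    have dG := ((hasDerivAt_along (h.connAt hx) A).clm_apply (hasDerivAt_const 0 B)).clm_apply dU
    have d2 := (dH.smul ((hasDerivAt_const (0 : ℝ) B).sub (du.smul dU))).sub dG
    have := deriv_along_unique (f := fun y => fderiv ℝ U y B)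
      (f' := fun y => H y • (B - g y (U y) B • U y) - Γ y B (U y)) h.isOpen hx d1 d2
      (fun y hy => c.fderiv_field hy B)
    simp only [Pi.sub_apply, Pi.smul_apply', zero_smul, add_zero, map_zero] at this
    rw [this]
    module
  obtain ⟨Y, hY, y1, y2, -⟩ := exists_ne_zero_orthogonal hE (g x) (h.symm x hx) (U x) X X
  have hp := h.pos x hx Y hY
  have e := hs X Y
  rw [second, second, c.fderiv_field hx, c.fderiv_field hx] at e
  have hc := c.curv_eq h hx X Y (U x)
  simp only [curv] at hc
  have e1 := congrArg (fun v => g x v Y) e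
  have e2 := congrArg (fun v => g x v Y) hc
  simp only [map_neg, map_add, map_sub, map_smul, neg_apply, add_apply, sub_apply,
    smul_apply, smul_eq_mul] at e1 e2
  rw [h.torsion_free x hx Y X] at e1
  have y1' : g x (U x) Y = 0 := by rw [h.symm x hx, y1]
  have y2' : g x X Y = 0 := by rw [h.symm x hx, y2]
  simp only [y1, y1', y2, y2', h.symm x hx X (U x), c.unit x hx] at e1 e2
  have h2 : (fderiv ℝ H x X + (H x ^ 2 + 2 * a x + b x) * g x (U x) X) * g x Y Y = 0 := by
    linear_combination e1 - e2
  have := (mul_eq_zero.1 h2).resolve_right hp.ne'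
  linarith

end IsConcircular
end Concircular

/-! ### Solutions of the flat systems attached to a concircular field -/

section FlatSystems

open Metric

variable {E : Type*} [NormedAddCommGroup E] [NormedSpace ℝ E] [FiniteDimensional ℝ E]

/-- `exists_solution_total_differential` in finite dimension, for a connection form given by plain
bilinear maps; derivatives of the coefficients are taken along lines. -/
theorem exists_solution_of_flat {W : Type*} [NormedAddCommGroup W] [NormedSpace ℝ W]
    [FiniteDimensional ℝ W] (A : E → E →ₗ[ℝ] W →ₗ[ℝ] W) {Ω : Set E} (hΩ : IsOpen Ω)
    (hA : ∀ X w, ContDiffOn ℝ ∞ (fun x => A x X w) Ω) {x₀ : E} (hx₀ : x₀ ∈ Ω)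
    (d : E → E → E → W → W)
    (hd : ∀ x ∈ Ω, ∀ X Y w, HasDerivAt (fun t : ℝ => A (x + t • X) Y w) (d x X Y w) 0)
    (hflat : ∀ x ∈ Ω, ∀ X Y w, d x X Y w + A x Y (A x X w) = d x Y X w + A x X (A x Y w)) :
    ∃ r > 0, ball x₀ r ⊆ Ω ∧ ∀ w₀ : W, ∃ Φ : E → W, Φ x₀ = w₀ ∧ ContDiffOn ℝ ∞ Φ (ball x₀ r) ∧
      ∀ x ∈ ball x₀ r, ∀ X, fderiv ℝ Φ x X = A x X (Φ x) := by
  have : CompleteSpace W := FiniteDimensional.complete ℝ W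
  let B : E → E →L[ℝ] W →L[ℝ] W := fun x =>
    LinearMap.toContinuousLinearMap
      ((LinearMap.toContinuousLinearMap : (W →ₗ[ℝ] W) ≃ₗ[ℝ] (W →L[ℝ] W)).toLinearMap ∘ₗ A x)
  have hB : ∀ x X w, B x X w = A x X w := fun x X w => rfl
  have hBs : ContDiffOn ℝ ∞ B Ω := by
    rw [contDiffOn_clm_apply]; intro X
    rw [contDiffOn_clm_apply]; intro w
    exact hA X w
  have hBd : ∀ x ∈ Ω, ∀ X Y w, fderiv ℝ B x X Y w = d x X Y w := by
    intro x hx X Y w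
    have hBx : DifferentiableAt ℝ B x :=
      (hBs.differentiableOn (by simp)).differentiableAt (hΩ.mem_nhds hx)
    have := ((hasDerivAt_along hBx X).clm_apply (hasDerivAt_const 0 Y)).clm_apply
      (hasDerivAt_const 0 w)
    have := this.unique (hd x hx X Y w)
    simpa using this
  exact exists_solution_total_differential B hΩ hBs hx₀ fun x hx X Y w => by
    rw [hBd x hx, hBd x hx]; exact hflat x hx X Y w

variable {Ω : Set E} {g : E → E →L[ℝ] E →L[ℝ] ℝ} {Γ : E → E →L[ℝ] E →L[ℝ] E}

namespace IsConcircular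

variable {U : E → E} {H a b : E → ℝ}
variable (h : IsLeviCivita Ω g Γ) (c : IsConcircular Ω g Γ U H a b)
include h c

/-- The 1-form `g(U, ·)` is closed, hence locally the differential of a function. -/
theorem exists_potential {x₀ : E} (hx₀ : x₀ ∈ Ω) : ∃ r > 0, ball x₀ r ⊆ Ω ∧ ∃ f : E → ℝ,
    ContDiffOn ℝ ∞ f (ball x₀ r) ∧ ∀ x ∈ ball x₀ r, ∀ X, fderiv ℝ f x X = g x (U x) X := by
  -- the unknown is `(s, f)` with `ds = 0` and `df = s u`
  obtain ⟨r, hr, hrΩ, hsol⟩ := exists_solution_of_flat (E := E) (W := ℝ × ℝ)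
    (fun x => LinearMap.mk₂ ℝ (fun X w => ((0 : ℝ), w.1 * g x (U x) X))
      (fun X Y w => by ext <;> simp; ring) (fun s X w => by ext <;> simp; ring)
      (fun X w w' => by ext <;> simp; ring) (fun s X w => by ext <;> simp; ring))
    h.isOpen (fun X w => by
      simp only [LinearMap.mk₂_apply]
      exact contDiffOn_const.prodMk (contDiffOn_const.mul
        ((h.smooth_metric.clm_apply c.smooth_field).clm_apply contDiffOn_const))) hx₀
    (fun x X Y w => ((0 : ℝ), w.1 * (g x (U x) (Γ x X Y)
      + H x * (g x X Y - g x (U x) X * g x (U x) Y))))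
    (fun x hx X Y w => by
      simp only [LinearMap.mk₂_apply]
      exact (hasDerivAt_const _ _).prodMk ((c.hasDerivAt_dual h hx X Y).const_mul _))
    (fun x hx X Y w => by
      simp only [LinearMap.mk₂_apply, h.torsion_free x hx X Y, h.symm x hx X Y]
      refine Prod.ext ?_ ?_ <;> simp only [Prod.fst_add, Prod.snd_add]; ring)
  obtain ⟨Φ, h0, hΦ, hΦd⟩ := hsol (1, 0)
  have hdiff : ∀ x ∈ ball x₀ r, HasFDerivAt Φ (fderiv ℝ Φ x) x := fun x hx =>
    ((hΦ.differentiableOn (by simp)).differentiableAt (isOpen_ball.mem_nhds hx)).hasFDerivAt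
  have h1 : ∀ x ∈ ball x₀ r, (Φ x).1 = 1 := by
    intro x hx
    have hd1 : ∀ y ∈ ball x₀ r, HasFDerivWithinAt (fun y => (Φ y).1) (0 : E →L[ℝ] ℝ)
        (ball x₀ r) y := by
      intro y hy
      refine ((hdiff y hy).fst.congr_fderiv ?_).hasFDerivWithinAt
      ext X; simp [hΦd y hy]
    have := (convex_ball x₀ r).is_const_of_fderivWithin_eq_zero (𝕜 := ℝ)
      (fun y hy => (hd1 y hy).differentiableWithinAt)
      (fun y hy => (hd1 y hy).fderivWithin (isOpen_ball.uniqueDiffWithinAt hy)) hx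
      (mem_ball_self hr)
    rw [this, h0]
  refine ⟨r, hr, hrΩ, fun x => (Φ x).2, hΦ.snd, fun x hx X => ?_⟩
  rw [(hdiff x hx).snd.fderiv]
  simp [hΦd x hx, h1 x hx]

/-- The solutions `w` of the Hessian equation
`∇dw = -H (u ⊗ dw + dw ⊗ u) - (2a + H²) w (g - u ⊗ u)`, `dw(U) = 0`: on the leaves orthogonal to `U`
these are the functions whose quotients are projective coordinates. Here `T` is the gradient
of `w`. -/
structure IsFibreFunction (B : Set E) (g : E → E →L[ℝ] E →L[ℝ] ℝ) (Γ : E → E →L[ℝ] E →L[ℝ] E)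
    (U : E → E) (H a : E → ℝ) (w : E → ℝ) (T : E → E) : Prop where
  smooth : ContDiffOn ℝ ∞ w B
  smooth_grad : ContDiffOn ℝ ∞ T B
  orthogonal : ∀ x ∈ B, g x (U x) (T x) = 0
  fderiv_eq : ∀ x ∈ B, ∀ X, fderiv ℝ w x X = g x (T x) X
  hessian : ∀ x ∈ B, ∀ X, nablaVec Γ T x X = -(H x) • (g x (U x) X • T x + g x (T x) X • U x)
    - ((2 * a x + H x ^ 2) * w x) • (X - g x (U x) X • U x)

variable (g Γ U H a) in
/-- The connection form of the Hessian equation of `IsFibreFunction`, on pairs `(w, T)`. The terms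
containing `τ = g(U, T)` vanish on the solutions of interest; they make the connection flat on all
pairs, by splitting off a trivial line. -/
def fibreForm (x : E) : E →ₗ[ℝ] (ℝ × E) →ₗ[ℝ] (ℝ × E) :=
  LinearMap.mk₂ ℝ (fun X p => (g x p.2 X - g x (U x) p.2 * g x (U x) X,
      -(Γ x X p.2) - H x • (g x (U x) X • p.2 + g x p.2 X • U x)
      + (H x * g x (U x) p.2) • (X + g x (U x) X • U x)
      - ((2 * a x + H x ^ 2) * p.1) • (X - g x (U x) X • U x)))
    (fun X Y p => by
      refine Prod.ext ?_ ?_ <;> simp only [Prod.fst_add, Prod.snd_add, map_add, add_apply]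
      · ring
      · module)
    (fun s X p => by
      refine Prod.ext ?_ ?_ <;> simp only [Prod.smul_fst, Prod.smul_snd, map_smul, smul_apply,
        smul_eq_mul]
      · ring
      · module)
    (fun X p q => by
      refine Prod.ext ?_ ?_ <;> simp only [Prod.fst_add, Prod.snd_add, map_add, add_apply]
      · ring
      · module)
    (fun s X p => by
      refine Prod.ext ?_ ?_ <;> simp only [Prod.smul_fst, Prod.smul_snd, map_smul, smul_apply,
        smul_eq_mul]
      · ring
      · module)

omit h c [FiniteDimensional ℝ E] in
theorem fibreForm_apply (x X : E) (p : ℝ × E) : fibreForm g Γ U H a x X p =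
    (g x p.2 X - g x (U x) p.2 * g x (U x) X,
      -(Γ x X p.2) - H x • (g x (U x) X • p.2 + g x p.2 X • U x)
      + (H x * g x (U x) p.2) • (X + g x (U x) X • U x)
      - ((2 * a x + H x ^ 2) * p.1) • (X - g x (U x) X • U x)) := rfl

omit [FiniteDimensional ℝ E] in
theorem contDiffOn_fibreForm (X : E) (p : ℝ × E) :
    ContDiffOn ℝ ∞ (fun x => fibreForm g Γ U H a x X p) Ω := by
  simp only [fibreForm_apply]
  have hg := h.smooth_metric
  have hG := h.smooth_conn
  have hU := c.smooth_field
  have hH := c.smooth_H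
  have ha := c.smooth_a
  have hu : ∀ Y, ContDiffOn ℝ ∞ (fun x => g x (U x) Y) Ω := fun Y =>
    (hg.clm_apply hU).clm_apply contDiffOn_const
  have hgc : ∀ Y Z, ContDiffOn ℝ ∞ (fun x => g x Y Z) Ω := fun Y Z =>
    (hg.clm_apply contDiffOn_const).clm_apply contDiffOn_const
  have hGc : ∀ Y Z, ContDiffOn ℝ ∞ (fun x => Γ x Y Z) Ω := fun Y Z =>
    (hG.clm_apply contDiffOn_const).clm_apply contDiffOn_const
  refine ContDiffOn.prodMk ((hgc _ _).sub ((hu _).mul (hu _))) ?_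
  refine ((((hGc _ _).neg.sub (hH.smul (((hu _).smul contDiffOn_const).add
    ((hgc _ _).smul hU)))).add ((hH.mul (hu _)).smul (contDiffOn_const.add
    ((hu _).smul hU)))).sub ?_)
  exact (((contDiffOn_const.mul ha).add (hH.pow 2)).mul contDiffOn_const).smul
    (contDiffOn_const.sub ((hu _).smul hU))

variable (g Γ U H a b) in
/-- The derivative along `X` of the connection form `fibreForm`, applied to `Y` and a pair. -/
def fibreFormDeriv (x X Y : E) (p : ℝ × E) : ℝ × E :=
  let du : E → ℝ := fun V => g x (U x) (Γ x X V) + H x * (g x X V - g x (U x) X * g x (U x) V)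
  let dU : E := H x • (X - g x (U x) X • U x) - Γ x X (U x)
  let dg : ℝ := g x (Γ x X p.2) Y + g x p.2 (Γ x X Y)
  let dH : ℝ := -(H x ^ 2 + 2 * a x + b x) * g x (U x) X
  let dκ : ℝ := -2 * H x * (2 * a x + H x ^ 2) * g x (U x) X
  (dg - (du p.2 * g x (U x) Y + g x (U x) p.2 * du Y),
    -(fderiv ℝ Γ x X Y p.2)
    - (H x • (du Y • p.2 + (g x p.2 Y • dU + dg • U x))
      + dH • (g x (U x) Y • p.2 + g x p.2 Y • U x))
    + ((H x * g x (U x) p.2) • (g x (U x) Y • dU + du Y • U x)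
      + (dH * g x (U x) p.2 + H x * du p.2) • (Y + g x (U x) Y • U x))
    - (((2 * a x + H x ^ 2) * p.1) • -(g x (U x) Y • dU + du Y • U x)
      + (dκ * p.1) • (Y - g x (U x) Y • U x)))

theorem hasDerivAt_fibreForm (hE : 4 ≤ Module.finrank ℝ E) {x : E} (hx : x ∈ Ω) (X Y : E)
    (p : ℝ × E) : HasDerivAt (fun t : ℝ => fibreForm g Γ U H a (x + t • X) Y p)
      (fibreFormDeriv g Γ U H a b x X Y p) 0 := by
  have du := c.hasDerivAt_dual h hx X
  have dU := hasDerivAt_along (c.fieldAt h hx) X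
  rw [c.fderiv_field hx] at dU
  have dg : ∀ A B : E, HasDerivAt (fun t : ℝ => g (x + t • X) A B)
      (g x (Γ x X A) B + g x A (Γ x X B)) 0 := fun A B =>
    (((hasDerivAt_along (h.metricAt hx) X).clm_apply (hasDerivAt_const 0 A)).clm_apply
      (hasDerivAt_const 0 B)).congr_deriv (by simp [h.compat x hx])
  have dG : ∀ A B : E, HasDerivAt (fun t : ℝ => Γ (x + t • X) A B) (fderiv ℝ Γ x X A B) 0 :=
    fun A B => (((hasDerivAt_along (h.connAt hx) X).clm_apply (hasDerivAt_const 0 A)).clm_apply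
      (hasDerivAt_const 0 B)).congr_deriv (by simp)
  have dH := hasDerivAt_along (c.HAt h hx) X
  rw [c.fderiv_H h hE hx] at dH
  have da := hasDerivAt_along (c.aAt h hx) X
  rw [c.fderiv_a h hE hx] at da
  have dκ : HasDerivAt (fun t : ℝ => 2 * a (x + t • X) + H (x + t • X) ^ 2)
      (-2 * H x * (2 * a x + H x ^ 2) * g x (U x) X) 0 := by
    refine ((da.const_mul 2).add (dH.pow 2)).congr_deriv ?_
    simp; ring
  simp only [fibreForm_apply, fibreFormDeriv]
  refine HasDerivAt.prodMk ?_ ?_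
  · exact ((dg p.2 Y).sub ((du p.2).mul (du Y))).congr_deriv (by simp)
  · have duU := (du Y).smul dU
    have t1 := dH.smul (((du Y).smul (hasDerivAt_const 0 p.2)).add ((dg p.2 Y).smul dU))
    have t2 := (dH.mul (du p.2)).smul ((hasDerivAt_const 0 Y).add duU)
    have t3 := (dκ.mul (hasDerivAt_const 0 p.1)).smul ((hasDerivAt_const 0 Y).sub duU)
    refine ((((dG Y p.2).neg.sub t1).add t2).sub t3).congr_deriv ?_
    simp only [Pi.sub_apply, Pi.smul_apply', Pi.add_apply, Pi.mul_apply, zero_smul, add_zero,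
      mul_zero, smul_zero, zero_add, zero_sub]

omit [FiniteDimensional ℝ E] in
/-- The system for fibre functions is integrable: the commutator of its coefficient maps is the
curvature of `curv_eq`, corrected by the derivatives of `u`, `H` and `a`. -/
theorem fibreForm_flat {x : E} (hx : x ∈ Ω) (X Y : E) (p : ℝ × E) :
    fibreFormDeriv g Γ U H a b x X Y p
        + fibreForm g Γ U H a x Y (fibreForm g Γ U H a x X p)
      = fibreFormDeriv g Γ U H a b x Y X p
        + fibreForm g Γ U H a x X (fibreForm g Γ U H a x Y p) := by
  obtain ⟨w, T⟩ := p
  have hu := c.unit x hx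
  have hc := c.curv_eq h hx X Y T
  simp only [curv] at hc
  have hXY := h.symm x hx Y X
  have hTX := h.symm x hx X T
  have hTY := h.symm x hx Y T
  have hG := h.torsion_free x hx Y X
  simp only [fibreForm_apply, fibreFormDeriv]
  generalize fderiv ℝ Γ x = D at *
  refine Prod.ext ?_ ?_
  · simp only [Prod.fst_add, map_neg, map_add, map_sub, map_smul, neg_apply, add_apply, sub_apply,
      smul_apply, smul_eq_mul, hXY, hTX, hTY, hG, hu]
    ring
  · simp only [Prod.snd_add, map_neg, map_add, map_sub, map_smul, neg_apply, add_apply, sub_apply,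
      smul_apply, smul_eq_mul, hXY, hTX, hTY, hG, hu] at hc ⊢
    linear_combination (norm := module) hc

/-- Fibre functions exist near every point, with arbitrary value and gradient orthogonal to `U`. -/
theorem exists_isFibreFunction (hE : 4 ≤ Module.finrank ℝ E) {x₀ : E} (hx₀ : x₀ ∈ Ω) :
    ∃ r > 0, ball x₀ r ⊆ Ω ∧ ∀ (w₀ : ℝ) (T₀ : E), g x₀ (U x₀) T₀ = 0 → ∃ (w : E → ℝ) (T : E → E),
      w x₀ = w₀ ∧ T x₀ = T₀ ∧ IsFibreFunction (ball x₀ r) g Γ U H a w T := by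
  obtain ⟨r, hr, hrΩ, hsol⟩ := exists_solution_of_flat (E := E) (W := ℝ × E)
    (fibreForm g Γ U H a) h.isOpen (c.contDiffOn_fibreForm h) hx₀ (fibreFormDeriv g Γ U H a b)
    (fun x hx => c.hasDerivAt_fibreForm h hE hx) (fun x hx => c.fibreForm_flat h hx)
  refine ⟨r, hr, hrΩ, fun w₀ T₀ hT₀ => ?_⟩
  obtain ⟨Φ, h0, hΦ, hΦd⟩ := hsol (w₀, T₀)
  have hdiff : ∀ x ∈ ball x₀ r, HasFDerivAt Φ (fderiv ℝ Φ x) x := fun x hx =>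
    ((hΦ.differentiableOn (by simp)).differentiableAt (isOpen_ball.mem_nhds hx)).hasFDerivAt
  have hTd : ∀ x ∈ ball x₀ r, ∀ X, fderiv ℝ (fun y => (Φ y).2) x X
      = (fibreForm g Γ U H a x X (Φ x)).2 := by
    intro x hx X
    rw [(hdiff x hx).snd.fderiv, ← hΦd x hx]; rfl
  have hwd : ∀ x ∈ ball x₀ r, ∀ X, fderiv ℝ (fun y => (Φ y).1) x X
      = (fibreForm g Γ U H a x X (Φ x)).1 := by
    intro x hx X
    rw [(hdiff x hx).fst.fderiv, ← hΦd x hx]; rfl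
  have hτ : ∀ x ∈ ball x₀ r, g x (U x) (Φ x).2 = 0 := by
    intro x hx
    have hd : ∀ y ∈ ball x₀ r, DifferentiableAt ℝ (fun y => g y (U y) (Φ y).2) y ∧
        fderiv ℝ (fun y => g y (U y) (Φ y).2) y = 0 := by
      intro y hy
      have hD : DifferentiableAt ℝ (fun y => g y (U y) (Φ y).2) y :=
        ((h.metricAt (hrΩ hy)).clm_apply (c.fieldAt h (hrΩ hy))).clm_apply
          (hdiff y hy).snd.differentiableAt
      refine ⟨hD, ?_⟩
      ext X
      have d1 := hasDerivAt_along hD X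
      have d2 := ((hasDerivAt_along (h.metricAt (hrΩ hy)) X).clm_apply
        (hasDerivAt_along (c.fieldAt h (hrΩ hy)) X)).clm_apply
        (hasDerivAt_along (hdiff y hy).snd.differentiableAt X)
      rw [d1.unique d2, hTd y hy, c.fderiv_field (hrΩ hy)]
      have hu := c.unit y (hrΩ hy)
      simp only [fibreForm_apply, zero_smul, add_zero, map_add, map_sub, map_neg, map_smul,
        add_apply, sub_apply, smul_apply, smul_eq_mul, h.compat y (hrΩ hy), hu,
        h.symm y (hrΩ hy) (Φ y).2 X, zero_apply]
      ring
    have := (convex_ball x₀ r).is_const_of_fderivWithin_eq_zero (𝕜 := ℝ)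
      (fun y hy => (hd y hy).1.differentiableWithinAt)
      (fun y hy => by
        rw [fderivWithin_of_isOpen isOpen_ball hy]; exact (hd y hy).2) hx (mem_ball_self hr)
    rw [this, h0]; exact hT₀
  refine ⟨fun x => (Φ x).1, fun x => (Φ x).2, by simp [h0], by simp [h0], hΦ.fst, hΦ.snd, hτ,
    fun x hx X => ?_, fun x hx X => ?_⟩
  · rw [hwd x hx]; simp [fibreForm_apply, hτ x hx]
  · rw [nablaVec, hTd x hx]
    simp only [fibreForm_apply, hτ x hx]
    module

end IsConcircular

/-- A metric of constant curvature admits a concircular unit field near every point: the normalized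
gradient of a solution of `∇df = -2 a f g`. -/
theorem IsLeviCivita.exists_isConcircular_of_isotropic (h : IsLeviCivita Ω g Γ)
    (hE : 4 ≤ Module.finrank ℝ E) {P : E → E →L[ℝ] E →L[ℝ] ℝ} (hPs : ContDiffOn ℝ ∞ P Ω)
    (hP : IsSchouten Ω g Γ P) {a : E → ℝ} (ha : ContDiffOn ℝ ∞ a Ω)
    (hPe : ∀ x ∈ Ω, ∀ X Y, P x X Y = a x * g x X Y) {x₀ : E} (hx₀ : x₀ ∈ Ω) :
    ∃ r > 0, ball x₀ r ⊆ Ω ∧ ∃ U H, IsConcircular (ball x₀ r) g Γ U H a (fun _ => 0) := by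
  have haAt : ∀ x ∈ Ω, DifferentiableAt ℝ a x := fun x hx =>
    (ha.differentiableOn (by simp)).differentiableAt (h.isOpen.mem_nhds hx)
  have hda : ∀ x ∈ Ω, ∀ X, fderiv ℝ a x X = 0 := by
    intro x hx X
    have hPd : DifferentiableAt ℝ P x :=
      (hPs.differentiableOn (by simp)).differentiableAt (h.isOpen.mem_nhds hx)
    have key : ∀ X Y Z, nablaForm Γ P x X Y Z = fderiv ℝ a x X * g x Y Z := by
      intro X Y Z
      rw [h.nablaForm_of_eq (U := fun _ => 0) (ν := fun _ => 0) hx hPd (by fun_prop) (haAt x hx)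
        (by fun_prop) (fun y hy Y Z => by simp [hPe y hy]) X Y Z]
      simp
    obtain ⟨Y, hY, y1, -, -⟩ := exists_ne_zero_orthogonal hE (g x) (h.symm x hx) X X X
    have := h.codazzi_schouten hE hP hPs hx X Y Y
    rw [key, key, h.symm x hx X Y, y1, mul_zero] at this
    exact (mul_eq_zero.1 this).resolve_right (h.pos x hx Y hY).ne'
  have hcurv : ∀ x ∈ Ω, ∀ X Y Z, curv Γ x X Y Z
      = -((2 * a x) • (g x Y Z • X - g x X Z • Y)) := by
    intro x hx X Y Z
    refine h.eq_of_inner hx fun V => ?_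
    rw [hP x hx]
    simp only [hPe x hx, map_neg, map_sub, map_smul, neg_apply, sub_apply,
      smul_apply, smul_eq_mul]
    ring
  obtain ⟨r, hr, hrΩ, hsol⟩ := exists_solution_of_flat (E := E) (W := ℝ × E)
    (fun x => LinearMap.mk₂ ℝ (fun X p => (g x p.2 X, -(Γ x X p.2) - (2 * a x * p.1) • X))
      (fun X Y p => by
        refine Prod.ext ?_ ?_ <;> simp only [Prod.fst_add, Prod.snd_add, map_add, add_apply]
        module)
      (fun s X p => by
        refine Prod.ext ?_ ?_ <;> simp only [Prod.smul_fst, Prod.smul_snd, map_smul, smul_apply]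
        module)
      (fun X p q => by
        refine Prod.ext ?_ ?_ <;> simp only [Prod.fst_add, Prod.snd_add, map_add, add_apply]
        module)
      (fun s X p => by
        refine Prod.ext ?_ ?_ <;> simp only [Prod.smul_fst, Prod.smul_snd, map_smul, smul_apply,
          smul_eq_mul]
        module))
    h.isOpen
    (fun X p => by
      simp only [LinearMap.mk₂_apply]
      exact ((h.smooth_metric.clm_apply contDiffOn_const).clm_apply contDiffOn_const).prodMk
        (((h.smooth_conn.clm_apply contDiffOn_const).clm_apply contDiffOn_const).neg.sub
        (((contDiffOn_const.mul ha).mul contDiffOn_const).smul contDiffOn_const))) hx₀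
    (fun x X Y p => (g x (Γ x X p.2) Y + g x p.2 (Γ x X Y), -(fderiv ℝ Γ x X Y p.2)))
    (fun x hx X Y p => by
      simp only [LinearMap.mk₂_apply]
      have da := hasDerivAt_along (haAt x hx) X
      rw [hda x hx] at da
      refine HasDerivAt.prodMk ?_ ?_
      · exact (((hasDerivAt_along (h.metricAt hx) X).clm_apply
          (hasDerivAt_const 0 p.2)).clm_apply
          (hasDerivAt_const 0 Y)).congr_deriv (by simp [h.compat x hx])
      · exact ((((hasDerivAt_along (h.connAt hx) X).clm_apply (hasDerivAt_const 0 Y)).clm_apply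
          (hasDerivAt_const 0 p.2)).neg.sub (((da.const_mul 2).mul_const p.1).smul_const
          Y)).congr_deriv (by simp))
    (fun x hx X Y p => by
      have hc := hcurv x hx X Y p.2
      simp only [curv] at hc
      have hX := h.symm x hx X p.2
      have hY := h.symm x hx Y p.2
      have hG := h.torsion_free x hx Y X
      have hXY := h.symm x hx Y X
      simp only [LinearMap.mk₂_apply]
      refine Prod.ext ?_ ?_
      · simp only [Prod.fst_add, map_neg, map_sub, map_smul, neg_apply, sub_apply, smul_apply,
          smul_eq_mul, hG, hXY]
        ring
      · simp only [Prod.snd_add, map_neg, map_sub, map_smul, hX, hY, hG] at hc ⊢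
        linear_combination (norm := module) hc)
  have hnt : Nontrivial E := Module.nontrivial_of_finrank_pos (R := ℝ) (by omega)
  obtain ⟨e, he⟩ := exists_ne (0 : E)
  obtain ⟨Φ, h0, hΦ, hΦd⟩ := hsol (0, e)
  have hTs : ContDiffOn ℝ ∞ (fun x => (Φ x).2) (ball x₀ r) := hΦ.snd
  have hfs : ContDiffOn ℝ ∞ (fun x => (Φ x).1) (ball x₀ r) := hΦ.fst
  have hNs : ContDiffOn ℝ ∞ (fun x => g x (Φ x).2 (Φ x).2) (ball x₀ r) :=
    ((h.smooth_metric.mono hrΩ).clm_apply hTs).clm_apply hTs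
  have hN0 : 0 < g x₀ (Φ x₀).2 (Φ x₀).2 := by rw [h0]; exact h.pos x₀ hx₀ e he
  have hev : ∀ᶠ x in nhds x₀, 0 < g x (Φ x).2 (Φ x).2 :=
    (hNs.continuousOn.continuousAt (ball_mem_nhds x₀ hr)).eventually_const_lt hN0
  obtain ⟨ρ, hρ, hball⟩ := Metric.mem_nhds_iff.1 (Filter.inter_mem hev (ball_mem_nhds x₀ hr))
  have hρr : ball x₀ ρ ⊆ ball x₀ r := fun x hx => (hball hx).2
  have hNpos : ∀ x ∈ ball x₀ ρ, 0 < g x (Φ x).2 (Φ x).2 := fun x hx => (hball hx).1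
  let s : E → ℝ := fun x => Real.sqrt (g x (Φ x).2 (Φ x).2)
  have hs0 : ∀ x ∈ ball x₀ ρ, s x ≠ 0 := fun x hx => (Real.sqrt_pos.2 (hNpos x hx)).ne'
  have hs2 : ∀ x ∈ ball x₀ ρ, s x ^ 2 = g x (Φ x).2 (Φ x).2 := fun x hx =>
    Real.sq_sqrt (hNpos x hx).le
  have hss : ContDiffOn ℝ ∞ s (ball x₀ ρ) := (hNs.mono hρr).sqrt fun x hx => (hNpos x hx).ne'
  have hρΩ := hρr.trans hrΩ
  refine ⟨ρ, hρ, hρΩ, fun x => (s x)⁻¹ • (Φ x).2, fun x => -(2 * a x * (Φ x).1) * (s x)⁻¹,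
    (hss.inv hs0).smul (hTs.mono hρr),
    ((contDiffOn_const.mul (ha.mono hρΩ)).mul (hfs.mono hρr)).neg.mul (hss.inv hs0),
    ha.mono hρΩ, contDiffOn_const, fun x hx => ?_, fun x hx X => ?_,
    P, hPs.mono hρΩ, fun x hx => hP x (hρΩ hx), fun x hx X Y => by simp [hPe x (hρΩ hx)]⟩
  · have := hs2 x hx
    have h3 := hs0 x hx
    simp only [map_smul, smul_apply, smul_eq_mul, ← this]
    field_simp
  · have hxΩ := hρΩ hx
    have hdiff : HasFDerivAt Φ (fderiv ℝ Φ x) x :=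
      ((hΦ.differentiableOn (by simp)).differentiableAt
        (isOpen_ball.mem_nhds (hρr hx))).hasFDerivAt
    have hsd : DifferentiableAt ℝ s x :=
      (hss.differentiableOn (by simp)).differentiableAt (isOpen_ball.mem_nhds hx)
    have hTd : fderiv ℝ (fun y => (Φ y).2) x X = -(Γ x X (Φ x).2) - (2 * a x * (Φ x).1) • X := by
      rw [hdiff.snd.fderiv]
      have := congrArg Prod.snd (hΦd x (hρr hx) X)
      simpa using this
    have dT := hasDerivAt_along hdiff.snd.differentiableAt X
    rw [hTd] at dT
    have ds := hasDerivAt_along hsd X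
    have dN := ((hasDerivAt_along (h.metricAt hxΩ) X).clm_apply dT).clm_apply dT
    have hsderiv : s x * fderiv ℝ s x X = -(2 * a x * (Φ x).1) * g x X (Φ x).2 := by
      have := deriv_along_unique (f := fun x => s x ^ 2) (f' := fun x => g x (Φ x).2 (Φ x).2)
        isOpen_ball hx (ds.pow 2) dN hs2
      simp only [zero_smul, add_zero, h.compat x hxΩ, map_sub, map_neg, map_smul, add_apply,
        sub_apply, neg_apply, smul_apply, smul_eq_mul, h.symm x hxΩ (Φ x).2 X,
        h.symm x hxΩ (Φ x).2 (Γ x X (Φ x).2)] at this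
      norm_num at this
      linear_combination this / 2
    have h3 := hs0 x hx
    have dU := (ds.inv (by simpa using h3)).smul dT
    have hUd : DifferentiableAt ℝ (fun x => (s x)⁻¹ • (Φ x).2) x :=
      (hsd.inv h3).smul hdiff.snd.differentiableAt
    have e1 := (hasDerivAt_along hUd X).unique dU
    have hsd' : fderiv ℝ s x X = -(2 * a x * (Φ x).1) * g x X (Φ x).2 * (s x)⁻¹ := by
      field_simp; linear_combination hsderiv
    rw [nablaVec, e1, hsd']
    simp only [zero_smul, add_zero, map_smul, smul_apply, smul_eq_mul, h.symm x hxΩ (Φ x).2 X,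
      Pi.inv_apply]
    match_scalars <;> field_simp; ring

end FlatSystems

/-! ### From weak `Z` symmetry to a concircular field -/

section WeaklyZSymmetric

open Metric

variable {E : Type*} [NormedAddCommGroup E] [NormedSpace ℝ E] [FiniteDimensional ℝ E]
variable {Ω : Set E} {g : E → E →L[ℝ] E →L[ℝ] ℝ} {Γ : E → E →L[ℝ] E →L[ℝ] E}

/-- A smooth covector field is dual to a smooth vector field. -/
theorem IsLeviCivita.exists_dual_field (h : IsLeviCivita Ω g Γ) {w : E → E →L[ℝ] ℝ}
    (hw : ContDiffOn ℝ ∞ w Ω) :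
    ∃ V : E → E, ContDiffOn ℝ ∞ V Ω ∧ ∀ x ∈ Ω, ∀ X, g x (V x) X = w x X := by
  have hinj : ∀ x ∈ Ω, Function.Injective (g x : E →ₗ[ℝ] (E →L[ℝ] ℝ)) := fun x hx X Y hXY =>
    h.eq_of_inner hx fun V => congrArg (fun f : E →L[ℝ] ℝ => f V) hXY
  have hfr : Module.finrank ℝ E = Module.finrank ℝ (E →L[ℝ] ℝ) := by
    rw [← (LinearMap.toContinuousLinearMap : (E →ₗ[ℝ] ℝ) ≃ₗ[ℝ] (E →L[ℝ] ℝ)).finrank_eq]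
    exact (Subspace.dual_finrank_eq (K := ℝ) (V := E)).symm
  have hequiv : ∀ x ∈ Ω, ∃ e : E ≃L[ℝ] (E →L[ℝ] ℝ), (e : E →L[ℝ] (E →L[ℝ] ℝ)) = g x := by
    intro x hx
    refine ⟨(LinearEquiv.ofInjectiveOfFinrankEq _ (hinj x hx) hfr).toContinuousLinearEquiv, ?_⟩
    ext X Y; rfl
  refine ⟨fun x => (g x).inverse (w x), fun x hx => ?_, fun x hx X => ?_⟩
  · obtain ⟨e, he⟩ := hequiv x hx
    have h1 : ContDiffAt ℝ ∞ (fun y => (g y).inverse) x := by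
      have h2 : ContDiffAt ℝ ∞ ContinuousLinearMap.inverse (g x) := by
        rw [← he]; exact contDiffAt_map_inverse e
      exact h2.comp x (h.smooth_metric.contDiffAt (h.isOpen.mem_nhds hx))
    exact h1.contDiffWithinAt.clm_apply (hw x hx)
  · obtain ⟨e, he⟩ := hequiv x hx
    change g x ((g x).inverse (w x)) X = _
    rw [← he, ContinuousLinearMap.inverse_equiv]
    simp

/-- If a symmetric tensor `Z` satisfies `w(X) Z(Y, V) - w(Y) Z(X, V) = η(X) g(Y, V) - η(Y) g(X, V)`
with `w = s g(U, ·)`, `s ≠ 0` and `U` a unit vector, then `Z = l g + ν u ⊗ u`. -/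
theorem eq_of_wedge_eq (hE : 4 ≤ Module.finrank ℝ E) {b Z : E →L[ℝ] E →L[ℝ] ℝ}
    (hsymm : ∀ X Y, b X Y = b Y X) (hpos : ∀ X, X ≠ 0 → 0 < b X X)
    (hZ : ∀ X Y, Z X Y = Z Y X) {U : E} (hU : b U U = 1) {s : ℝ} (hs : s ≠ 0) {η : E →L[ℝ] ℝ}
    (h : ∀ X Y V, s * b U X * Z Y V - s * b U Y * Z X V = η X * b Y V - η Y * b X V) (Y V : E) :
    Z Y V = η U / s * b Y V + (Z U U - η U / s) * (b U Y * b U V) := by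
  have hη : ∀ X, b U X = 0 → η X = 0 := by
    intro X hX
    obtain ⟨Y, hY, y1, y2, -⟩ := exists_ne_zero_orthogonal hE b hsymm U X X
    have := h X Y Y
    rw [hX, hsymm U Y, y1, hsymm X Y, y2] at this
    have h2 : η X * b Y Y = 0 := by linear_combination -this
    exact (mul_eq_zero.1 h2).resolve_right (hpos Y hY).ne'
  have hperp : ∀ Y V, b U Y = 0 → Z Y V = η U / s * b Y V := by
    intro Y V hY
    have := h U Y V
    rw [hU, hY, hη Y hY] at this
    field_simp
    linear_combination this
  have hdec : ∀ Y V, Z Y V = η U / s * (b Y V - b U Y * b U V) + b U Y * Z U V := by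
    intro Y V
    have := hperp (Y - b U Y • U) V (by simp [hU])
    simp only [map_sub, map_smul, sub_apply, smul_apply, smul_eq_mul] at this
    linear_combination this
  have h1 := hdec Y V
  have h2 := hdec V U
  rw [hZ V U, hU, hsymm V U] at h2
  rw [h1, h2]
  ring

/-- A conformally flat weakly `Z` symmetric metric, with `Z = k P + ψ g` nondegenerate and `A ≠ B`
at `x₀`, has a concircular unit field near `x₀`. -/
theorem IsLeviCivita.exists_isConcircular (h : IsLeviCivita Ω g Γ)
    (hE : 4 ≤ Module.finrank ℝ E) {P Z : E → E →L[ℝ] E →L[ℝ] ℝ} (hPs : ContDiffOn ℝ ∞ P Ω)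
    (hP : IsSchouten Ω g Γ P) {k : ℝ} (hk : k ≠ 0) {ψ : E → ℝ} (hψ : ContDiffOn ℝ ∞ ψ Ω)
    (hZe : ∀ x, Z x = k • P x + ψ x • g x)
    (hZsymm : ∀ x ∈ Ω, ∀ X Y, Z x X Y = Z x Y X)
    (hZnd : ∀ x ∈ Ω, ∀ X, X ≠ 0 → ∃ Y, Z x X Y ≠ 0)
    {A B D : E → E →L[ℝ] ℝ} (hA : ContDiffOn ℝ ∞ A Ω) (hB : ContDiffOn ℝ ∞ B Ω)
    (hWZ : ∀ x ∈ Ω, ∀ X Y V, nablaForm Γ Z x X Y V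
      = A x X * Z x Y V + B x Y * Z x X V + D x V * Z x X Y)
    {x₀ : E} (hx₀ : x₀ ∈ Ω) (hω : A x₀ ≠ B x₀) :
    ∃ r > 0, ball x₀ r ⊆ Ω ∧ ∃ U H a b, IsConcircular (ball x₀ r) g Γ U H a b := by
  obtain ⟨W, hWs, hW⟩ := h.exists_dual_field (hA.sub hB)
  have hNs : ContDiffOn ℝ ∞ (fun x => g x (W x) (W x)) Ω :=
    (h.smooth_metric.clm_apply hWs).clm_apply hWs
  have hW0 : W x₀ ≠ 0 := by
    intro h0
    apply hω
    ext X
    have := hW x₀ hx₀ X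
    rw [h0] at this
    simp only [map_zero, zero_apply, sub_apply] at this
    linarith
  have hev : ∀ᶠ x in nhds x₀, 0 < g x (W x) (W x) :=
    (hNs.continuousOn.continuousAt (h.isOpen.mem_nhds hx₀)).eventually_const_lt
      (h.pos x₀ hx₀ _ hW0)
  obtain ⟨r, hr, hball⟩ := Metric.mem_nhds_iff.1
    (Filter.inter_mem hev (h.isOpen.mem_nhds hx₀))
  have hrΩ : ball x₀ r ⊆ Ω := fun x hx => (hball hx).2
  have hNpos : ∀ x ∈ ball x₀ r, 0 < g x (W x) (W x) := fun x hx => (hball hx).1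
  have h' := h.mono isOpen_ball hrΩ
  -- the length `s` of the covector `A - B` and its direction `U`
  let s : E → ℝ := fun x => Real.sqrt (g x (W x) (W x))
  have hs0 : ∀ x ∈ ball x₀ r, s x ≠ 0 := fun x hx => (Real.sqrt_pos.2 (hNpos x hx)).ne'
  have hs2 : ∀ x ∈ ball x₀ r, s x ^ 2 = g x (W x) (W x) := fun x hx =>
    Real.sq_sqrt (hNpos x hx).le
  have hss : ContDiffOn ℝ ∞ s (ball x₀ r) := (hNs.mono hrΩ).sqrt fun x hx => (hNpos x hx).ne'
  let U : E → E := fun x => (s x)⁻¹ • W x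
  have hUs : ContDiffOn ℝ ∞ U (ball x₀ r) := (hss.inv hs0).smul (hWs.mono hrΩ)
  have hU1 : ∀ x ∈ ball x₀ r, g x (U x) (U x) = 1 := by
    intro x hx
    have h3 := hs0 x hx
    simp only [U, map_smul, smul_apply, smul_eq_mul, ← hs2 x hx]
    field_simp
  have hωU : ∀ x ∈ ball x₀ r, ∀ X, A x X - B x X = s x * g x (U x) X := by
    intro x hx X
    have h3 := hs0 x hx
    have := hW x (hrΩ hx) X
    simp only [sub_apply] at this
    simp only [U, map_smul, smul_apply, smul_eq_mul, ← this]
    field_simp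
  have hZs : ContDiffOn ℝ ∞ Z Ω := by
    have : ContDiffOn ℝ ∞ (fun x => k • P x + ψ x • g x) Ω :=
      (hPs.const_smul k).add (hψ.smul h.smooth_metric)
    exact this.congr fun x _ => hZe x
  have hZd : ∀ x ∈ Ω, DifferentiableAt ℝ Z x := fun x hx =>
    (hZs.differentiableOn (by simp)).differentiableAt (h.isOpen.mem_nhds hx)
  -- the Codazzi equation for `P`, in terms of `Z`
  have hcod : ∀ x ∈ Ω, ∀ X Y V, nablaForm Γ Z x X Y V - nablaForm Γ Z x Y X V
      = fderiv ℝ ψ x X * g x Y V - fderiv ℝ ψ x Y * g x X V := by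
    intro x hx X Y V
    have hPd : DifferentiableAt ℝ P x :=
      (hPs.differentiableOn (by simp)).differentiableAt (h.isOpen.mem_nhds hx)
    have hψd : DifferentiableAt ℝ ψ x :=
      (hψ.differentiableOn (by simp)).differentiableAt (h.isOpen.mem_nhds hx)
    have key : ∀ X Y V, nablaForm Γ Z x X Y V
        = k * nablaForm Γ P x X Y V + fderiv ℝ ψ x X * g x Y V := by
      intro X Y V
      have dZ := hasDerivAt_along (hZd x hx) X
      have dR := ((hasDerivAt_along hPd X).const_smul k).add
        ((hasDerivAt_along hψd X).smul (hasDerivAt_along (h.metricAt hx) X))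
      have := deriv_along_unique (f := Z) (f' := fun x => k • P x + ψ x • g x) h.isOpen hx dZ dR
        (fun y _ => hZe y)
      simp only [nablaForm, this, hZe x, add_apply, smul_apply, smul_eq_mul, zero_smul, add_zero,
        h.compat x hx]
      ring
    rw [key, key, h.codazzi_schouten hE hP hPs hx X Y V]
    ring
  let l : E → ℝ := fun x => fderiv ℝ ψ x (U x) / s x
  let ν : E → ℝ := fun x => Z x (U x) (U x) - l x
  have hls : ContDiffOn ℝ ∞ l (ball x₀ r) :=
    (((hψ.fderiv_of_isOpen h.isOpen (by simp)).mono hrΩ).clm_apply hUs).div hss hs0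
  have hνs : ContDiffOn ℝ ∞ ν (ball x₀ r) :=
    (((hZs.mono hrΩ).clm_apply hUs).clm_apply hUs).sub hls
  have hZform : ∀ x ∈ ball x₀ r, ∀ Y V,
      Z x Y V = l x * g x Y V + ν x * (g x (U x) Y * g x (U x) V) := by
    intro x hx Y V
    refine eq_of_wedge_eq hE (h'.symm x hx) (h'.pos x hx) (hZsymm x (hrΩ hx)) (hU1 x hx)
      (hs0 x hx) (η := fderiv ℝ ψ x) (fun X Y V => ?_) Y V
    have e1 := hcod x (hrΩ hx) X Y V
    rw [hWZ x (hrΩ hx), hWZ x (hrΩ hx), hZsymm x (hrΩ hx) Y X] at e1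
    rw [← hωU x hx, ← hωU x hx]
    linear_combination e1
  have hl0 : ∀ x ∈ ball x₀ r, l x ≠ 0 := by
    intro x hx hl
    obtain ⟨Y, hY, y1, -, -⟩ := exists_ne_zero_orthogonal hE (g x) (h'.symm x hx)
      (U x) (U x) (U x)
    obtain ⟨V, hV⟩ := hZnd x (hrΩ hx) Y hY
    apply hV
    rw [hZform x hx, hl, h'.symm x hx (U x) Y, y1]
    ring
  have hUAt : ∀ x ∈ ball x₀ r, DifferentiableAt ℝ U x := fun x hx =>
    (hUs.differentiableOn (by simp)).differentiableAt (isOpen_ball.mem_nhds hx)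
  have hlAt : ∀ x ∈ ball x₀ r, DifferentiableAt ℝ l x := fun x hx =>
    (hls.differentiableOn (by simp)).differentiableAt (isOpen_ball.mem_nhds hx)
  have hνAt : ∀ x ∈ ball x₀ r, DifferentiableAt ℝ ν x := fun x hx =>
    (hνs.differentiableOn (by simp)).differentiableAt (isOpen_ball.mem_nhds hx)
  have hUn : ∀ x ∈ ball x₀ r, ∀ X, g x (nablaVec Γ U x X) (U x) = 0 := by
    intro x hx X
    have dU := hasDerivAt_along (hUAt x hx) X
    have d := ((hasDerivAt_along (h'.metricAt hx) X).clm_apply dU).clm_apply dU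
    have := deriv_along_unique (f := fun x => g x (U x) (U x)) (f' := fun _ => (1 : ℝ))
      isOpen_ball hx d (hasDerivAt_const 0 1) hU1
    simp only [zero_smul, add_zero, add_apply, h'.compat x hx,
      h'.symm x hx (U x) (fderiv ℝ U x X), h'.symm x hx (U x) (Γ x X (U x))] at this
    simp only [nablaVec, map_add, add_apply]
    linear_combination this / 2
  have hBD : ∀ x ∈ ball x₀ r, ∀ Y, D x Y = B x Y := by
    intro x hx Y
    obtain ⟨V, hV, v1, v2, -⟩ := exists_ne_zero_orthogonal hE (g x) (h'.symm x hx) (U x) Y Y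
    have e1 := hWZ x (hrΩ hx) V Y V
    have e2 := hWZ x (hrΩ hx) V V Y
    have hsym : nablaForm Γ Z x V Y V = nablaForm Γ Z x V V Y := by
      rw [h'.nablaForm_of_eq hx (hZd x (hrΩ hx)) (hUAt x hx) (hlAt x hx) (hνAt x hx) hZform,
        h'.nablaForm_of_eq hx (hZd x (hrΩ hx)) (hUAt x hx) (hlAt x hx) (hνAt x hx) hZform,
        h'.symm x hx Y V]
      ring
    rw [hsym, e2] at e1
    have v1' : g x (U x) V = 0 := by rw [h'.symm x hx, v1]
    have v2' : g x Y V = 0 := by rw [h'.symm x hx, v2]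
    simp only [hZform x hx, v1', v2, v2', mul_zero, zero_mul, add_zero] at e1
    have h2 : (D x Y - B x Y) * (l x * g x V V) = 0 := by linear_combination e1
    have := (mul_eq_zero.1 h2).resolve_right (mul_ne_zero (hl0 x hx) (h'.pos x hx V hV).ne')
    linarith
  -- the equation of weak `Z` symmetry in terms of `l`, `ν` and `U`
  have hmain : ∀ x ∈ ball x₀ r, ∀ X Y V, fderiv ℝ l x X * g x Y V
      + fderiv ℝ ν x X * (g x (U x) Y * g x (U x) V)
      + ν x * (g x (nablaVec Γ U x X) Y * g x (U x) V
        + g x (U x) Y * g x (nablaVec Γ U x X) V)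
      = A x X * (l x * g x Y V + ν x * (g x (U x) Y * g x (U x) V))
        + B x Y * (l x * g x X V + ν x * (g x (U x) X * g x (U x) V))
        + B x V * (l x * g x X Y + ν x * (g x (U x) X * g x (U x) Y)) := by
    intro x hx X Y V
    rw [← h'.nablaForm_of_eq hx (hZd x (hrΩ hx)) (hUAt x hx) (hlAt x hx) (hνAt x hx) hZform,
      hWZ x (hrΩ hx), hBD x hx, hZform x hx, hZform x hx, hZform x hx]
  have hBperp : ∀ x ∈ ball x₀ r, ∀ Y, g x (U x) Y = 0 → B x Y = 0 := by
    intro x hx Y hY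
    obtain ⟨V, hV, v1, v2, -⟩ := exists_ne_zero_orthogonal hE (g x) (h'.symm x hx) (U x) Y Y
    have e := hmain x hx V Y V
    have v1' : g x (U x) V = 0 := by rw [h'.symm x hx, v1]
    have v2' : g x Y V = 0 := by rw [h'.symm x hx, v2]
    simp only [v1', v2, v2', hY, mul_zero, zero_mul, add_zero, zero_add] at e
    exact (mul_eq_zero.1 e.symm).resolve_right
      (mul_ne_zero (hl0 x hx) (h'.pos x hx V hV).ne')
  have hBU : ∀ x ∈ ball x₀ r, ∀ Y, B x Y = B x (U x) * g x (U x) Y := by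
    intro x hx Y
    have := hBperp x hx (Y - g x (U x) Y • U x) (by simp [hU1 x hx])
    simp only [map_sub, map_smul, smul_eq_mul] at this
    linear_combination this
  have hdl : ∀ x ∈ ball x₀ r, ∀ X, fderiv ℝ l x X = l x * A x X := by
    intro x hx X
    obtain ⟨V, hV, v1, v2, -⟩ := exists_ne_zero_orthogonal hE (g x) (h'.symm x hx) (U x) X X
    have e := hmain x hx X V V
    have v1' : g x (U x) V = 0 := by rw [h'.symm x hx, v1]
    have v2' : g x X V = 0 := by rw [h'.symm x hx, v2]
    simp only [v1', v2', mul_zero, zero_mul, add_zero] at e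
    have h2 : (fderiv ℝ l x X - l x * A x X) * g x V V = 0 := by linear_combination e
    have := (mul_eq_zero.1 h2).resolve_right (h'.pos x hx V hV).ne'
    linarith
  have hdlν : ∀ x ∈ ball x₀ r, ∀ X, fderiv ℝ l x X + fderiv ℝ ν x X
      = (A x X + 2 * B x (U x) * g x (U x) X) * (l x + ν x) := by
    intro x hx X
    have e := hmain x hx X (U x) (U x)
    simp only [hU1 x hx, hUn x hx, h'.symm x hx X (U x)] at e
    linear_combination e
  have hnabla : ∀ x ∈ ball x₀ r, ∀ X, ν x • nablaVec Γ U x X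
      = (B x (U x) * l x) • (X - g x (U x) X • U x) := by
    intro x hx X
    refine h'.eq_of_inner hx fun Y => ?_
    have e := hmain x hx X Y (U x)
    simp only [hU1 x hx, hUn x hx, h'.symm x hx X (U x), h'.symm x hx Y (U x), hBU x hx Y] at e
    simp only [map_smul, map_sub, sub_apply, smul_apply, smul_eq_mul]
    linear_combination e - g x (U x) Y * hdlν x hx X
  -- the divergence of `U` bounds `B(U) l / ν`, so that `ν` obeys a linear equation
  let S : E → E →L[ℝ] E := fun x => fderiv ℝ U x + (Γ x).flip (U x)
  have hSn : ∀ x X, S x X = nablaVec Γ U x X := fun x X => rfl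
  let tr : (E →L[ℝ] E) →ₗ[ℝ] ℝ := LinearMap.trace ℝ E ∘ₗ ContinuousLinearMap.coeLM ℝ
  have htrc : Continuous tr := tr.continuous_of_finiteDimensional
  have hn1 : (Module.finrank ℝ E : ℝ) - 1 ≠ 0 := by
    have : (4 : ℝ) ≤ Module.finrank ℝ E := by exact_mod_cast hE
    intro h0; linarith
  have htr : ∀ x ∈ ball x₀ r,
      ν x * tr (S x) = B x (U x) * l x * ((Module.finrank ℝ E : ℝ) - 1) := by
    intro x hx
    have e : ν x • S x = (B x (U x) * l x) •
        (ContinuousLinearMap.id ℝ E - (g x (U x)).smulRight (U x)) := by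
      ext X; simpa [hSn] using hnabla x hx X
    have := congrArg tr e
    simp only [map_smul, map_sub, smul_eq_mul] at this
    have t1 : tr (ContinuousLinearMap.id ℝ E) = Module.finrank ℝ E := LinearMap.trace_id ℝ E
    have t2 : tr ((g x (U x)).smulRight (U x)) = 1 := by
      have : tr ((g x (U x)).smulRight (U x)) = LinearMap.trace ℝ E
        ((g x (U x) : E →ₗ[ℝ] ℝ).smulRight (U x)) := rfl
      rw [this, LinearMap.trace_smulRight]; exact hU1 x hx
    rw [this, t1, t2]
  have hSc : ContinuousOn S (ball x₀ r) := by
    have h1 : ContinuousOn (fderiv ℝ U) (ball x₀ r) :=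
      hUs.continuousOn_fderiv_of_isOpen isOpen_ball (by simp)
    have h2 : ContinuousOn (fun x => ContinuousLinearMap.flipₗᵢ ℝ E E E (Γ x)) (ball x₀ r) :=
      (ContinuousLinearMap.flipₗᵢ ℝ E E E).continuous.comp_continuousOn h'.smooth_conn.continuousOn
    exact h1.add (h2.clm_apply hUs.continuousOn)
  have hdν : ∀ x ∈ ball x₀ r, ∀ X, fderiv ℝ ν x X = ν x * (A x
      + (2 * tr (S x) * (l x + ν x) / (((Module.finrank ℝ E : ℝ) - 1) * l x)) • g x (U x)) X := by
    intro x hx X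
    have e1 := hdlν x hx X
    have e2 := htr x hx
    have h3 := hl0 x hx
    rw [hdl x hx] at e1
    simp only [add_apply, smul_apply, smul_eq_mul]
    field_simp
    linear_combination ((Module.finrank ℝ E : ℝ) - 1) * l x * e1
      - 2 * g x (U x) X * (l x + ν x) * e2
  have hPform : ∀ x ∈ ball x₀ r, ∀ X Y, P x X Y
      = (l x - ψ x) / k * g x X Y + ν x / k * (g x (U x) X * g x (U x) Y) := by
    intro x hx X Y
    have := hZform x hx X Y
    rw [hZe x] at this
    simp only [add_apply, smul_apply, smul_eq_mul] at this
    field_simp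
    linear_combination this
  have has : ContDiffOn ℝ ∞ (fun x => (l x - ψ x) / k) (ball x₀ r) :=
    (hls.sub (hψ.mono hrΩ)).div_const k
  by_cases hν0 : ν x₀ = 0
  · -- constant curvature
    have hνz : ∀ x ∈ ball x₀ r, ν x = 0 := fun x hx =>
      eq_zero_of_fderiv_eq_mul (hνs.differentiableOn (by simp))
        ((hA.mono hrΩ).continuousOn.add (ContinuousOn.smul
          (((continuousOn_const.mul (htrc.comp_continuousOn hSc)).mul
            (hls.continuousOn.add hνs.continuousOn)).div (continuousOn_const.mul hls.continuousOn)
            fun x hx => mul_ne_zero hn1 (hl0 x hx))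
          (h'.smooth_metric.continuousOn.clm_apply hUs.continuousOn))) hdν hν0 hx
    obtain ⟨ρ, hρ, hρr, V, H, hc⟩ := h'.exists_isConcircular_of_isotropic hE (hPs.mono hrΩ)
      (fun x hx => hP x (hrΩ hx)) has
      (fun x hx X Y => by rw [hPform x hx, hνz x hx]; ring) (mem_ball_self hr)
    exact ⟨ρ, hρ, hρr.trans hrΩ, V, H, _, _, hc⟩
  · have hev : ∀ᶠ x in nhds x₀, ν x ≠ 0 :=
      (hνs.continuousOn.continuousAt (ball_mem_nhds x₀ hr)).eventually_ne hν0
    obtain ⟨ρ, hρ, hball⟩ := Metric.mem_nhds_iff.1 (Filter.inter_mem hev (ball_mem_nhds x₀ hr))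
    have hρr : ball x₀ ρ ⊆ ball x₀ r := fun x hx => (hball hx).2
    have hν : ∀ x ∈ ball x₀ ρ, ν x ≠ 0 := fun x hx => (hball hx).1
    refine ⟨ρ, hρ, hρr.trans hrΩ, U, fun x => B x (U x) * l x / ν x, _, fun x => ν x / k,
      hUs.mono hρr, ?_, has.mono hρr, (hνs.mono hρr).div_const k, fun x hx => hU1 x (hρr hx),
      fun x hx X => ?_, P, hPs.mono (hρr.trans hrΩ), fun x hx => hP x (hrΩ (hρr hx)),
      fun x hx => hPform x (hρr hx)⟩
    · exact (((hB.mono (hρr.trans hrΩ)).clm_apply (hUs.mono hρr)).mul (hls.mono hρr)).div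
        (hνs.mono hρr) hν
    · have e := hnabla x (hρr hx) X
      have h3 := hν x hx
      rw [div_eq_inv_mul, mul_smul, ← e, smul_smul, inv_mul_cancel₀ h3, one_smul]

end WeaklyZSymmetric

/-! ### Components and index-free tensors -/

section Components

variable {n : ℕ}

/-- The bilinear form with a given matrix of components. -/
def formOf (S : Matrix (Fin n) (Fin n) ℝ) :
    EuclideanSpace ℝ (Fin n) →L[ℝ] EuclideanSpace ℝ (Fin n) →L[ℝ] ℝ :=
  ∑ i, ∑ j, S i j • (EuclideanSpace.proj i : EuclideanSpace ℝ (Fin n) →L[ℝ] ℝ).smulRight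
    (EuclideanSpace.proj j : EuclideanSpace ℝ (Fin n) →L[ℝ] ℝ)

/-- The covector with given components. -/
def covectorOf (w : Fin n → ℝ) : EuclideanSpace ℝ (Fin n) →L[ℝ] ℝ :=
  ∑ i, w i • (EuclideanSpace.proj i : EuclideanSpace ℝ (Fin n) →L[ℝ] ℝ)

/-- The contraction with the Christoffel symbols of `G`. -/
def connOf (G : EuclideanSpace ℝ (Fin n) → Matrix (Fin n) (Fin n) ℝ)
    (x : EuclideanSpace ℝ (Fin n)) :
    EuclideanSpace ℝ (Fin n) →L[ℝ] EuclideanSpace ℝ (Fin n) →L[ℝ] EuclideanSpace ℝ (Fin n) :=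
  ∑ k, ∑ i, ∑ j, christoffel G k i j x •
    (EuclideanSpace.proj i : EuclideanSpace ℝ (Fin n) →L[ℝ] ℝ).smulRight
      ((EuclideanSpace.proj j : EuclideanSpace ℝ (Fin n) →L[ℝ] ℝ).smulRight
        (EuclideanSpace.single k (1 : ℝ)))

theorem formOf_apply (S : Matrix (Fin n) (Fin n) ℝ) (X Y : EuclideanSpace ℝ (Fin n)) :
    formOf S X Y = ∑ i, ∑ j, S i j * (X i * Y j) := by
  simp [formOf]

theorem formOf_single (S : Matrix (Fin n) (Fin n) ℝ) (i j : Fin n) :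
    formOf S (EuclideanSpace.single i 1) (EuclideanSpace.single j 1) = S i j := by
  simp [formOf_apply]

theorem formOf_single_left (S : Matrix (Fin n) (Fin n) ℝ) (i : Fin n)
    (Y : EuclideanSpace ℝ (Fin n)) :
    formOf S (EuclideanSpace.single i 1) Y = ∑ j, S i j * Y j := by
  simp [formOf_apply]

theorem formOf_single_right (S : Matrix (Fin n) (Fin n) ℝ) (X : EuclideanSpace ℝ (Fin n))
    (j : Fin n) : formOf S X (EuclideanSpace.single j 1) = ∑ i, S i j * X i := by
  simp [formOf_apply]

theorem covectorOf_single (w : Fin n → ℝ) (i : Fin n) :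
    covectorOf w (EuclideanSpace.single i 1) = w i := by
  simp [covectorOf]

theorem connOf_apply (G : EuclideanSpace ℝ (Fin n) → Matrix (Fin n) (Fin n) ℝ)
    (x X Y : EuclideanSpace ℝ (Fin n)) (k : Fin n) :
    connOf G x X Y k = ∑ i, ∑ j, christoffel G k i j x * (X i * Y j) := by
  simp only [connOf, FunLike.coe_sum, Finset.sum_apply, WithLp.ofLp_sum, smul_apply,
    ContinuousLinearMap.smulRight_apply, PiLp.smul_apply, EuclideanSpace.coe_proj, smul_eq_mul,
    PiLp.single_apply]
  rw [Finset.sum_eq_single k (fun b _ hb => by simp [Ne.symm hb]) (by simp)]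
  simp

theorem connOf_single (G : EuclideanSpace ℝ (Fin n) → Matrix (Fin n) (Fin n) ℝ)
    (x : EuclideanSpace ℝ (Fin n)) (i j k : Fin n) :
    connOf G x (EuclideanSpace.single i 1) (EuclideanSpace.single j 1) k
      = christoffel G k i j x := by
  simp [connOf_apply]

theorem connOf_single_left (G : EuclideanSpace ℝ (Fin n) → Matrix (Fin n) (Fin n) ℝ)
    (x Y : EuclideanSpace ℝ (Fin n)) (i k : Fin n) :
    connOf G x (EuclideanSpace.single i 1) Y k = ∑ j, christoffel G k i j x * Y j := by
  simp [connOf_apply]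

/-- Linear functions on `ℝⁿ` agree if they agree on the coordinate vectors. -/
theorem eq_of_eq_single {F : Type*} [AddCommGroup F] [Module ℝ F]
    {f f' : EuclideanSpace ℝ (Fin n) → F}
    (hf : ∀ X Y (t : ℝ), f (X + t • Y) = f X + t • f Y)
    (hf' : ∀ X Y (t : ℝ), f' (X + t • Y) = f' X + t • f' Y)
    (h : ∀ i, f (EuclideanSpace.single i 1) = f' (EuclideanSpace.single i 1))
    (X : EuclideanSpace ℝ (Fin n)) : f X = f' X := by
  have mk : ∀ f : EuclideanSpace ℝ (Fin n) → F, (∀ X Y (t : ℝ), f (X + t • Y) = f X + t • f Y) →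
      IsLinearMap ℝ f := by
    intro f hf
    have h0 : f 0 = 0 := by simpa using hf 0 0 1
    exact ⟨fun X Y => by simpa using hf X Y 1, fun t X => by simpa [h0] using hf 0 X t⟩
  have : (mk f hf).mk' = (mk f' hf').mk' := by
    refine (EuclideanSpace.basisFun (Fin n) ℝ).toBasis.ext fun i => ?_
    simpa using h i
  exact LinearMap.congr_fun this X

variable {U : Set (EuclideanSpace ℝ (Fin n))}
  {G : EuclideanSpace ℝ (Fin n) → Matrix (Fin n) (Fin n) ℝ}

theorem contDiffOn_pd (hU : IsOpen U) {f : EuclideanSpace ℝ (Fin n) → ℝ} (hf : ContDiffOn ℝ ∞ f U)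
    (i : Fin n) : ContDiffOn ℝ ∞ (pd i f) U :=
  (hf.fderiv_of_isOpen hU (by simp)).clm_apply contDiffOn_const

theorem contDiffOn_formOf {S : EuclideanSpace ℝ (Fin n) → Matrix (Fin n) (Fin n) ℝ}
    (hS : ∀ i j, ContDiffOn ℝ ∞ (fun x => S x i j) U) :
    ContDiffOn ℝ ∞ (fun x => formOf (S x)) U := by
  unfold formOf
  exact ContDiffOn.sum fun i _ => ContDiffOn.sum fun j _ => (hS i j).smul contDiffOn_const

theorem contDiffOn_covectorOf {w : EuclideanSpace ℝ (Fin n) → Fin n → ℝ}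
    (hw : ∀ i, ContDiffOn ℝ ∞ (fun x => w x i) U) :
    ContDiffOn ℝ ∞ (fun x => covectorOf (w x)) U := by
  unfold covectorOf
  exact ContDiffOn.sum fun i _ => (hw i).smul contDiffOn_const

theorem contDiffOn_det {S : EuclideanSpace ℝ (Fin n) → Matrix (Fin n) (Fin n) ℝ}
    (hS : ∀ i j, ContDiffOn ℝ ∞ (fun x => S x i j) U) :
    ContDiffOn ℝ ∞ (fun x => (S x).det) U := by
  simp only [Matrix.det_apply]
  exact ContDiffOn.sum fun σ _ => (contDiffOn_prod fun i _ => hS _ _).const_smul _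

theorem contDiffOn_inv {S : EuclideanSpace ℝ (Fin n) → Matrix (Fin n) (Fin n) ℝ}
    (hS : ∀ i j, ContDiffOn ℝ ∞ (fun x => S x i j) U) (hdet : ∀ x ∈ U, (S x).det ≠ 0)
    (i j : Fin n) : ContDiffOn ℝ ∞ (fun x => (S x)⁻¹ i j) U := by
  simp only [Matrix.inv_def, Ring.inverse_eq_inv', Matrix.smul_apply, smul_eq_mul,
    Matrix.adjugate_apply]
  refine ((contDiffOn_det hS).inv hdet).mul (contDiffOn_det fun a b => ?_)
  by_cases h : a = j
  · subst h; simpa using contDiffOn_const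
  · simpa [Matrix.updateRow_ne h] using hS a b

namespace IsMetricOn

variable (hU : IsOpen U) (hG : IsMetricOn U G)
include hU hG

omit hU in
theorem det_ne_zero {x : EuclideanSpace ℝ (Fin n)} (hx : x ∈ U) : (G x).det ≠ 0 :=
  (hG.2 x hx).det_pos.ne'

omit hU in
theorem symm {x : EuclideanSpace ℝ (Fin n)} (hx : x ∈ U) (i j : Fin n) : G x i j = G x j i := by
  simpa using (hG.2 x hx).isHermitian.apply j i

theorem contDiffOn_christoffel (k i j : Fin n) : ContDiffOn ℝ ∞ (christoffel G k i j) U := by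
  unfold christoffel
  exact contDiffOn_const.mul (ContDiffOn.sum fun p _ =>
    (contDiffOn_inv hG.1 (fun x hx => hG.det_ne_zero hx) k p).mul
      (((contDiffOn_pd hU (hG.1 _ _) _).add (contDiffOn_pd hU (hG.1 _ _) _)).sub
        (contDiffOn_pd hU (hG.1 _ _) _)))

theorem contDiffOn_connOf : ContDiffOn ℝ ∞ (connOf G) U := by
  unfold connOf
  exact ContDiffOn.sum fun k _ => ContDiffOn.sum fun i _ => ContDiffOn.sum fun j _ =>
    (hG.contDiffOn_christoffel hU k i j).smul contDiffOn_const

theorem contDiffOn_riemann (j k l m : Fin n) : ContDiffOn ℝ ∞ (riemann G j k l m) U := by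
  unfold riemann
  have hc := hG.contDiffOn_christoffel hU
  exact ((contDiffOn_pd hU (hc _ _ _) _).sub (contDiffOn_pd hU (hc _ _ _) _)).add
    (ContDiffOn.sum fun p _ => ((hc _ _ _).mul (hc _ _ _)).sub ((hc _ _ _).mul (hc _ _ _)))

theorem contDiffOn_ricci (k l : Fin n) : ContDiffOn ℝ ∞ (fun x => ricci G x k l) U := by
  unfold ricci
  exact (ContDiffOn.sum fun m _ => hG.contDiffOn_riemann hU m k l m).neg

theorem contDiffOn_scalarCurv : ContDiffOn ℝ ∞ (scalarCurv G) U := by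
  unfold scalarCurv
  exact ContDiffOn.sum fun k _ => ContDiffOn.sum fun l _ =>
    (contDiffOn_inv hG.1 (fun x hx => hG.det_ne_zero hx) k l).mul (hG.contDiffOn_ricci hU k l)

theorem pd_symm {x : EuclideanSpace ℝ (Fin n)} (hx : x ∈ U) (p i j : Fin n) :
    pd p (fun y => G y i j) x = pd p (fun y => G y j i) x := by
  have : (fun y => G y i j) =ᶠ[nhds x] fun y => G y j i := by
    filter_upwards [hU.mem_nhds hx] with y hy using hG.symm hy i j
  rw [pd, pd, this.fderiv_eq]

omit hG in
theorem fderiv_formOf {S : EuclideanSpace ℝ (Fin n) → Matrix (Fin n) (Fin n) ℝ}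
    (hS : ∀ i j, ContDiffOn ℝ ∞ (fun x => S x i j) U) {x : EuclideanSpace ℝ (Fin n)} (hx : x ∈ U)
    (k i j : Fin n) : fderiv ℝ (fun x => formOf (S x)) x (EuclideanSpace.single k 1)
      (EuclideanSpace.single i 1) (EuclideanSpace.single j 1) = pd k (fun y => S y i j) x := by
  have h1 : DifferentiableAt ℝ (fun x => formOf (S x)) x :=
    ((contDiffOn_formOf hS).differentiableOn (by simp)).differentiableAt (hU.mem_nhds hx)
  have h2 : DifferentiableAt ℝ (fun x => S x i j) x :=
    ((hS i j).differentiableOn (by simp)).differentiableAt (hU.mem_nhds hx)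
  have := deriv_along_unique (f := fun x => formOf (S x) (EuclideanSpace.single i 1)
    (EuclideanSpace.single j 1)) (f' := fun x => S x i j) hU hx
    (((hasDerivAt_along h1 (EuclideanSpace.single k 1)).clm_apply
      (hasDerivAt_const 0 (EuclideanSpace.single i 1))).clm_apply
        (hasDerivAt_const 0 (EuclideanSpace.single j 1)))
    (hasDerivAt_along h2 (EuclideanSpace.single k 1)) (fun y _ => formOf_single _ i j)
  simpa [pd] using this

omit hU in
/-- The Christoffel symbols of the first kind. -/
theorem sum_christoffel_mul {x : EuclideanSpace ℝ (Fin n)} (hx : x ∈ U) (i j k : Fin n) :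
    ∑ p, christoffel G p i j x * G x p k = (1 / 2) *
      (pd i (fun y => G y j k) x + pd j (fun y => G y i k) x - pd k (fun y => G y i j) x) := by
  have hinv : ∀ q, ∑ p, (G x)⁻¹ p q * G x p k = if q = k then 1 else 0 := by
    intro q
    have h1 : G x * (G x)⁻¹ = 1 := Matrix.mul_nonsing_inv _ (hG.det_ne_zero hx).isUnit
    have h2 := congrFun (congrFun h1 k) q
    rw [Matrix.mul_apply, Matrix.one_apply] at h2
    rw [show (if q = k then (1 : ℝ) else 0) = if k = q then 1 else 0 by simp [eq_comm], ← h2]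
    exact Finset.sum_congr rfl fun p _ => by rw [hG.symm hx p k, mul_comm]
  simp only [christoffel, Finset.mul_sum, Finset.sum_mul]
  rw [Finset.sum_comm]
  have : ∀ q, ∑ p, 1 / 2 * ((G x)⁻¹ p q * (pd i (fun y => G y j q) x + pd j (fun y => G y i q) x
      - pd q (fun y => G y i j) x)) * G x p k = (if q = k then 1 else 0) * (1 / 2 *
      (pd i (fun y => G y j q) x + pd j (fun y => G y i q) x - pd q (fun y => G y i j) x)) := by
    intro q
    rw [← hinv q, Finset.sum_mul]
    exact Finset.sum_congr rfl fun p _ => by ring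
  rw [Finset.sum_congr rfl fun q _ => this q]
  simp

/-- The Christoffel symbols define the Levi-Civita connection. -/
theorem isLeviCivita : IsLeviCivita U (fun x => formOf (G x)) (connOf G) where
  isOpen := hU
  smooth_metric := contDiffOn_formOf hG.1
  smooth_conn := hG.contDiffOn_connOf hU
  symm x hx X Y := by
    rw [formOf_apply, formOf_apply, Finset.sum_comm]
    refine Finset.sum_congr rfl fun i _ => Finset.sum_congr rfl fun j _ => ?_
    rw [hG.symm hx j i]; ring
  pos x hx X hX := by
    have h1 := (hG.2 x hx).dotProduct_mulVec_pos (x := X.ofLp) (by simpa using hX)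
    refine lt_of_lt_of_eq h1 ?_
    rw [formOf_apply]
    simp only [dotProduct, Matrix.mulVec, Finset.mul_sum, Pi.star_apply, star_trivial]
    exact Finset.sum_congr rfl fun i _ => Finset.sum_congr rfl fun j _ => by ring
  torsion_free x hx X Y := by
    ext k
    rw [connOf_apply, connOf_apply, Finset.sum_comm]
    refine Finset.sum_congr rfl fun i _ => Finset.sum_congr rfl fun j _ => ?_
    have : christoffel G k j i x = christoffel G k i j x := by
      simp only [christoffel]
      congr 1
      refine Finset.sum_congr rfl fun p _ => ?_
      rw [hG.pd_symm hU hx p i j]; ring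
    rw [this]; ring
  compat x hx X Y Z := by
    refine eq_of_eq_single (f := fun X => fderiv ℝ (fun x => formOf (G x)) x X Y Z)
      (f' := fun X => formOf (G x) (connOf G x X Y) Z + formOf (G x) Y (connOf G x X Z))
      (fun X X' t => by simp) (fun X X' t => by simp; ring) (fun i => ?_) X
    refine eq_of_eq_single
      (f := fun Y => fderiv ℝ (fun x => formOf (G x)) x (EuclideanSpace.single i 1) Y Z)
      (f' := fun Y => formOf (G x) (connOf G x (EuclideanSpace.single i 1) Y) Z
        + formOf (G x) Y (connOf G x (EuclideanSpace.single i 1) Z))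
      (fun X X' t => by simp) (fun X X' t => by simp; ring) (fun j => ?_) Y
    refine eq_of_eq_single
      (f := fun Z => fderiv ℝ (fun x => formOf (G x)) x (EuclideanSpace.single i 1)
        (EuclideanSpace.single j 1) Z)
      (f' := fun Z => formOf (G x) (connOf G x (EuclideanSpace.single i 1)
        (EuclideanSpace.single j 1)) Z + formOf (G x) (EuclideanSpace.single j 1)
          (connOf G x (EuclideanSpace.single i 1) Z))
      (fun X X' t => by simp) (fun X X' t => by simp; ring) (fun k => ?_) Z
    beta_reduce
    rw [fderiv_formOf hU hG.1 hx, formOf_single_right, formOf_single_left]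
    simp only [connOf_single]
    have e1 := hG.sum_christoffel_mul hx i j k
    have e2 := hG.sum_christoffel_mul hx i k j
    have c1 : ∑ p, G x p k * christoffel G p i j x = ∑ p, christoffel G p i j x * G x p k :=
      Finset.sum_congr rfl fun p _ => mul_comm _ _
    have c2 : ∑ p, G x j p * christoffel G p i k x = ∑ p, christoffel G p i k x * G x p j :=
      Finset.sum_congr rfl fun p _ => by rw [hG.symm hx j p, mul_comm]
    rw [c1, c2, e1, e2, hG.pd_symm hU hx i k j]
    ring

/-- The components of the curvature. -/
theorem curv_single {x : EuclideanSpace ℝ (Fin n)} (hx : x ∈ U) (j k l m : Fin n) :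
    curv (connOf G) x (EuclideanSpace.single j 1) (EuclideanSpace.single k 1)
      (EuclideanSpace.single l 1) m = riemann G j k l m x := by
  have hd : ∀ a b c : Fin n, fderiv ℝ (connOf G) x (EuclideanSpace.single a 1)
      (EuclideanSpace.single b 1) (EuclideanSpace.single c 1) m
        = pd a (christoffel G m b c) x := by
    intro a b c
    have h1 : DifferentiableAt ℝ (connOf G) x :=
      ((hG.contDiffOn_connOf hU).differentiableOn (by simp)).differentiableAt (hU.mem_nhds hx)
    have h2 : DifferentiableAt ℝ (christoffel G m b c) x :=
      ((hG.contDiffOn_christoffel hU m b c).differentiableOn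
        (by simp)).differentiableAt (hU.mem_nhds hx)
    have d1 := ((hasDerivAt_along h1 (EuclideanSpace.single a 1)).clm_apply
      (hasDerivAt_const 0 (EuclideanSpace.single b 1))).clm_apply
        (hasDerivAt_const 0 (EuclideanSpace.single c 1))
    have d2 := (hasDerivAt_const (0 : ℝ)
      (EuclideanSpace.proj m : EuclideanSpace ℝ (Fin n) →L[ℝ] ℝ)).clm_apply d1
    have := deriv_along_unique (f := fun x => (EuclideanSpace.proj m :
        EuclideanSpace ℝ (Fin n) →L[ℝ] ℝ) (connOf G x (EuclideanSpace.single b 1)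
        (EuclideanSpace.single c 1))) (f' := christoffel G m b c) hU hx d2
      (hasDerivAt_along h2 (EuclideanSpace.single a 1)) (fun y _ => connOf_single G y b c m)
    simpa [pd] using this
  simp only [curv, PiLp.sub_apply, PiLp.add_apply, hd, riemann,
    connOf_single_left G x (connOf G x _ _), connOf_single, Finset.sum_sub_distrib]
  ring

end IsMetricOn

end Components

/-! ### The Schouten tensor in coordinates -/

section Schouten

/-- A Schouten tensor is symmetric, by the first Bianchi identity. -/
theorem IsLeviCivita.schouten_symm {E : Type*} [NormedAddCommGroup E] [NormedSpace ℝ E]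
    [FiniteDimensional ℝ E] (hE : 4 ≤ Module.finrank ℝ E) {Ω : Set E} {g P : E → E →L[ℝ] E →L[ℝ] ℝ}
    {Γ : E → E →L[ℝ] E →L[ℝ] E} (h : IsLeviCivita Ω g Γ) (hP : IsSchouten Ω g Γ P)
    {x : E} (hx : x ∈ Ω) (Y Z : E) : P x Y Z = P x Z Y := by
  obtain ⟨X, hX, hXY, hXZ, -⟩ := exists_ne_zero_orthogonal hE (g x) (h.symm x hx) Y Z Z
  have hb := congrArg (fun v => g x v X) (h.bianchi_one hx X Y Z)
  simp only [map_add, add_apply, map_zero, zero_apply, hP x hx] at hb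
  rw [h.symm x hx Y X, h.symm x hx Z X, h.symm x hx Z Y, hXY, hXZ] at hb
  have : g x X X * (P x Y Z - P x Z Y) = 0 := by linear_combination -hb
  exact sub_eq_zero.1 ((mul_eq_zero.1 this).resolve_left (h.pos x hx X hX).ne')

variable {n : ℕ}

theorem formOf_add (S T : Matrix (Fin n) (Fin n) ℝ) : formOf (S + T) = formOf S + formOf T := by
  simp only [formOf, Matrix.add_apply, add_smul, Finset.sum_add_distrib]

theorem formOf_smul (c : ℝ) (S : Matrix (Fin n) (Fin n) ℝ) : formOf (c • S) = c • formOf S := by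
  simp only [formOf, Matrix.smul_apply, smul_assoc, Finset.smul_sum]

/-- The components of the Schouten tensor `(Ric - s / (2(n - 1)) g) / (n - 2)`. -/
def schouten (G : EuclideanSpace ℝ (Fin n) → Matrix (Fin n) (Fin n) ℝ)
    (x : EuclideanSpace ℝ (Fin n)) : Matrix (Fin n) (Fin n) ℝ :=
  (1 / ((n : ℝ) - 2)) • (ricci G x - (scalarCurv G x / (2 * ((n : ℝ) - 1))) • G x)

variable {U : Set (EuclideanSpace ℝ (Fin n))}
  {G : EuclideanSpace ℝ (Fin n) → Matrix (Fin n) (Fin n) ℝ}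

theorem zTensor_eq (hn : 3 < n) (f : EuclideanSpace ℝ (Fin n) → ℝ) (x : EuclideanSpace ℝ (Fin n)) :
    zTensor G f x = ((n : ℝ) - 2) • schouten G x
      + (scalarCurv G x / (2 * ((n : ℝ) - 1)) + f x) • G x := by
  have h2 : ((n : ℝ) - 2) ≠ 0 := by
    have : (3 : ℝ) < n := by exact_mod_cast hn
    linarith
  rw [zTensor, schouten, smul_smul, mul_one_div_cancel h2]
  module

namespace IsMetricOn

variable (hU : IsOpen U) (hG : IsMetricOn U G)
include hU hG

theorem contDiffOn_schouten (i j : Fin n) : ContDiffOn ℝ ∞ (fun x => schouten G x i j) U := by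
  simp only [schouten, Matrix.smul_apply, Matrix.sub_apply, smul_eq_mul]
  exact contDiffOn_const.mul ((hG.contDiffOn_ricci hU i j).sub
    (((hG.contDiffOn_scalarCurv hU).div_const _).mul (hG.1 i j)))

omit hU in
/-- Lowering the last index of the Weyl tensor. -/
theorem sum_mul_riemann (hn : 3 < n) {x : EuclideanSpace ℝ (Fin n)} (hx : x ∈ U) (j k l v : Fin n)
    (hw : ∀ m, weyl G j k l m x = 0) :
    ∑ m, G x m v * riemann G j k l m x = -(schouten G x k l * G x j v
      - schouten G x j l * G x k v + G x k l * schouten G x j v - G x j l * schouten G x k v) := by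
  have hn' : (3 : ℝ) < n := by exact_mod_cast hn
  have h2 : ((n : ℝ) - 2) ≠ 0 := by linarith
  have h1 : ((n : ℝ) - 1) ≠ 0 := by linarith
  have s1 : ∀ a, ∑ m, G x m v * (1 : Matrix (Fin n) (Fin n) ℝ) a m = G x a v := by
    intro a; simp [Matrix.one_apply]
  have s2 : ∀ a, ∑ m, G x m v * (ricci G x * (G x)⁻¹) a m = ricci G x a v := by
    intro a
    have h3 : ricci G x * (G x)⁻¹ * G x = ricci G x := by
      rw [mul_assoc, Matrix.nonsing_inv_mul _ (hG.det_ne_zero hx).isUnit, mul_one]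
    have h4 := congrFun (congrFun h3 a) v
    rw [Matrix.mul_apply] at h4
    rw [← h4]
    exact Finset.sum_congr rfl fun m _ => mul_comm _ _
  set c1 := 1 / ((n : ℝ) - 2) with hc1
  set c2 := scalarCurv G x / (((n : ℝ) - 1) * ((n : ℝ) - 2)) with hc2
  have hr : ∀ m, G x m v * riemann G j k l m x =
      (c2 * G x k l - c1 * ricci G x k l) * (G x m v * (1 : Matrix (Fin n) (Fin n) ℝ) j m)
      + (c1 * ricci G x j l - c2 * G x j l) * (G x m v * (1 : Matrix (Fin n) (Fin n) ℝ) k m)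
      + (-(c1 * G x k l)) * (G x m v * (ricci G x * (G x)⁻¹) j m)
      + (c1 * G x j l) * (G x m v * (ricci G x * (G x)⁻¹) k m) := by
    intro m
    have := hw m
    simp only [weyl] at this
    linear_combination G x m v * this
  rw [Finset.sum_congr rfl fun m _ => hr m]
  simp only [Finset.sum_add_distrib, ← Finset.mul_sum, s1, s2]
  simp only [schouten, Matrix.smul_apply, Matrix.sub_apply, smul_eq_mul, hc1, hc2]
  field_simp
  ring

/-- A conformally flat metric in dimension greater than three has a Schouten tensor. -/
theorem isSchouten (hn : 3 < n) (hw : ∀ x ∈ U, ∀ j k l m, weyl G j k l m x = 0) :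
    IsSchouten U (fun x => formOf (G x)) (connOf G) (fun x => formOf (schouten G x)) := by
  intro x hx X Y Z V
  let g := formOf (G x)
  let P := formOf (schouten G x)
  let L := fun X Y Z V => g (curv (connOf G) x X Y Z) V
  let R := fun X Y Z V => -(P Y Z * g X V - P X Z * g Y V + g Y Z * P X V - g X Z * P Y V)
  change L X Y Z V = R X Y Z V
  refine eq_of_eq_single (f := fun X => L X Y Z V) (f' := fun X => R X Y Z V)
    (fun X X' t => by simp [L, curv]; ring) (fun X X' t => by simp [R]; ring) (fun j => ?_) X
  refine eq_of_eq_single (f := fun Y => L _ Y Z V) (f' := fun Y => R _ Y Z V)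
    (fun X X' t => by simp [L, curv]; ring) (fun X X' t => by simp [R]; ring) (fun k => ?_) Y
  refine eq_of_eq_single (f := fun Z => L _ _ Z V) (f' := fun Z => R _ _ Z V)
    (fun X X' t => by simp [L, curv]; ring) (fun X X' t => by simp [R]; ring) (fun l => ?_) Z
  refine eq_of_eq_single (f := fun V => L _ _ _ V) (f' := fun V => R _ _ _ V)
    (fun X X' t => by simp [L]) (fun X X' t => by simp [R]; ring) (fun v => ?_) V
  simp only [L, R, g, P, formOf_single]
  rw [formOf_single_right, ← hG.sum_mul_riemann hn hx j k l v (hw x hx j k l)]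
  exact Finset.sum_congr rfl fun m _ => by rw [hG.curv_single hU hx]

omit hG in
/-- The components of a covariant derivative. -/
theorem nablaForm_single {S : EuclideanSpace ℝ (Fin n) → Matrix (Fin n) (Fin n) ℝ}
    (hS : ∀ i j, ContDiffOn ℝ ∞ (fun x => S x i j) U) {x : EuclideanSpace ℝ (Fin n)} (hx : x ∈ U)
    (k j l : Fin n) : nablaForm (connOf G) (fun x => formOf (S x)) x (EuclideanSpace.single k 1)
      (EuclideanSpace.single j 1) (EuclideanSpace.single l 1) = covDeriv G S k j l x := by
  rw [nablaForm, fderiv_formOf hU hS hx, formOf_single_right, formOf_single_left, covDeriv,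
    Finset.sum_add_distrib, ← sub_sub]
  simp only [connOf_single]
  congr 1
  · congr 1
    exact Finset.sum_congr rfl fun m _ => mul_comm _ _
  · exact Finset.sum_congr rfl fun m _ => mul_comm _ _

/-- A conformally flat weakly `Z` symmetric metric with non-singular `Z` carries a unit concircular
field near every point where `A ≠ B`. -/
theorem exists_isConcircular (hn : 3 < n) (hw : ∀ x ∈ U, ∀ j k l m, weyl G j k l m x = 0)
    {f : EuclideanSpace ℝ (Fin n) → ℝ} (hf : ContDiffOn ℝ ∞ f U)
    (hdet : ∀ x ∈ U, (zTensor G f x).det ≠ 0) {A B D : EuclideanSpace ℝ (Fin n) → Fin n → ℝ}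
    (hA : ∀ i, ContDiffOn ℝ ∞ (fun x => A x i) U) (hB : ∀ i, ContDiffOn ℝ ∞ (fun x => B x i) U)
    (hWZ : ∀ x ∈ U, ∀ k j l, covDeriv G (zTensor G f) k j l x =
      A x k * zTensor G f x j l + B x j * zTensor G f x k l + D x l * zTensor G f x k j)
    {x₀ : EuclideanSpace ℝ (Fin n)} (hx₀ : x₀ ∈ U) (hω : A x₀ ≠ B x₀) :
    ∃ r > 0, Metric.ball x₀ r ⊆ U ∧ ∃ V H a b,
      IsConcircular (Metric.ball x₀ r) (fun x => formOf (G x)) (connOf G) V H a b := by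
  have hn' : (3 : ℝ) < n := by exact_mod_cast hn
  have hE : 4 ≤ Module.finrank ℝ (EuclideanSpace ℝ (Fin n)) := by
    rw [finrank_euclideanSpace_fin]; exact hn
  have hL := hG.isLeviCivita hU
  have hS := hG.isSchouten hU hn hw
  have hψ : ContDiffOn ℝ ∞ (fun x => scalarCurv G x / (2 * ((n : ℝ) - 1)) + f x) U :=
    ((hG.contDiffOn_scalarCurv hU).div_const _).add hf
  have hZe : ∀ x, formOf (zTensor G f x) = ((n : ℝ) - 2) • formOf (schouten G x)
      + (scalarCurv G x / (2 * ((n : ℝ) - 1)) + f x) • formOf (G x) := fun x => by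
    rw [zTensor_eq hn, formOf_add, formOf_smul, formOf_smul]
  have hZs : ∀ i j, ContDiffOn ℝ ∞ (fun x => zTensor G f x i j) U := fun i j => by
    simp only [zTensor, Matrix.add_apply, Matrix.smul_apply, smul_eq_mul]
    exact (hG.contDiffOn_ricci hU i j).add (hf.mul (hG.1 i j))
  refine hL.exists_isConcircular hE (P := fun x => formOf (schouten G x))
    (Z := fun x => formOf (zTensor G f x)) (A := fun x => covectorOf (A x))
    (B := fun x => covectorOf (B x)) (D := fun x => covectorOf (D x))
    (contDiffOn_formOf (hG.contDiffOn_schouten hU)) hS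
    (sub_ne_zero.2 (by linarith : (n : ℝ) ≠ 2)) hψ hZe (fun x hx X Y => ?_) (fun x hx X hX => ?_)
    (contDiffOn_covectorOf hA) (contDiffOn_covectorOf hB) (fun x hx X Y V => ?_) hx₀ (fun h => ?_)
  · simp only [hZe, add_apply, smul_apply]
    rw [hL.schouten_symm hE hS hx X Y, hL.symm x hx X Y]
  · by_contra! hc
    refine hX (WithLp.ofLp_injective 2 ?_)
    refine Matrix.eq_zero_of_vecMul_eq_zero (hdet x hx) (funext fun j => ?_)
    have := hc (EuclideanSpace.single j 1)
    rw [formOf_single_right] at this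
    rw [Pi.zero_apply, ← this, Matrix.vecMul, dotProduct]
    exact Finset.sum_congr rfl fun i _ => mul_comm _ _
  · let L := fun X Y V => nablaForm (connOf G) (fun x => formOf (zTensor G f x)) x X Y V
    let R := fun X Y V => covectorOf (A x) X * formOf (zTensor G f x) Y V
      + covectorOf (B x) Y * formOf (zTensor G f x) X V
      + covectorOf (D x) V * formOf (zTensor G f x) X Y
    change L X Y V = R X Y V
    refine eq_of_eq_single (f := fun X => L X Y V) (f' := fun X => R X Y V)
      (fun X X' t => by simp [L, nablaForm]; ring) (fun X X' t => by simp [R]; ring)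
      (fun j => ?_) X
    refine eq_of_eq_single (f := fun Y => L _ Y V) (f' := fun Y => R _ Y V)
      (fun X X' t => by simp [L, nablaForm]; ring) (fun X X' t => by simp [R]; ring)
      (fun k => ?_) Y
    refine eq_of_eq_single (f := fun V => L _ _ V) (f' := fun V => R _ _ V)
      (fun X X' t => by simp [L, nablaForm]; ring) (fun X X' t => by simp [R]; ring)
      (fun l => ?_) V
    simp only [L, R, formOf_single, covectorOf_single]
    rw [nablaForm_single hU hZs hx, hWZ x hx]
  · refine hω (funext fun i => ?_)
    rw [← covectorOf_single (A x₀) i, ← covectorOf_single (B x₀) i]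
    exact congrArg (fun w : EuclideanSpace ℝ (Fin n) →L[ℝ] ℝ => w (EuclideanSpace.single i 1)) h

end IsMetricOn

end Schouten

/-! ### Immersions and homothetic pullbacks of the metric -/

section Immersion

variable {E : Type*} [NormedAddCommGroup E] [NormedSpace ℝ E]
  {F : Type*} [NormedAddCommGroup F] [NormedSpace ℝ F]
  {Ω : Set E} {g : E → E →L[ℝ] E →L[ℝ] ℝ} {Γ : E → E →L[ℝ] E →L[ℝ] E}
  {V : Set F} {g' : F → F →L[ℝ] F →L[ℝ] ℝ} {Γ' : F → F →L[ℝ] F →L[ℝ] F} {Ψ : F → E}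

/-- The covariant derivative in the direction `v` of the vector field `DΨ w` along the map `Ψ`. -/
def nablaMap (Γ : E → E →L[ℝ] E →L[ℝ] E) (Ψ : F → E) (y v w : F) : E :=
  fderiv ℝ (fderiv ℝ Ψ) y v w + Γ (Ψ y) (fderiv ℝ Ψ y v) (fderiv ℝ Ψ y w)

section

variable (hV : IsOpen V) (hΨ : ContDiffOn ℝ ∞ Ψ V)
include hV hΨ

theorem differentiableAt_of_smoothOn {y : F} (hy : y ∈ V) : DifferentiableAt ℝ Ψ y :=
  (hΨ.differentiableOn (by simp)).differentiableAt (hV.mem_nhds hy)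

theorem differentiableAt_fderiv_of_smoothOn {y : F} (hy : y ∈ V) :
    DifferentiableAt ℝ (fderiv ℝ Ψ) y :=
  ((hΨ.contDiffAt (hV.mem_nhds hy)).fderiv_right (m := 1) (by norm_cast)).differentiableAt (by simp)

theorem fderiv_fderiv_symm {y : F} (hy : y ∈ V) (v w : F) :
    fderiv ℝ (fderiv ℝ Ψ) y v w = fderiv ℝ (fderiv ℝ Ψ) y w v :=
  ((hΨ.contDiffAt (hV.mem_nhds hy)).isSymmSndFDerivAt
    (by simp only [minSmoothness_of_isRCLikeNormedField]; exact WithTop.coe_le_coe.2 le_top)).eq v w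

theorem hasDerivAt_comp_along {W : Type*} [NormedAddCommGroup W] [NormedSpace ℝ W] {A : E → W}
    {y : F} (hy : y ∈ V) (hA : DifferentiableAt ℝ A (Ψ y)) (v : F) :
    HasDerivAt (fun t : ℝ => A (Ψ (y + t • v))) (fderiv ℝ A (Ψ y) (fderiv ℝ Ψ y v)) 0 := by
  have h1 := hasDerivAt_along (differentiableAt_of_smoothOn hV hΨ hy) v
  have h2 : HasFDerivAt A (fderiv ℝ A (Ψ y)) (Ψ (y + (0 : ℝ) • v)) := by
    simpa using hA.hasFDerivAt
  exact HasFDerivAt.comp_hasDerivAt (f := fun t : ℝ => Ψ (y + t • v)) 0 h2 h1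

variable (h : IsLeviCivita Ω g Γ) (hm : Set.MapsTo Ψ V Ω)
include h hm

theorem nablaMap_symm {y : F} (hy : y ∈ V) (v w : F) : nablaMap Γ Ψ y v w = nablaMap Γ Ψ y w v := by
  rw [nablaMap, nablaMap, fderiv_fderiv_symm hV hΨ hy, h.torsion_free _ (hm hy)]

/-- The product rule for inner products of vector fields along `Ψ`. -/
theorem hasDerivAt_inner_along {y : F} (hy : y ∈ V) (v : F) {Y Z : F → E} {dY dZ : E}
    (hY : HasDerivAt (fun t : ℝ => Y (y + t • v)) dY 0)
    (hZ : HasDerivAt (fun t : ℝ => Z (y + t • v)) dZ 0) :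
    HasDerivAt (fun t : ℝ => g (Ψ (y + t • v)) (Y (y + t • v)) (Z (y + t • v)))
      (g (Ψ y) (dY + Γ (Ψ y) (fderiv ℝ Ψ y v) (Y y)) (Z y)
        + g (Ψ y) (Y y) (dZ + Γ (Ψ y) (fderiv ℝ Ψ y v) (Z y))) 0 := by
  have d := ((hasDerivAt_comp_along hV hΨ hy (h.metricAt (hm hy)) v).clm_apply hY).clm_apply hZ
  refine d.congr_deriv ?_
  simp only [zero_smul, add_zero, add_apply, h.compat _ (hm hy), map_add]
  ring

theorem hasDerivAt_inner_fderiv {y : F} (hy : y ∈ V) (v w z : F) :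
    HasDerivAt (fun t : ℝ => g (Ψ (y + t • v)) (fderiv ℝ Ψ (y + t • v) w)
      (fderiv ℝ Ψ (y + t • v) z)) (g (Ψ y) (nablaMap Γ Ψ y v w) (fderiv ℝ Ψ y z)
        + g (Ψ y) (fderiv ℝ Ψ y w) (nablaMap Γ Ψ y v z)) 0 := by
  have d := hasDerivAt_along (differentiableAt_fderiv_of_smoothOn hV hΨ hy) v
  exact (hasDerivAt_inner_along hV hΨ h hm hy v (Y := fun y => fderiv ℝ Ψ y w)
    (Z := fun y => fderiv ℝ Ψ y z) (d.clm_apply (hasDerivAt_const 0 w))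
    (d.clm_apply (hasDerivAt_const 0 z))).congr_deriv (by simp [nablaMap])

omit hV in
/-- The tangential part of `nablaMap` is the Levi-Civita connection of any metric homothetic to the
pullback: this is the uniqueness part of the fundamental theorem of Riemannian geometry. -/
theorem inner_nablaMap (h' : IsLeviCivita V g' Γ') {c : ℝ} (hc : c ≠ 0)
    (hg : ∀ y ∈ V, ∀ v w, g' y v w = c * g (Ψ y) (fderiv ℝ Ψ y v) (fderiv ℝ Ψ y w))
    {y : F} (hy : y ∈ V) (v w z : F) :
    g (Ψ y) (nablaMap Γ Ψ y v w) (fderiv ℝ Ψ y z)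
      = g (Ψ y) (fderiv ℝ Ψ y (Γ' y v w)) (fderiv ℝ Ψ y z) := by
  have hV := h'.isOpen
  -- the difference of both sides is symmetric in the first two and skew in the last two slots
  let T : F → F → F → ℝ := fun v w z => c * g (Ψ y) (nablaMap Γ Ψ y v w) (fderiv ℝ Ψ y z)
    - g' y (Γ' y v w) z
  have hsymm : ∀ v w z, T v w z = T w v z := fun v w z => by
    simp only [T, nablaMap_symm hV hΨ h hm hy v w, h'.torsion_free y hy v w]
  have hskew : ∀ v w z, T v w z = -T v z w := fun v w z => by
    have d1 := ((hasDerivAt_along (h'.metricAt hy) v).clm_apply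
      (hasDerivAt_const 0 w)).clm_apply (hasDerivAt_const 0 z)
    have d2 := (hasDerivAt_inner_fderiv hV hΨ h hm hy v w z).const_mul c
    have := deriv_along_unique (f := fun y => g' y w z) hV hy d1 d2 (fun y hy => hg y hy w z)
    simp only [zero_smul, add_zero, map_zero, h'.compat y hy] at this
    have e := h'.symm y hy w (Γ' y v z)
    have e' := h.symm (Ψ y) (hm hy) (fderiv ℝ Ψ y w) (nablaMap Γ Ψ y v z)
    simp only [T]
    linear_combination -this + e - c * e'
  have h0 : T v w z = 0 := by
    have h1 := hskew v w z
    have h2 := hsymm v z w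
    have h3 := hskew z v w
    have h4 := hsymm z w v
    have h5 := hskew w z v
    have h6 := hsymm w v z
    linarith
  simp only [T, hg y hy, ← mul_sub] at h0
  exact sub_eq_zero.1 ((mul_eq_zero.1 h0).resolve_left hc)

omit hV in
/-- The connection of a local isometry. -/
theorem nablaMap_of_isometry (h' : IsLeviCivita V g' Γ')
    (hg : ∀ y ∈ V, ∀ v w, g' y v w = g (Ψ y) (fderiv ℝ Ψ y v) (fderiv ℝ Ψ y w))
    {y : F} (hy : y ∈ V) (hs : Function.Surjective (fderiv ℝ Ψ y)) (v w : F) :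
    nablaMap Γ Ψ y v w = fderiv ℝ Ψ y (Γ' y v w) := by
  refine h.eq_of_inner (hm hy) fun X => ?_
  obtain ⟨z, rfl⟩ := hs X
  exact inner_nablaMap hΨ h hm h' one_ne_zero (fun y hy v w => by rw [one_mul, hg y hy]) hy v w z

end

/-! ### The leaves orthogonal to a concircular field -/

section Leaf

variable {U : E → E} {H a b : E → ℝ}
  (h : IsLeviCivita Ω g Γ) (c : IsConcircular Ω g Γ U H a b) (h' : IsLeviCivita V g' Γ')
  (hΨ : ContDiffOn ℝ ∞ Ψ V) (hm : Set.MapsTo Ψ V Ω)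
  (hU : ∀ y ∈ V, ∀ v, g (Ψ y) (U (Ψ y)) (fderiv ℝ Ψ y v) = 0)
  (hs : ∀ y ∈ V, ∀ X, g (Ψ y) (U (Ψ y)) X = 0 → ∃ v, fderiv ℝ Ψ y v = X)
  {k : ℝ} (hk : 0 < k)
  (hg : ∀ y ∈ V, ∀ v w, g' y v w = k * g (Ψ y) (fderiv ℝ Ψ y v) (fderiv ℝ Ψ y w))
include h c h' hΨ hm hU hs hk hg

/-- The Gauss formula: the leaves are umbilical with mean curvature `-H`. -/
theorem nablaMap_of_leaf {y : F} (hy : y ∈ V) (v w : F) :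
    nablaMap Γ Ψ y v w = fderiv ℝ Ψ y (Γ' y v w)
      - (H (Ψ y) * g (Ψ y) (fderiv ℝ Ψ y v) (fderiv ℝ Ψ y w)) • U (Ψ y) := by
  have hn : g (Ψ y) (nablaMap Γ Ψ y v w) (U (Ψ y))
      = -(H (Ψ y) * g (Ψ y) (fderiv ℝ Ψ y v) (fderiv ℝ Ψ y w)) := by
    have dU := hasDerivAt_comp_along h'.isOpen hΨ hy (c.fieldAt h (hm hy)) v
    have dw := (hasDerivAt_along (differentiableAt_fderiv_of_smoothOn h'.isOpen hΨ hy) v).clm_apply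
      (hasDerivAt_const 0 w)
    have d := hasDerivAt_inner_along h'.isOpen hΨ h hm hy v (Y := fun y => U (Ψ y))
      (Z := fun y => fderiv ℝ Ψ y w) dU dw
    have := deriv_along_unique (f' := fun _ => (0 : ℝ)) h'.isOpen hy d (hasDerivAt_const _ _)
      (fun y hy => hU y hy w)
    have e := c.nabla (Ψ y) (hm hy) (fderiv ℝ Ψ y v)
    rw [nablaVec, hU y hy, zero_smul, sub_zero] at e
    simp only [zero_smul, add_zero, map_zero, e, map_smul, smul_apply, smul_eq_mul] at this
    rw [h.symm _ (hm hy), nablaMap]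
    linear_combination this
  have hu := c.unit (Ψ y) (hm hy)
  refine h.eq_of_inner (hm hy) fun X => ?_
  obtain ⟨z, hz⟩ := hs y hy (X - g (Ψ y) (U (Ψ y)) X • U (Ψ y)) (by
    rw [map_sub, map_smul, hu]; simp)
  have ht := inner_nablaMap hΨ h hm h' hk.ne' hg hy v w z
  have hz0 := hU y hy z
  have hq := hU y hy (Γ' y v w)
  have hX : X = fderiv ℝ Ψ y z + g (Ψ y) (U (Ψ y)) X • U (Ψ y) := by rw [hz]; abel
  rw [h.symm _ (hm hy)] at hq
  rw [hX]
  simp only [map_add, map_sub, map_smul, sub_apply, smul_apply, smul_eq_mul, hn, ht, hz0, hq, hu]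
  ring

/-- The Gauss equation: the leaves have constant curvature. -/
theorem curv_of_leaf {y : F} (hy : y ∈ V) (hH : ∀ v, fderiv ℝ H (Ψ y) (fderiv ℝ Ψ y v) = 0)
    (v z w : F) : curv Γ' y v z w = -(((2 * a (Ψ y) + H (Ψ y) ^ 2) / k) •
      (g' y z w • v - g' y v w • z)) := by
  have hV := h'.isOpen
  have hS := fun {y} hy => nablaMap_of_leaf h c h' hΨ hm hU hs hk hg (y := y) hy
  -- the derivative along `z` of the Gauss formula
  have key : ∀ v z w, fderiv ℝ (fderiv ℝ (fderiv ℝ Ψ)) y z v w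
      + (fderiv ℝ Γ (Ψ y) (fderiv ℝ Ψ y z) (fderiv ℝ Ψ y v) (fderiv ℝ Ψ y w)
        + Γ (Ψ y) (fderiv ℝ (fderiv ℝ Ψ) y z v) (fderiv ℝ Ψ y w)
        + Γ (Ψ y) (fderiv ℝ Ψ y v) (fderiv ℝ (fderiv ℝ Ψ) y z w))
      = fderiv ℝ (fderiv ℝ Ψ) y z (Γ' y v w) + fderiv ℝ Ψ y (fderiv ℝ Γ' y z v w)
        - ((H (Ψ y) * g (Ψ y) (fderiv ℝ Ψ y v) (fderiv ℝ Ψ y w)) •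
            (fderiv ℝ U (Ψ y) (fderiv ℝ Ψ y z))
          + (H (Ψ y) * (g (Ψ y) (nablaMap Γ Ψ y z v) (fderiv ℝ Ψ y w)
            + g (Ψ y) (fderiv ℝ Ψ y v) (nablaMap Γ Ψ y z w))) • U (Ψ y)) := by
    intro v z w
    have dJ := hasDerivAt_along (differentiableAt_fderiv_of_smoothOn hV hΨ hy) z
    have dDJ := hasDerivAt_along (differentiableAt_fderiv_of_smoothOn hV
      (hΨ.fderiv_of_isOpen hV (m := ∞) (by simp)) hy) z
    have dG := hasDerivAt_comp_along hV hΨ hy (h.connAt (hm hy)) z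
    have dG' := hasDerivAt_along (h'.connAt hy) z
    have dU := hasDerivAt_comp_along hV hΨ hy (c.fieldAt h (hm hy)) z
    have dH := hasDerivAt_comp_along hV hΨ hy (c.HAt h (hm hy)) z
    have dg := hasDerivAt_inner_fderiv hV hΨ h hm hy z v w
    have cc := fun v : F => hasDerivAt_const (0 : ℝ) v
    rw [hH z] at dH
    have d1 := ((dDJ.clm_apply (cc v)).clm_apply (cc w)).add
      ((dG.clm_apply (dJ.clm_apply (cc v))).clm_apply (dJ.clm_apply (cc w)))
    have d2 := (dJ.clm_apply ((dG'.clm_apply (cc v)).clm_apply (cc w))).sub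
      ((dH.mul dg).smul dU)
    have := deriv_along_unique (f := fun y => nablaMap Γ Ψ y v w) hV hy d1 d2
      (fun y hy => hS hy v w)
    simpa [add_assoc] using this
  have k1 := key v z w
  have k2 := key z v w
  have hT : fderiv ℝ (fderiv ℝ (fderiv ℝ Ψ)) y z v w = fderiv ℝ (fderiv ℝ (fderiv ℝ Ψ)) y v z w :=
    congrArg (fun f : F →L[ℝ] E => f w)
      (fderiv_fderiv_symm hV (hΨ.fderiv_of_isOpen hV (m := ∞) (by simp)) hy z v)
  have s1 := hS hy z (Γ' y v w)
  have s2 := hS hy v (Γ' y z w)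
  have s3 := hS hy z w
  have s4 := hS hy v w
  have hc := c.curv_eq h (hm hy) (fderiv ℝ Ψ y v) (fderiv ℝ Ψ y z) (fderiv ℝ Ψ y w)
  have hJ : ∀ X Y, fderiv ℝ Ψ y X = fderiv ℝ Ψ y Y → X = Y := fun X Y hXY =>
    h'.eq_of_inner hy fun W => by rw [hg y hy, hg y hy, hXY]
  have hsy := nablaMap_symm hV hΨ h hm hy v z
  have u1 := c.nabla (Ψ y) (hm hy) (fderiv ℝ Ψ y z)
  have u2 := c.nabla (Ψ y) (hm hy) (fderiv ℝ Ψ y v)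
  have o := hU y hy
  have gs := h.symm (Ψ y) (hm hy)
  have hfin : fderiv ℝ Ψ y (curv Γ' y v z w) = -((2 * a (Ψ y) + H (Ψ y) ^ 2) •
      (g (Ψ y) (fderiv ℝ Ψ y z) (fderiv ℝ Ψ y w) • fderiv ℝ Ψ y v
        - g (Ψ y) (fderiv ℝ Ψ y v) (fderiv ℝ Ψ y w) • fderiv ℝ Ψ y z)) := by
    simp only [o, zero_smul, sub_zero, mul_zero, add_zero, smul_zero] at hc
    rw [s3] at k1
    rw [s4, hsy] at k2
    simp only [nablaVec, o, zero_smul, sub_zero] at u1 u2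
    simp only [nablaMap] at s1 s2 s3 s4
    have e3 := congrArg (Γ (Ψ y) (fderiv ℝ Ψ y v)) s3
    have e4 := congrArg (Γ (Ψ y) (fderiv ℝ Ψ y z)) s4
    rw [← eq_sub_iff_add_eq] at u1 u2
    rw [u1, hT] at k1
    rw [u2, fderiv_fderiv_symm hV hΨ hy v z] at k2
    simp only [map_add, map_sub, map_smul, smul_eq_mul,
      gs (fderiv ℝ Ψ y _) (U (Ψ y)), o] at k1 k2 e3 e4
    simp only [curv] at hc ⊢
    simp only [map_add, map_sub]
    linear_combination (norm := module) hc - k1 + k2 - s1 + s2 + e3 - e4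
  apply hJ
  rw [hfin, hg y hy, hg y hy]
  simp only [map_neg, map_smul, map_sub]
  match_scalars <;> field_simp

end Leaf
end Immersion

/-! ### Linear second order equations and planes -/

section Plane

variable {E : Type*} [NormedAddCommGroup E] [InnerProductSpace ℝ E] [FiniteDimensional ℝ E]

theorem exists_finrank_eq_two (hE : 2 ≤ Module.finrank ℝ E) (u v : E) :
    ∃ P : Submodule ℝ E, Module.finrank ℝ P = 2 ∧ u ∈ P ∧ v ∈ P := by
  have step : ∀ k : ℕ, ∀ S : Submodule ℝ E, Module.finrank ℝ S + k = 2 →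
      ∃ P : Submodule ℝ E, Module.finrank ℝ P = 2 ∧ S ≤ P := by
    intro k
    induction k with
    | zero => exact fun S hS => ⟨S, hS, le_rfl⟩
    | succ k ih =>
      intro S hS
      obtain ⟨x, hx⟩ : ∃ x, x ∉ S := by
        by_contra! hc
        rw [(Submodule.eq_top_iff'.2 hc), finrank_top] at hS
        omega
      have hx0 : x ≠ 0 := fun h => hx (h ▸ S.zero_mem)
      have hd := Submodule.finrank_sup_add_finrank_inf_eq S (ℝ ∙ x)
      rw [((Submodule.disjoint_span_singleton' hx0).2 hx).eq_bot, finrank_bot,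
        finrank_span_singleton hx0] at hd
      obtain ⟨P, hP, hle⟩ := ih (S ⊔ ℝ ∙ x) (by omega)
      exact ⟨P, hP, le_sup_left.trans hle⟩
  have h2 : Module.finrank ℝ (Submodule.span ℝ (Set.range ![u, v])) ≤ 2 :=
    (finrank_range_le_card (R := ℝ) ![u, v]).trans_eq (Fintype.card_fin 2)
  obtain ⟨P, hP, hle⟩ := step (2 - Module.finrank ℝ (Submodule.span ℝ (Set.range ![u, v]))) _
    (Nat.add_sub_of_le h2)
  exact ⟨P, hP, hle (Submodule.subset_span ⟨0, rfl⟩), hle (Submodule.subset_span ⟨1, rfl⟩)⟩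

/-- A solution of a second order linear equation with scalar coefficients stays in the plane spanned
by its initial position and velocity. -/
theorem exists_plane_of_linear_ode (hE : 2 ≤ Module.finrank ℝ E) {W W' : ℝ → E} {α β : ℝ → ℝ}
    {J : Set ℝ} (hJ : IsPreconnected J) (hα : ContinuousOn α J) (hβ : ContinuousOn β J)
    (hW : ∀ t ∈ J, HasDerivAt W (W' t) t)
    (hW' : ∀ t ∈ J, HasDerivAt W' (α t • W' t + β t • W t) t) :
    ∃ P : Submodule ℝ E, Module.finrank ℝ P = 2 ∧ ∀ t ∈ J, W t ∈ P := by
  rcases J.eq_empty_or_nonempty with rfl | ⟨t₀, ht₀⟩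
  · obtain ⟨P, hP, -, -⟩ := exists_finrank_eq_two hE (0 : E) 0
    exact ⟨P, hP, by simp⟩
  obtain ⟨P, hP, h1, h2⟩ := exists_finrank_eq_two hE (W t₀) (W' t₀)
  refine ⟨P, hP, fun t ht => ?_⟩
  -- the component of the solution orthogonal to the plane solves the same equation
  let p : E →L[ℝ] E := ContinuousLinearMap.id ℝ E - P.starProjection
  have hp : ∀ x, p x = 0 ↔ x ∈ P := fun x => by
    rw [← Submodule.starProjection_eq_self_iff, eq_comm (b := x)]
    exact sub_eq_zero
  let L : ℝ → E × E →L[ℝ] E × E := fun t =>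
    (ContinuousLinearMap.inl ℝ E E).comp (ContinuousLinearMap.snd ℝ E E)
    + α t • (ContinuousLinearMap.inr ℝ E E).comp (ContinuousLinearMap.snd ℝ E E)
    + β t • (ContinuousLinearMap.inr ℝ E E).comp (ContinuousLinearMap.fst ℝ E E)
  have hL : ContinuousOn L J :=
    (continuousOn_const.add (hα.smul continuousOn_const)).add (hβ.smul continuousOn_const)
  have h0 := eq_zero_of_linear_ode (f := fun t => (p (W t), p (W' t))) hJ hL (fun t ht => by
    have d1 := p.hasFDerivAt.comp_hasDerivAt t (hW t ht)
    have d2 := p.hasFDerivAt.comp_hasDerivAt t (hW' t ht)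
    refine (d1.prodMk d2).congr_deriv ?_
    simp [L]) ht₀ (by simp [(hp _).2 h1, (hp _).2 h2]) ht
  exact (hp _).1 (congrArg Prod.fst h0)

end Plane

/-! ### Coordinates from fibre functions -/

section Coordinates

/-- The inverse function theorem, with an inverse that is smooth on its whole domain. -/
theorem exists_openPartialHomeomorph {E : Type*} [NormedAddCommGroup E] [NormedSpace ℝ E]
    [FiniteDimensional ℝ E] {F : E → E} {Ω : Set E} (hΩ : IsOpen Ω) (hF : ContDiffOn ℝ ∞ F Ω)
    {x₀ : E} (hx₀ : x₀ ∈ Ω) (hinj : ∀ X, fderiv ℝ F x₀ X = 0 → X = 0) :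
    ∃ Φ : OpenPartialHomeomorph E E, x₀ ∈ Φ.source ∧ Φ.source ⊆ Ω ∧ (∀ x, Φ x = F x) ∧
      ContDiffOn ℝ ∞ Φ.symm Φ.target := by
  have : CompleteSpace E := FiniteDimensional.complete ℝ E
  have hd : ∀ x ∈ Ω, HasFDerivAt F (fderiv ℝ F x) x := fun x hx =>
    (differentiableAt_of_smoothOn hΩ hF hx).hasFDerivAt
  have hequiv : fderiv ℝ F x₀ ∈ Set.range ((↑) : (E ≃L[ℝ] E) → E →L[ℝ] E) := by
    have hi : Function.Injective (fderiv ℝ F x₀ : E →ₗ[ℝ] E) :=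
      (injective_iff_map_eq_zero _).2 hinj
    exact ⟨(LinearEquiv.ofInjectiveEndo _ hi).toContinuousLinearEquiv, by ext X; rfl⟩
  let S : Set E := Ω ∩ fderiv ℝ F ⁻¹' Set.range ((↑) : (E ≃L[ℝ] E) → E →L[ℝ] E)
  have hS : IsOpen S := (hF.continuousOn_fderiv_of_isOpen hΩ (by simp)).isOpen_inter_preimage hΩ
    ContinuousLinearEquiv.isOpen
  obtain ⟨e, he⟩ := hequiv
  have hc : ContDiffAt ℝ ∞ F x₀ := hF.contDiffAt (hΩ.mem_nhds hx₀)
  have hde : HasFDerivAt F (e : E →L[ℝ] E) x₀ := he ▸ hd x₀ hx₀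
  let Φ := (hc.toOpenPartialHomeomorph F hde (by simp)).restrOpen S hS
  have hΦ : ∀ x, Φ x = F x := fun x => rfl
  have hsS : Φ.source ⊆ S := Set.inter_subset_right
  refine ⟨Φ, ⟨hc.mem_toOpenPartialHomeomorph_source hde (by simp), hx₀, e, he⟩,
    hsS.trans Set.inter_subset_left, hΦ, fun y hy => ?_⟩
  obtain ⟨hxΩ, e', he'⟩ := hsS (Φ.map_target hy)
  exact (Φ.contDiffAt_symm (f₀' := e') hy (he' ▸ hd _ hxΩ)
    (hF.contDiffAt (hΩ.mem_nhds hxΩ))).contDiffWithinAt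

theorem fderiv_euclidean_apply {E : Type*} [NormedAddCommGroup E] [NormedSpace ℝ E] {n : ℕ}
    {F : E → EuclideanSpace ℝ (Fin n)} {x : E} (hF : DifferentiableAt ℝ F x) (X : E) (i : Fin n) :
    fderiv ℝ F x X i = fderiv ℝ (fun x => F x i) x X := by
  have := ((EuclideanSpace.proj i : EuclideanSpace ℝ (Fin n) →L[ℝ] ℝ).hasFDerivAt.comp x
    hF.hasFDerivAt).fderiv
  rw [show (fun x => F x i) = (EuclideanSpace.proj i : EuclideanSpace ℝ (Fin n) →L[ℝ] ℝ) ∘ F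
    from rfl, this]
  rfl

theorem IsConcircular.IsFibreFunction.mono {E : Type*} [NormedAddCommGroup E] [NormedSpace ℝ E]
    {g : E → E →L[ℝ] E →L[ℝ] ℝ} {Γ : E → E →L[ℝ] E →L[ℝ] E} {U : E → E} {H a w : E → ℝ}
    {T : E → E} {B B' : Set E} (hw : IsFibreFunction B g Γ U H a w T) (hB : B' ⊆ B) :
    IsFibreFunction B' g Γ U H a w T :=
  ⟨hw.smooth.mono hB, hw.smooth_grad.mono hB, fun x hx => hw.orthogonal x (hB hx),
    fun x hx => hw.fderiv_eq x (hB hx), fun x hx => hw.hessian x (hB hx)⟩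

variable {m : ℕ} {Ω : Set (EuclideanSpace ℝ (Fin (m + 1)))}
  {g : EuclideanSpace ℝ (Fin (m + 1)) →
    EuclideanSpace ℝ (Fin (m + 1)) →L[ℝ] EuclideanSpace ℝ (Fin (m + 1)) →L[ℝ] ℝ}
  {Γ : EuclideanSpace ℝ (Fin (m + 1)) → EuclideanSpace ℝ (Fin (m + 1)) →L[ℝ]
    EuclideanSpace ℝ (Fin (m + 1)) →L[ℝ] EuclideanSpace ℝ (Fin (m + 1))}
  {U : EuclideanSpace ℝ (Fin (m + 1)) → EuclideanSpace ℝ (Fin (m + 1))}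
  {H a b : EuclideanSpace ℝ (Fin (m + 1)) → ℝ}

variable (h : IsLeviCivita Ω g Γ) (c : IsConcircular Ω g Γ U H a b) (hm : 3 < m + 1)
include h c

theorem exists_basis_orthogonal {x₀ : EuclideanSpace ℝ (Fin (m + 1))} (hx₀ : x₀ ∈ Ω) :
    ∃ T : Fin m → EuclideanSpace ℝ (Fin (m + 1)), (∀ α, g x₀ (U x₀) (T α) = 0) ∧
      ∀ X, g x₀ (U x₀) X = 0 → (∀ α, g x₀ (T α) X = 0) → X = 0 := by
  let f : EuclideanSpace ℝ (Fin (m + 1)) →ₗ[ℝ] ℝ := (g x₀ (U x₀)).toLinearMap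
  have hr : LinearMap.range f = ⊤ := by
    rw [LinearMap.range_eq_top]
    intro s
    refine ⟨s • U x₀, ?_⟩
    simp [f, c.unit x₀ hx₀]
  have hk : Module.finrank ℝ (LinearMap.ker f) = m := by
    have := f.finrank_range_add_finrank_ker
    rw [hr, finrank_top, Module.finrank_self, finrank_euclideanSpace_fin] at this
    omega
  let e := Module.finBasisOfFinrankEq ℝ (LinearMap.ker f) hk
  refine ⟨fun α => e α, fun α => (e α).2, fun X hX hT => ?_⟩
  have h0 : ((g x₀).flip X).toLinearMap ∘ₗ (LinearMap.ker f).subtype = 0 :=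
    e.ext fun α => by simpa using hT α
  have h1 : g x₀ X X = 0 := by simpa using LinearMap.congr_fun h0 ⟨X, hX⟩
  by_contra hne
  exact (h.pos x₀ hx₀ X hne).ne' h1

include hm

/-- A potential of `U` together with fibre functions which separate the directions orthogonal
to `U`. -/
theorem exists_fibre_functions {x₀ : EuclideanSpace ℝ (Fin (m + 1))} (hx₀ : x₀ ∈ Ω) :
    ∃ r > 0, Metric.ball x₀ r ⊆ Ω ∧ ∃ (ρ : EuclideanSpace ℝ (Fin (m + 1)) → ℝ)
      (w : Fin (m + 1) → EuclideanSpace ℝ (Fin (m + 1)) → ℝ)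
      (T : Fin (m + 1) → EuclideanSpace ℝ (Fin (m + 1)) → EuclideanSpace ℝ (Fin (m + 1))),
      ContDiffOn ℝ ∞ ρ (Metric.ball x₀ r) ∧
      (∀ x ∈ Metric.ball x₀ r, ∀ X, fderiv ℝ ρ x X = g x (U x) X) ∧
      (∀ i, IsConcircular.IsFibreFunction (Metric.ball x₀ r) g Γ U H a (w i) (T i)) ∧
      w 0 x₀ = 1 ∧ T 0 x₀ = 0 ∧ (∀ α : Fin m, w α.succ x₀ = 0) ∧
      ∀ X, g x₀ (U x₀) X = 0 → (∀ α : Fin m, g x₀ (T α.succ x₀) X = 0) → X = 0 := by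
  have hE : 4 ≤ Module.finrank ℝ (EuclideanSpace ℝ (Fin (m + 1))) := by
    rw [finrank_euclideanSpace_fin]; exact hm
  obtain ⟨r₁, hr₁, hr₁Ω, ρ, hρ, hρd⟩ := c.exists_potential h hx₀
  obtain ⟨r₂, hr₂, hr₂Ω, hsol⟩ := c.exists_isFibreFunction h hE hx₀
  obtain ⟨T₀, hT₀, hT₀X⟩ := exists_basis_orthogonal h c hx₀
  obtain ⟨w0, T0, hw0, hT0, hf0⟩ := hsol 1 0 (by simp)
  choose w T hw hT hf using fun α => hsol 0 (T₀ α) (hT₀ α)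
  have h1 : Metric.ball x₀ (min r₁ r₂) ⊆ Metric.ball x₀ r₁ :=
    Metric.ball_subset_ball (min_le_left _ _)
  have h2 : Metric.ball x₀ (min r₁ r₂) ⊆ Metric.ball x₀ r₂ :=
    Metric.ball_subset_ball (min_le_right _ _)
  refine ⟨min r₁ r₂, lt_min hr₁ hr₂, h1.trans hr₁Ω, ρ, Fin.cons w0 w, Fin.cons T0 T, hρ.mono h1,
    fun x hx => hρd x (h1 hx), fun i => ?_, hw0, hT0, hw, fun X hX hXT => hT₀X X hX fun α => ?_⟩
  · refine Fin.cases (hf0.mono h2) (fun α => ?_) i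
    exact (hf α).mono h2
  · rw [← hT α]; exact hXT α

/-- Coordinates in which all geodesics lie in planes through the origin: the fibre functions,
multiplied with the exponential of the potential. -/
theorem exists_subprojective_coordinates {x₀ : EuclideanSpace ℝ (Fin (m + 1))} (hx₀ : x₀ ∈ Ω) :
    ∃ Φ : OpenPartialHomeomorph (EuclideanSpace ℝ (Fin (m + 1))) (EuclideanSpace ℝ (Fin (m + 1))),
      x₀ ∈ Φ.source ∧ Φ.source ⊆ Ω ∧ ContDiffOn ℝ ∞ Φ Φ.source ∧ ContDiffOn ℝ ∞ Φ.symm Φ.target ∧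
      ∀ (J : Set ℝ) (C C' : ℝ → EuclideanSpace ℝ (Fin (m + 1))), IsPreconnected J →
        (∀ t ∈ J, C t ∈ Φ.source) → (∀ t ∈ J, HasDerivAt C (C' t) t) →
        (∀ t ∈ J, HasDerivAt C' (-(Γ (C t) (C' t) (C' t))) t) →
        ∃ P : Submodule ℝ (EuclideanSpace ℝ (Fin (m + 1))), Module.finrank ℝ P = 2 ∧
          ∀ t ∈ J, Φ (C t) ∈ P := by
  obtain ⟨r, hr, hrΩ, ρ, w, T, hρ, hρd, hw, h00, hT0, hw0, hsep⟩ := exists_fibre_functions h c hm hx₀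
  have hB : IsOpen (Metric.ball x₀ r) := Metric.isOpen_ball
  have hx : x₀ ∈ Metric.ball x₀ r := Metric.mem_ball_self hr
  let F : EuclideanSpace ℝ (Fin (m + 1)) → EuclideanSpace ℝ (Fin (m + 1)) :=
    fun x => WithLp.toLp 2 fun i => Real.exp (ρ x) * w i x
  have hF : ContDiffOn ℝ ∞ F (Metric.ball x₀ r) :=
    contDiffOn_euclidean.2 fun i => hρ.exp.mul (hw i).smooth
  have hFd : ∀ X i, fderiv ℝ F x₀ X i
      = Real.exp (ρ x₀) * (g x₀ (T i x₀) X + g x₀ (U x₀) X * w i x₀) := by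
    intro X i
    rw [fderiv_euclidean_apply (differentiableAt_of_smoothOn hB hF hx)]
    have d := (differentiableAt_of_smoothOn hB hρ hx).hasFDerivAt.exp.mul
      (differentiableAt_of_smoothOn hB (hw i).smooth hx).hasFDerivAt
    have e : fderiv ℝ (fun x => F x i) x₀ = _ := d.fderiv
    rw [e]
    simp only [add_apply, smul_apply, smul_eq_mul, hρd x₀ hx, (hw i).fderiv_eq x₀ hx]
    ring
  obtain ⟨Φ, hxΦ, hΦB, hΦ, hΦs⟩ := exists_openPartialHomeomorph hB hF hx (fun X hX => by
    have hz : ∀ i, g x₀ (T i x₀) X + g x₀ (U x₀) X * w i x₀ = 0 := fun i =>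
      (mul_eq_zero.1 ((hFd X i).symm.trans (by rw [hX]; rfl))).resolve_left (Real.exp_ne_zero _)
    have hU : g x₀ (U x₀) X = 0 := by simpa [h00, hT0] using hz 0
    exact hsep X hU fun α => by simpa [hU] using hz α.succ)
  refine ⟨Φ, hxΦ, hΦB.trans hrΩ, (hF.mono hΦB).congr fun x _ => hΦ x, hΦs,
    fun J C C' hJ hCs hC hC' => ?_⟩
  have hE : 2 ≤ Module.finrank ℝ (EuclideanSpace ℝ (Fin (m + 1))) := by
    rw [finrank_euclideanSpace_fin]; omega
  have hCB : ∀ t ∈ J, C t ∈ Metric.ball x₀ r := fun t ht => hΦB (hCs t ht)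
  have hCΩ : Set.MapsTo C J Ω := fun t ht => hrΩ (hCB t ht)
  have cC : ContinuousOn C J := fun t ht => (hC t ht).continuousAt.continuousWithinAt
  have cC' : ContinuousOn C' J := fun t ht => (hC' t ht).continuousAt.continuousWithinAt
  have cg : ContinuousOn (fun t => g (C t)) J := h.smooth_metric.continuousOn.comp cC hCΩ
  have cu : ContinuousOn (fun t => g (C t) (U (C t)) (C' t)) J :=
    (cg.clm_apply (c.smooth_field.continuousOn.comp cC hCΩ)).clm_apply cC'
  have cH : ContinuousOn (fun t => H (C t)) J := c.smooth_H.continuousOn.comp cC hCΩ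
  have ca : ContinuousOn (fun t => a (C t)) J := c.smooth_a.continuousOn.comp cC hCΩ
  have htoLp : ∀ {f : ℝ → Fin (m + 1) → ℝ} {f' : Fin (m + 1) → ℝ} {t : ℝ},
      (∀ i, HasDerivAt (fun t => f t i) (f' i) t) →
      HasDerivAt (fun t => WithLp.toLp 2 (f t)) (WithLp.toLp 2 f') t := fun hf =>
    (PiLp.continuousLinearEquiv 2 ℝ
      (fun _ : Fin (m + 1) => ℝ)).symm.toContinuousLinearMap.hasFDerivAt.comp_hasDerivAt _
      (hasDerivAt_pi.2 hf)
  obtain ⟨P, hP, hPW⟩ := exists_plane_of_linear_ode hE (W := fun t => WithLp.toLp 2 fun i => w i (C t))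
    (W' := fun t => WithLp.toLp 2 fun i => g (C t) (T i (C t)) (C' t))
    (α := fun t => -2 * H (C t) * g (C t) (U (C t)) (C' t))
    (β := fun t => -((2 * a (C t) + H (C t) ^ 2)
      * (g (C t) (C' t) (C' t) - g (C t) (U (C t)) (C' t) ^ 2))) hJ
    ((continuousOn_const.mul cH).mul cu)
    ((((continuousOn_const.mul ca).add (cH.pow 2)).mul
      (((cg.clm_apply cC').clm_apply cC').sub (cu.pow 2))).neg)
    (fun t ht => htoLp fun i => by
      have d := (differentiableAt_of_smoothOn hB (hw i).smooth
        (hCB t ht)).hasFDerivAt.comp_hasDerivAt t (hC t ht)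
      rwa [(hw i).fderiv_eq _ (hCB t ht)] at d)
    (fun t ht => by
      have dg := (h.metricAt (hCΩ ht)).hasFDerivAt.comp_hasDerivAt t (hC t ht)
      have : ∀ i, HasDerivAt (fun t => g (C t) (T i (C t)) (C' t))
          (-2 * H (C t) * g (C t) (U (C t)) (C' t) * g (C t) (T i (C t)) (C' t)
          + -((2 * a (C t) + H (C t) ^ 2) * (g (C t) (C' t) (C' t)
            - g (C t) (U (C t)) (C' t) ^ 2)) * w i (C t)) t := by
        intro i
        have dT := (differentiableAt_of_smoothOn hB (hw i).smooth_grad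
          (hCB t ht)).hasFDerivAt.comp_hasDerivAt t (hC t ht)
        refine ((dg.clm_apply dT).clm_apply (hC' t ht)).congr_deriv ?_
        have hh := (hw i).hessian _ (hCB t ht) (C' t)
        rw [nablaVec, ← eq_sub_iff_add_eq] at hh
        simp only [Function.comp_apply, add_apply, h.compat _ (hCΩ ht), hh, map_neg, map_sub,
          map_smul, map_add, sub_apply, smul_apply, smul_eq_mul]
        ring
      refine (htoLp this).congr_deriv ?_
      ext i
      simp)
  refine ⟨P, hP, fun t ht => ?_⟩
  have : Φ (C t) = Real.exp (ρ (C t)) • WithLp.toLp 2 fun i => w i (C t) := by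
    rw [hΦ]; ext i; simp [F]
  rw [this]
  exact P.smul_mem _ (hPW t ht)

end Coordinates

/-! ### The warped product structure -/

section Box

variable {m : ℕ}

/-- The inclusion of `ℝᵐ` into `ℝᵐ⁺¹` as the last `m` coordinates. -/
def fiberInc : EuclideanSpace ℝ (Fin m) →L[ℝ] EuclideanSpace ℝ (Fin (m + 1)) :=
  ∑ α : Fin m, (EuclideanSpace.proj α : EuclideanSpace ℝ (Fin m) →L[ℝ] ℝ).smulRight
    (EuclideanSpace.single α.succ (1 : ℝ))

theorem fiberInc_succ (z : EuclideanSpace ℝ (Fin m)) (α : Fin m) : fiberInc z α.succ = z α := by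
  simp only [fiberInc, FunLike.coe_sum, Finset.sum_apply, WithLp.ofLp_sum,
    ContinuousLinearMap.smulRight_apply, PiLp.smul_apply, EuclideanSpace.coe_proj, smul_eq_mul,
    PiLp.single_apply]
  rw [Finset.sum_eq_single α (fun b _ hb => by simp [Ne.symm hb]) (by simp)]
  simp

theorem fiberInc_zero (z : EuclideanSpace ℝ (Fin m)) : fiberInc z 0 = 0 := by
  simp [fiberInc, Fin.succ_ne_zero, eq_comm]

theorem fiberInc_single (α : Fin m) :
    fiberInc (EuclideanSpace.single α 1) = EuclideanSpace.single α.succ (1 : ℝ) := by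
  ext i
  refine Fin.cases ?_ (fun β => ?_) i
  · rw [fiberInc_zero]; simp [eq_comm]
  · rw [fiberInc_succ]; simp [PiLp.single_apply]

/-- The point of `ℝᵐ⁺¹` with first coordinate `t` and remaining coordinates `z`. -/
def boxPoint (t : ℝ) (z : EuclideanSpace ℝ (Fin m)) : EuclideanSpace ℝ (Fin (m + 1)) :=
  t • EuclideanSpace.single 0 (1 : ℝ) + fiberInc z

theorem boxPoint_zero (t : ℝ) (z : EuclideanSpace ℝ (Fin m)) : boxPoint t z 0 = t := by
  simp [boxPoint, fiberInc_zero]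

theorem fiberCoord_boxPoint (t : ℝ) (z : EuclideanSpace ℝ (Fin m)) :
    fiberCoord (boxPoint t z) = z := by
  ext α
  simp [fiberCoord, boxPoint, fiberInc_succ]

theorem boxPoint_fiberCoord (y : EuclideanSpace ℝ (Fin (m + 1))) :
    boxPoint (y 0) (fiberCoord y) = y := by
  ext i
  refine Fin.cases (boxPoint_zero _ _) (fun α => ?_) i
  simp [fiberCoord, boxPoint, fiberInc_succ]

theorem eq_fiberInc {v : EuclideanSpace ℝ (Fin (m + 1))} (hv : v 0 = 0) :
    v = fiberInc (fiberCoord v) := by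
  conv_lhs => rw [← boxPoint_fiberCoord v, boxPoint, hv, zero_smul, zero_add]

theorem continuous_fiberCoord : Continuous (fiberCoord (m := m)) := by
  unfold fiberCoord
  exact (PiLp.continuous_toLp 2 _).comp (by fun_prop)

/-- A function on an open convex set is constant if its derivative vanishes. -/
theorem eq_of_fderiv_eq_zero {E : Type*} [NormedAddCommGroup E] [NormedSpace ℝ E] {f : E → ℝ}
    {s : Set E} (hs : Convex ℝ s) (ho : IsOpen s) (hf : DifferentiableOn ℝ f s)
    (h : ∀ x ∈ s, ∀ v, fderiv ℝ f x v = 0) {x y : E} (hx : x ∈ s) (hy : y ∈ s) : f x = f y :=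
  hs.is_const_of_fderivWithin_eq_zero hf (fun z hz => by
    rw [fderivWithin_of_isOpen ho hz]; ext v; exact h z hz v) hx hy

/-- The Ricci tensor of a metric of constant curvature. -/
theorem ricci_of_curv_eq {n : ℕ} {V : Set (EuclideanSpace ℝ (Fin n))} (hV : IsOpen V)
    {G : EuclideanSpace ℝ (Fin n) → Matrix (Fin n) (Fin n) ℝ} (hG : IsMetricOn V G) {k : ℝ}
    {y : EuclideanSpace ℝ (Fin n)} (hy : y ∈ V)
    (hc : ∀ X Y Z, curv (connOf G) y X Y Z
      = -(k • (formOf (G y) Y Z • X - formOf (G y) X Z • Y))) :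
    ricci G y = (k * ((n : ℝ) - 1)) • G y := by
  ext p l
  have : ∀ q, riemann G q p l q y
      = -(k * (G y p l - G y q l * (1 : Matrix (Fin n) (Fin n) ℝ) q p)) := by
    intro q
    rw [← hG.curv_single hV hy, hc]
    simp [formOf_single, PiLp.single_apply, Matrix.one_apply]
  simp only [ricci, this, Matrix.smul_apply, smul_eq_mul, Finset.sum_neg_distrib, neg_neg,
    ← Finset.mul_sum, Finset.sum_sub_distrib]
  simp [Matrix.one_apply]
  ring

/-- Coordinates in which the first coordinate vector field is concircular exhibit a warped product
with Einstein fibre: the leaves are homothetic to each other along the flow, and they have constant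
curvature by the Gauss equation. -/
theorem IsConcircular.exists_warped {Ω : Set (EuclideanSpace ℝ (Fin (m + 1)))}
    {g : EuclideanSpace ℝ (Fin (m + 1)) →
      EuclideanSpace ℝ (Fin (m + 1)) →L[ℝ] EuclideanSpace ℝ (Fin (m + 1)) →L[ℝ] ℝ}
    {Γ : EuclideanSpace ℝ (Fin (m + 1)) → EuclideanSpace ℝ (Fin (m + 1)) →L[ℝ]
      EuclideanSpace ℝ (Fin (m + 1)) →L[ℝ] EuclideanSpace ℝ (Fin (m + 1))}
    {U : EuclideanSpace ℝ (Fin (m + 1)) → EuclideanSpace ℝ (Fin (m + 1))}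
    {H a b : EuclideanSpace ℝ (Fin (m + 1)) → ℝ} (h : IsLeviCivita Ω g Γ)
    (c : IsConcircular Ω g Γ U H a b) (hm : 3 < m + 1) {t₀ t₁ t₂ : ℝ} (ht₀ : t₀ ∈ Set.Ioo t₁ t₂)
    {V : Set (EuclideanSpace ℝ (Fin m))} (hV : IsOpen V) (hVc : Convex ℝ V)
    {z₀ : EuclideanSpace ℝ (Fin m)} (hz₀ : z₀ ∈ V)
    {Θ : EuclideanSpace ℝ (Fin (m + 1)) → EuclideanSpace ℝ (Fin (m + 1))}
    {B : Set (EuclideanSpace ℝ (Fin (m + 1)))}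
    (hB : B = {y | y 0 ∈ Set.Ioo t₁ t₂ ∧ fiberCoord y ∈ V})
    (hΘ : ContDiffOn ℝ ∞ Θ B) (hΘΩ : Set.MapsTo Θ B Ω)
    (hU : ∀ y ∈ B, fderiv ℝ Θ y (EuclideanSpace.single 0 1) = U (Θ y))
    (hUv : ∀ y ∈ B, ∀ v, g (Θ y) (U (Θ y)) (fderiv ℝ Θ y v) = v 0)
    (hs : ∀ y ∈ B, Function.Surjective (fderiv ℝ Θ y)) :
    ∃ (q : ℝ → ℝ) (G : EuclideanSpace ℝ (Fin m) → Matrix (Fin m) (Fin m) ℝ),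
      ContDiffOn ℝ ∞ q (Set.Ioo t₁ t₂) ∧ IsMetricOn V G ∧ IsEinsteinOn V G ∧
      ∀ y ∈ B, ∀ α β : Fin m,
        g (Θ y) (fderiv ℝ Θ y (EuclideanSpace.single α.succ 1))
          (fderiv ℝ Θ y (EuclideanSpace.single β.succ 1))
          = Real.exp (q (y 0)) * G (fiberCoord y) α β := by
  have hBo : IsOpen B := by
    rw [hB]
    exact (isOpen_Ioo.preimage (by fun_prop)).inter (hV.preimage continuous_fiberCoord)
  have hBp : ∀ t ∈ Set.Ioo t₁ t₂, ∀ z ∈ V, boxPoint t z ∈ B := fun t ht z hz => by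
    rw [hB]; exact ⟨by rwa [boxPoint_zero], by rwa [fiberCoord_boxPoint]⟩
  have hE : 4 ≤ Module.finrank ℝ (EuclideanSpace ℝ (Fin (m + 1))) := by
    rw [finrank_euclideanSpace_fin]; exact hm
  -- the tangential part of the metric, in coordinates
  let S : EuclideanSpace ℝ (Fin (m + 1)) → EuclideanSpace ℝ (Fin m) → EuclideanSpace ℝ (Fin m) → ℝ :=
    fun y v w => g (Θ y) (fderiv ℝ Θ y (fiberInc v)) (fderiv ℝ Θ y (fiberInc w))
  have hSs : ∀ v w, ContDiffOn ℝ ∞ (fun y => S y v w) B := fun v w =>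
    ((h.smooth_metric.comp hΘ hΘΩ).clm_apply
      ((hΘ.fderiv_of_isOpen hBo (m := ∞) (by simp)).clm_apply contDiffOn_const)).clm_apply
      ((hΘ.fderiv_of_isOpen hBo (m := ∞) (by simp)).clm_apply contDiffOn_const)
  have hinj : ∀ y ∈ B, ∀ v, fderiv ℝ Θ y v = 0 → v = 0 := fun y hy v hv =>
    (injective_iff_map_eq_zero (fderiv ℝ Θ y)).1
      (LinearMap.injective_iff_surjective.2 (hs y hy)) v hv
  have hSpos : ∀ y ∈ B, ∀ v, v ≠ 0 → 0 < S y v v := fun y hy v hv => by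
    refine h.pos _ (hΘΩ hy) _ fun h0 => hv ?_
    have := hinj y hy _ h0
    ext α
    rw [← fiberInc_succ, this]; simp
  -- the leaves are homothetic along the flow
  have hflow : ∀ y ∈ B, ∀ v w, HasDerivAt (fun t : ℝ => S (y + t • EuclideanSpace.single 0 1) v w)
      (2 * H (Θ y) * S y v w) 0 := by
    intro y hy v w
    have hn : ∀ v, nablaMap Γ Θ y (EuclideanSpace.single 0 1) (fiberInc v)
        = H (Θ y) • fderiv ℝ Θ y (fiberInc v) := by
      intro v
      rw [nablaMap_symm hBo hΘ h hΘΩ hy, nablaMap, hU y hy]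
      have d1 := (hasDerivAt_along (differentiableAt_fderiv_of_smoothOn hBo hΘ hy)
        (fiberInc v)).clm_apply (hasDerivAt_const 0 (EuclideanSpace.single 0 (1 : ℝ)))
      have d2 := hasDerivAt_comp_along hBo hΘ hy (c.fieldAt h (hΘΩ hy)) (fiberInc v)
      have e := deriv_along_unique (f := fun y => fderiv ℝ Θ y (EuclideanSpace.single 0 1))
        (f' := fun y => U (Θ y)) hBo hy d1 d2 hU
      simp only [map_zero, add_zero] at e
      rw [e]
      have := c.nabla _ (hΘΩ hy) (fderiv ℝ Θ y (fiberInc v))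
      rw [nablaVec, hUv y hy, fiberInc_zero, zero_smul, sub_zero] at this
      exact this
    refine (hasDerivAt_inner_fderiv hBo hΘ h hΘΩ hy (EuclideanSpace.single 0 1) (fiberInc v)
      (fiberInc w)).congr_deriv ?_
    simp only [hn, map_smul, smul_apply, smul_eq_mul, S]
    ring
  have hbox : ∀ (z : EuclideanSpace ℝ (Fin m)) (t s : ℝ), boxPoint (t + s) z = boxPoint t z + s • EuclideanSpace.single 0 1 :=
    fun z t s => by simp only [boxPoint]; module
  have hflow' : ∀ t ∈ Set.Ioo t₁ t₂, ∀ z ∈ V, ∀ v w, HasDerivAt (fun t : ℝ => S (boxPoint t z) v w)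
      (2 * H (Θ (boxPoint t z)) * S (boxPoint t z) v w) t := by
    intro t ht z hz v w
    have d := hflow _ (hBp t ht z hz) v w
    have d2 : HasDerivAt (fun s : ℝ => S (boxPoint (t + s) z) v w)
        (2 * H (Θ (boxPoint t z)) * S (boxPoint t z) v w) 0 := by
      simpa only [hbox] using d
    have d3 := HasDerivAt.comp_sub_const (f := fun s : ℝ => S (boxPoint (t + s) z) v w) t t
      (by simpa using d2)
    simpa using d3
  -- functions whose gradient is normal to the leaves
  have hleaf : ∀ f : EuclideanSpace ℝ (Fin (m + 1)) → ℝ, (∀ x ∈ Ω, DifferentiableAt ℝ f x) →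
      (∀ x ∈ Ω, ∀ X, g x (U x) X = 0 → fderiv ℝ f x X = 0) → ∀ t ∈ Set.Ioo t₁ t₂, ∀ z ∈ V,
      f (Θ (boxPoint t z)) = f (Θ (boxPoint t z₀)) := by
    intro f hf hf0 t ht z hz
    have hd : ∀ z ∈ V, HasFDerivAt (fun z => f (Θ (boxPoint t z)))
        ((fderiv ℝ f (Θ (boxPoint t z))).comp
          ((fderiv ℝ Θ (boxPoint t z)).comp fiberInc)) z := fun z hz =>
      (hf _ (hΘΩ (hBp t ht z hz))).hasFDerivAt.comp z
        ((differentiableAt_of_smoothOn hBo hΘ (hBp t ht z hz)).hasFDerivAt.comp z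
          ((fiberInc (m := m)).hasFDerivAt.const_add _))
    refine eq_of_fderiv_eq_zero hVc hV (f := fun z => f (Θ (boxPoint t z)))
      (fun z hz => (hd z hz).differentiableAt.differentiableWithinAt) (fun z hz v => ?_) hz hz₀
    rw [(hd z hz).fderiv]
    exact hf0 _ (hΘΩ (hBp t ht z hz)) _ (by
      simpa [fiberInc_zero] using hUv _ (hBp t ht z hz) (fiberInc v))
  have hHl : ∀ x ∈ Ω, ∀ X, g x (U x) X = 0 → fderiv ℝ H x X = 0 := fun x hx X hX => by
    rw [c.fderiv_H h hE hx, hX, mul_zero]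
  have hal : ∀ x ∈ Ω, ∀ X, g x (U x) X = 0 → fderiv ℝ a x X = 0 := fun x hx X hX => by
    rw [c.fderiv_a h hE hx, hX, mul_zero]
  have hHc := hleaf H (fun x hx => c.HAt h hx) hHl
  have hac := hleaf a (fun x hx => c.aAt h hx) hal
  -- the warping function is the size of a fixed coordinate vector along a flow line
  let v₀ : EuclideanSpace ℝ (Fin m) := EuclideanSpace.single ⟨0, by omega⟩ 1
  have hv₀ : v₀ ≠ 0 := by
    intro h0
    have := congrArg (fun v : EuclideanSpace ℝ (Fin m) => v ⟨0, by omega⟩) h0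
    simp [v₀] at this
  let q : ℝ → ℝ := fun t => Real.log (S (boxPoint t z₀) v₀ v₀)
  have hbd : ∀ z : EuclideanSpace ℝ (Fin m), ContDiff ℝ ∞ fun t : ℝ => boxPoint t z := fun z =>
    (contDiff_id.smul contDiff_const).add contDiff_const
  have hq : ContDiffOn ℝ ∞ q (Set.Ioo t₁ t₂) :=
    ContDiffOn.log ((hSs v₀ v₀).comp (hbd z₀).contDiffOn fun t ht => hBp t ht z₀ hz₀)
      fun t ht => (hSpos _ (hBp t ht z₀ hz₀) v₀ hv₀).ne'
  have hqd : ∀ t ∈ Set.Ioo t₁ t₂, HasDerivAt q (2 * H (Θ (boxPoint t z₀))) t := fun t ht => by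
    have hp := hSpos _ (hBp t ht z₀ hz₀) v₀ hv₀
    refine ((hflow' t ht z₀ hz₀ v₀ v₀).log hp.ne').congr_deriv ?_
    field_simp
  have hconst : ∀ t ∈ Set.Ioo t₁ t₂, ∀ z ∈ V, ∀ v w, S (boxPoint t z) v w
      = Real.exp (q t) * (Real.exp (-q t₀) * S (boxPoint t₀ z) v w) := by
    intro t ht z hz v w
    have hd : ∀ t ∈ Set.Ioo t₁ t₂, HasDerivAt
        (fun t => Real.exp (-q t) * S (boxPoint t z) v w) 0 t := by
      intro t ht
      refine ((hqd t ht).neg.exp.mul (hflow' t ht z hz v w)).congr_deriv ?_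
      rw [hHc t ht z hz]
      ring
    have := eq_of_fderiv_eq_zero (convex_Ioo t₁ t₂) isOpen_Ioo
      (fun t ht => (hd t ht).differentiableAt.differentiableWithinAt)
      (fun t ht v => by rw [(hd t ht).hasFDerivAt.fderiv]; simp) ht ht₀
    rw [← this, ← mul_assoc, ← Real.exp_add, add_neg_cancel, Real.exp_zero, one_mul]
  -- the metric of the fibre
  let G : EuclideanSpace ℝ (Fin m) → Matrix (Fin m) (Fin m) ℝ := fun z α β =>
    Real.exp (-q t₀) * S (boxPoint t₀ z) (EuclideanSpace.single α 1) (EuclideanSpace.single β 1)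
  have hGf : ∀ z v w, formOf (G z) v w = Real.exp (-q t₀) * S (boxPoint t₀ z) v w := by
    intro z v w
    refine eq_of_eq_single (f := fun v => formOf (G z) v w)
      (f' := fun v => Real.exp (-q t₀) * S (boxPoint t₀ z) v w) (fun X X' t => by simp)
      (fun X X' t => by simp [S]; ring) (fun α => ?_) v
    refine eq_of_eq_single (f := fun w => formOf (G z) _ w)
      (f' := fun w => Real.exp (-q t₀) * S (boxPoint t₀ z) _ w) (fun X X' t => by simp)
      (fun X X' t => by simp [S]; ring) (fun β => ?_) w
    exact formOf_single _ _ _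
  have hzd : ContDiff ℝ ∞ fun z : EuclideanSpace ℝ (Fin m) => boxPoint t₀ z :=
    contDiff_const.add fiberInc.contDiff
  have hzB : Set.MapsTo (fun z => boxPoint t₀ z) V B := fun z hz => hBp t₀ ht₀ z hz
  have hG : IsMetricOn V G := by
    refine ⟨fun α β => contDiffOn_const.mul ((hSs _ _).comp hzd.contDiffOn hzB), fun z hz => ?_⟩
    refine Matrix.posDef_iff_dotProduct_mulVec.2 ⟨?_, fun v hv => ?_⟩
    · ext α β
      exact congrArg (Real.exp (-q t₀) * ·) (h.symm _ (hΘΩ (hzB hz)) _ _)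
    · have : star v ⬝ᵥ (G z).mulVec v = formOf (G z) (WithLp.toLp 2 v) (WithLp.toLp 2 v) := by
        rw [formOf_apply]
        simp only [dotProduct, Matrix.mulVec, Finset.mul_sum, Pi.star_apply, star_trivial]
        exact Finset.sum_congr rfl fun i _ => Finset.sum_congr rfl fun j _ => by ring
      rw [this, hGf]
      exact mul_pos (Real.exp_pos _) (hSpos _ (hzB hz) _ (by simpa using hv))
  refine ⟨q, G, hq, hG, ?_, fun y hy α β => ?_⟩
  · let Ψ : EuclideanSpace ℝ (Fin m) → EuclideanSpace ℝ (Fin (m + 1)) := fun z => Θ (boxPoint t₀ z)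
    have hΨ : ContDiffOn ℝ ∞ Ψ V := hΘ.comp hzd.contDiffOn hzB
    have hΨd : ∀ z ∈ V, ∀ v, fderiv ℝ Ψ z v = fderiv ℝ Θ (boxPoint t₀ z) (fiberInc v) := by
      intro z hz v
      have : HasFDerivAt Ψ ((fderiv ℝ Θ (boxPoint t₀ z)).comp fiberInc) z :=
        (differentiableAt_of_smoothOn hBo hΘ (hzB hz)).hasFDerivAt.comp z
          ((fiberInc (m := m)).hasFDerivAt.const_add _)
      rw [this.fderiv]; rfl
    have hΨΩ : Set.MapsTo Ψ V Ω := fun z hz => hΘΩ (hzB hz)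
    have hΨU : ∀ z ∈ V, ∀ v, g (Ψ z) (U (Ψ z)) (fderiv ℝ Ψ z v) = 0 := fun z hz v => by
      rw [hΨd z hz]
      exact (hUv _ (hzB hz) _).trans (fiberInc_zero v)
    refine ⟨(2 * a (Ψ z₀) + H (Ψ z₀) ^ 2) / Real.exp (-q t₀) * ((m : ℝ) - 1), fun z hz => ?_⟩
    refine ricci_of_curv_eq hV hG hz fun X Y Z => ?_
    have := curv_of_leaf h c (hG.isLeviCivita hV) hΨ hΨΩ hΨU (fun z hz X hX => ?_)
      (Real.exp_pos (-q t₀)) (fun z hz v w => ?_) hz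
      (fun v => hHl _ (hΨΩ hz) _ (hΨU z hz v)) X Y Z
    · rw [this, hHc t₀ ht₀ z hz, hac t₀ ht₀ z hz]
    · obtain ⟨v, rfl⟩ := hs _ (hzB hz) X
      refine ⟨fiberCoord v, ?_⟩
      rw [hΨd z hz, ← eq_fiberInc ((hUv _ (hzB hz) v).symm.trans hX)]
    · rw [hGf, hΨd z hz, hΨd z hz]
  · have hy' : y 0 ∈ Set.Ioo t₁ t₂ ∧ fiberCoord y ∈ V := by rwa [hB] at hy
    have := hconst _ hy'.1 _ hy'.2 (EuclideanSpace.single α 1) (EuclideanSpace.single β 1)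
    rw [boxPoint_fiberCoord] at this
    simp only [S, fiberInc_single] at this
    rw [this]
    simp only [G, S, fiberInc_single]

/-- Coordinates exhibiting a warped product with Einstein fibre: a potential of `U`, and quotients of
fibre functions. -/
theorem exists_warped_coordinates {Ω : Set (EuclideanSpace ℝ (Fin (m + 1)))}
    {g : EuclideanSpace ℝ (Fin (m + 1)) →
      EuclideanSpace ℝ (Fin (m + 1)) →L[ℝ] EuclideanSpace ℝ (Fin (m + 1)) →L[ℝ] ℝ}
    {Γ : EuclideanSpace ℝ (Fin (m + 1)) → EuclideanSpace ℝ (Fin (m + 1)) →L[ℝ]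
      EuclideanSpace ℝ (Fin (m + 1)) →L[ℝ] EuclideanSpace ℝ (Fin (m + 1))}
    {U : EuclideanSpace ℝ (Fin (m + 1)) → EuclideanSpace ℝ (Fin (m + 1))}
    {H a b : EuclideanSpace ℝ (Fin (m + 1)) → ℝ} (h : IsLeviCivita Ω g Γ)
    (c : IsConcircular Ω g Γ U H a b) (hm : 3 < m + 1)
    {x₀ : EuclideanSpace ℝ (Fin (m + 1))} (hx₀ : x₀ ∈ Ω) :
    ∃ Φ : OpenPartialHomeomorph (EuclideanSpace ℝ (Fin (m + 1))) (EuclideanSpace ℝ (Fin (m + 1))),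
      x₀ ∈ Φ.source ∧ Φ.source ⊆ Ω ∧ ContDiffOn ℝ ∞ Φ Φ.source ∧ ContDiffOn ℝ ∞ Φ.symm Φ.target ∧
      ∃ (t₁ t₂ : ℝ) (V : Set (EuclideanSpace ℝ (Fin m))) (q : ℝ → ℝ)
        (G : EuclideanSpace ℝ (Fin m) → Matrix (Fin m) (Fin m) ℝ), IsOpen V ∧
        Φ.target = {y | y 0 ∈ Set.Ioo t₁ t₂ ∧ fiberCoord y ∈ V} ∧
        ContDiffOn ℝ ∞ q (Set.Ioo t₁ t₂) ∧ IsMetricOn V G ∧ IsEinsteinOn V G ∧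
        ∀ y ∈ Φ.target,
          g (Φ.symm y) (fderiv ℝ Φ.symm y (EuclideanSpace.single 0 1))
            (fderiv ℝ Φ.symm y (EuclideanSpace.single 0 1)) = 1 ∧
          (∀ α : Fin m, g (Φ.symm y) (fderiv ℝ Φ.symm y (EuclideanSpace.single 0 1))
            (fderiv ℝ Φ.symm y (EuclideanSpace.single α.succ 1)) = 0) ∧
          ∀ α β : Fin m, g (Φ.symm y) (fderiv ℝ Φ.symm y (EuclideanSpace.single α.succ 1))
            (fderiv ℝ Φ.symm y (EuclideanSpace.single β.succ 1))
            = Real.exp (q (y 0)) * G (fiberCoord y) α β := by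
  obtain ⟨r, hr, hrΩ, ρ, w, T, hρ, hρd, hw, h00, hT0, hw0, hsep⟩ := exists_fibre_functions h c hm hx₀
  let B : Set (EuclideanSpace ℝ (Fin (m + 1))) := Metric.ball x₀ r ∩ w 0 ⁻¹' {0}ᶜ
  have hB : IsOpen B := (hw 0).smooth.continuousOn.isOpen_inter_preimage Metric.isOpen_ball
    isOpen_compl_singleton
  have hBb : B ⊆ Metric.ball x₀ r := Set.inter_subset_left
  have hx : x₀ ∈ B := ⟨Metric.mem_ball_self hr, by simp [h00]⟩
  have hne : ∀ x ∈ B, w 0 x ≠ 0 := fun x hx => hx.2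
  let F : EuclideanSpace ℝ (Fin (m + 1)) → EuclideanSpace ℝ (Fin (m + 1)) :=
    fun x => WithLp.toLp 2 (Fin.cons (ρ x) fun α : Fin m => w α.succ x / w 0 x)
  have hF : ContDiffOn ℝ ∞ F B := contDiffOn_euclidean.2 fun i => by
    refine Fin.cases (hρ.mono hBb) (fun α => ?_) i
    exact ((hw α.succ).smooth.mono hBb).div ((hw 0).smooth.mono hBb) hne
  have hFz : ∀ x ∈ B, ∀ X, fderiv ℝ F x X 0 = g x (U x) X := by
    intro x hx X
    rw [fderiv_euclidean_apply (differentiableAt_of_smoothOn hB hF hx)]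
    exact hρd x (hBb hx) X
  have hFs : ∀ x ∈ B, ∀ X, ∀ α : Fin m, fderiv ℝ F x X α.succ
      = (w 0 x * g x (T α.succ x) X - w α.succ x * g x (T 0 x) X) / w 0 x ^ 2 := by
    intro x hx X α
    rw [fderiv_euclidean_apply (differentiableAt_of_smoothOn hB hF hx)]
    have d := (differentiableAt_of_smoothOn Metric.isOpen_ball (hw α.succ).smooth
      (hBb hx)).hasFDerivAt.mul ((hasDerivAt_inv (hne x hx)).comp_hasFDerivAt x
        (differentiableAt_of_smoothOn Metric.isOpen_ball (hw 0).smooth (hBb hx)).hasFDerivAt)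
    have e : fderiv ℝ (fun x => F x α.succ) x = _ := d.fderiv
    rw [e]
    simp only [add_apply, smul_apply, smul_eq_mul, (hw _).fderiv_eq x (hBb hx), Function.comp_apply]
    have := hne x hx
    field_simp
    ring
  obtain ⟨Φ, hxΦ, hΦB, hΦ, hΦs⟩ := exists_openPartialHomeomorph hB hF hx (fun X hX => by
    refine hsep X ?_ fun α => ?_
    · rw [← hFz x₀ hx, hX]; rfl
    · have := hFs x₀ hx X α
      rw [hX, h00, hT0, hw0] at this
      simpa using this.symm)
  -- shrink the domain so that the image becomes a box
  have hy₀ : F x₀ ∈ Φ.target := hΦ x₀ ▸ Φ.map_source hxΦ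
  have hcont : ContinuousAt (fun p : ℝ × EuclideanSpace ℝ (Fin m) => boxPoint p.1 p.2)
      (F x₀ 0, fiberCoord (F x₀)) := by
    unfold boxPoint
    fun_prop
  have hnhds : Φ.target ∈ nhds (boxPoint (F x₀ 0) (fiberCoord (F x₀))) := by
    rw [boxPoint_fiberCoord]; exact Φ.open_target.mem_nhds hy₀
  obtain ⟨ε, hε, hεΦ⟩ := Metric.mem_nhds_iff.1 (hcont hnhds)
  let V : Set (EuclideanSpace ℝ (Fin m)) := Metric.ball (fiberCoord (F x₀)) ε
  let K : Set (EuclideanSpace ℝ (Fin (m + 1))) :=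
    {y | y 0 ∈ Set.Ioo (F x₀ 0 - ε) (F x₀ 0 + ε) ∧ fiberCoord y ∈ V}
  have hK : IsOpen K :=
    (isOpen_Ioo.preimage (by fun_prop)).inter (Metric.isOpen_ball.preimage continuous_fiberCoord)
  have hKΦ : K ⊆ Φ.target := by
    intro y hy
    rw [← boxPoint_fiberCoord y]
    refine hεΦ (a := (y 0, fiberCoord y)) ?_
    rw [← ball_prod_same, Real.ball_eq_Ioo]
    exact hy
  have hyK : F x₀ ∈ K := ⟨⟨by linarith, by linarith⟩, Metric.mem_ball_self hε⟩
  let Φ' := (Φ.symm.restrOpen K hK).symm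
  have hΦ't : Φ'.target = K := Set.inter_eq_right.2 hKΦ
  have hΦ's : ∀ y, Φ'.symm y = Φ.symm y := fun y => rfl
  have hΦ'e : ∀ x, Φ' x = F x := hΦ
  have hmem : ∀ y ∈ K, Φ.symm y ∈ B := fun y hy => hΦB (Φ.map_target (hKΦ hy))
  have hsub : Φ'.source ⊆ B := fun x hx => by
    rw [← Φ'.left_inv hx]
    exact hmem _ (hΦ't ▸ Φ'.map_source hx)
  have hsm : ContDiffOn ℝ ∞ Φ.symm K := hΦs.mono hKΦ
  -- the derivatives of the coordinates and of their inverse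
  have hinv : ∀ y ∈ K, ∀ v, fderiv ℝ F (Φ.symm y) (fderiv ℝ Φ.symm y v) = v := by
    intro y hy v
    have d := (differentiableAt_of_smoothOn hB hF (hmem y hy)).hasFDerivAt.comp y
      (differentiableAt_of_smoothOn hK hsm hy).hasFDerivAt
    have e : F ∘ Φ.symm =ᶠ[nhds y] id := by
      filter_upwards [hK.mem_nhds hy] with z hz
      exact (hΦ _).symm.trans (Φ.right_inv (hKΦ hz))
    have := (d.congr_of_eventuallyEq e.symm).unique (hasFDerivAt_id y)
    exact congrArg (fun L : EuclideanSpace ℝ (Fin (m + 1)) →L[ℝ] _ => L v) this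
  have hinj : ∀ y ∈ K, Function.Injective (fderiv ℝ Φ.symm y) := fun y hy v v' hvv => by
    rw [← hinv y hy v, ← hinv y hy v', hvv]
  have hsurj : ∀ y ∈ K, Function.Surjective (fderiv ℝ Φ.symm y) := fun y hy =>
    LinearMap.injective_iff_surjective.1 (hinj y hy)
  have hFU : ∀ x ∈ B, fderiv ℝ F x (U x) = EuclideanSpace.single 0 1 := by
    intro x hx
    have hxΩ := hrΩ (hBb hx)
    ext i
    refine Fin.cases ?_ (fun α => ?_) i
    · rw [hFz x hx, c.unit x hxΩ]; simp
    · rw [hFs x hx, h.symm x hxΩ _ (U x), h.symm x hxΩ _ (U x), (hw _).orthogonal x (hBb hx),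
        (hw _).orthogonal x (hBb hx)]
      simp
  have hU : ∀ y ∈ K, fderiv ℝ Φ.symm y (EuclideanSpace.single 0 1) = U (Φ.symm y) := by
    intro y hy
    obtain ⟨v, hv⟩ := hsurj y hy (U (Φ.symm y))
    rw [← hv, ← hFU _ (hmem y hy), ← hv, hinv y hy]
  have hUv : ∀ y ∈ K, ∀ v, g (Φ.symm y) (U (Φ.symm y)) (fderiv ℝ Φ.symm y v) = v 0 := by
    intro y hy v
    rw [← hFz _ (hmem y hy), hinv y hy]
  obtain ⟨q, G, hq, hG, hGE, hGf⟩ := c.exists_warped h hm (t₀ := F x₀ 0) (t₁ := F x₀ 0 - ε)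
    (t₂ := F x₀ 0 + ε) ⟨by linarith, by linarith⟩ Metric.isOpen_ball (convex_ball _ _)
    (Metric.mem_ball_self hε) (B := K) rfl hsm (fun y hy => hrΩ (hBb (hmem y hy))) hU hUv hsurj
  refine ⟨Φ', ?_, hsub.trans (hBb.trans hrΩ), (hF.mono hsub).congr fun x _ => hΦ'e x, ?_,
    F x₀ 0 - ε, F x₀ 0 + ε, V, q, G, Metric.isOpen_ball, hΦ't, hq, hG, hGE, fun y hy => ?_⟩
  · have := Φ'.map_target (hΦ't.symm ▸ hyK)
    rwa [hΦ's, ← hΦ x₀, Φ.left_inv hxΦ] at this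
  · rw [hΦ't]; exact hsm
  · rw [hΦ't] at hy
    have e0 := hU y hy
    have e1 := hUv y hy
    change g (Φ.symm y) (fderiv ℝ Φ.symm y _) (fderiv ℝ Φ.symm y _) = 1 ∧
      (∀ α : Fin m, g (Φ.symm y) (fderiv ℝ Φ.symm y _) (fderiv ℝ Φ.symm y _) = 0) ∧ _
    refine ⟨?_, fun α => ?_, hGf y hy⟩
    · nth_rw 1 [e0]; rw [e1]; simp
    · rw [e0, e1]; simp

end Box

/-! ### Tensor fields on a manifold and their components in charts -/

section Charts

variable {n : ℕ} {M : Type*} [TopologicalSpace M] [ChartedSpace (EuclideanSpace ℝ (Fin n)) M]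
  [IsManifold (𝓡 n) ∞ M] {e : OpenPartialHomeomorph M (EuclideanSpace ℝ (Fin n))}

theorem contMDiffOn_coordVec (he : e ∈ charts n M) (i : Fin n) :
    ContMDiffOn (𝓡 n) (𝓡 n).tangent ∞ (fun x => (Bundle.TotalSpace.mk' (EuclideanSpace ℝ (Fin n))
      (e.symm x) (coordVec e x i) : TangentBundle (𝓡 n) M)) e.target := by
  have h1 := (contMDiffOn_symm_of_mem_maximalAtlas he).contMDiffOn_tangentMapWithin (m := ∞)
    (by simp) e.open_target.uniqueMDiffOn
  have h2 : ContMDiffOn (𝓡 n) (𝓡 n).tangent ∞ (fun x : EuclideanSpace ℝ (Fin n) =>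
      (Bundle.TotalSpace.mk' (EuclideanSpace ℝ (Fin n)) x (EuclideanSpace.single i (1 : ℝ)) :
        TangentBundle (𝓡 n) (EuclideanSpace ℝ (Fin n)))) e.target :=
    contMDiffOn_vectorSpace_iff_contDiffOn.2 contDiffOn_const
  refine (h1.comp h2 fun x hx => hx).congr fun x hx => ?_
  simp only [Function.comp_apply, tangentMapWithin, coordVec]
  rw [mfderivWithin_of_isOpen e.open_target hx]

theorem contDiffOn_metricIn (g : Metric n M) (he : e ∈ charts n M) (i j : Fin n) :
    ContDiffOn ℝ ∞ (fun x => metricIn g e x i j) e.target := by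
  have h1 : ContMDiffOn (𝓡 n) ((𝓡 n).prod 𝓘(ℝ, EuclideanSpace ℝ (Fin n) →L[ℝ]
      EuclideanSpace ℝ (Fin n) →L[ℝ] ℝ)) ∞ (fun x => Bundle.TotalSpace.mk'
      (EuclideanSpace ℝ (Fin n) →L[ℝ] EuclideanSpace ℝ (Fin n) →L[ℝ] ℝ)
      (E := fun p : M => TangentSpace (𝓡 n) p →L[ℝ] TangentSpace (𝓡 n) p →L[ℝ] ℝ) (e.symm x)
      (g.inner (e.symm x))) e.target :=
    g.contMDiff.comp_contMDiffOn (contMDiffOn_symm_of_mem_maximalAtlas he)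
  have h2 := ContMDiffOn.clm_bundle_apply₂ (F₁ := EuclideanSpace ℝ (Fin n))
    (F₂ := EuclideanSpace ℝ (Fin n)) (F₃ := ℝ) (E₃ := Bundle.Trivial M ℝ) h1
    (contMDiffOn_coordVec he i) (contMDiffOn_coordVec he j)
  intro x hx
  have := (Bundle.contMDiffWithinAt_totalSpace.1 (h2 x hx)).2
  simpa [metricIn] using this.contDiffWithinAt

theorem contDiffOn_covectorIn (A : Covector n M) (he : e ∈ charts n M) (i : Fin n) :
    ContDiffOn ℝ ∞ (fun x => covectorIn A e x i) e.target := by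
  have h1 := A.contMDiff.comp_contMDiffOn (contMDiffOn_symm_of_mem_maximalAtlas he)
  have h2 := ContMDiffOn.clm_bundle_apply (F₁ := EuclideanSpace ℝ (Fin n))
    (F₂ := ℝ) (E₂ := Bundle.Trivial M ℝ) h1 (contMDiffOn_coordVec he i)
  intro x hx
  have := (Bundle.contMDiffWithinAt_totalSpace.1 (h2 x hx)).2
  simpa [covectorIn] using this.contDiffWithinAt

omit [IsManifold (𝓡 n) ∞ M] in
theorem contDiffOn_scalarIn {f : M → ℝ} (hf : ContMDiff (𝓡 n) 𝓘(ℝ, ℝ) ∞ f)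
    (he : e ∈ charts n M) : ContDiffOn ℝ ∞ (scalarIn f e) e.target :=
  (hf.comp_contMDiffOn (contMDiffOn_symm_of_mem_maximalAtlas he)).contDiffOn

omit [IsManifold (𝓡 n) ∞ M] in
theorem mdifferentiableAt_symm_chart (he : e ∈ charts n M) {x : EuclideanSpace ℝ (Fin n)}
    (hx : x ∈ e.target) : MDifferentiableAt (𝓡 n) (𝓡 n) e.symm x :=
  ((contMDiffOn_symm_of_mem_maximalAtlas he).contMDiffAt
    (e.open_target.mem_nhds hx)).mdifferentiableAt (by simp)

/-- The differential of the inverse of a chart, with its source identified with `ℝⁿ`. -/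
def chartDeriv (e : OpenPartialHomeomorph M (EuclideanSpace ℝ (Fin n)))
    (x : EuclideanSpace ℝ (Fin n)) : EuclideanSpace ℝ (Fin n) →L[ℝ] TangentSpace (𝓡 n) (e.symm x) :=
  mfderiv (𝓡 n) (𝓡 n) e.symm x

omit [IsManifold (𝓡 n) ∞ M] in
theorem chartDeriv_bijective (he : e ∈ charts n M) {x : EuclideanSpace ℝ (Fin n)}
    (hx : x ∈ e.target) : Function.Bijective (chartDeriv e x) := by
  have hinj : Function.Injective (chartDeriv e x) := by
    have h1 : MDifferentiableAt (𝓡 n) (𝓡 n) e (e.symm x) :=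
      (contMDiffAt_of_mem_maximalAtlas he (e.map_target hx)).mdifferentiableAt (by simp)
    have h2 := mfderiv_comp x h1 (mdifferentiableAt_symm_chart he hx)
    have h3 : e ∘ e.symm =ᶠ[nhds x] id := by
      filter_upwards [e.open_target.mem_nhds hx] with y hy using e.right_inv hy
    rw [h3.mfderiv_eq, mfderiv_id] at h2
    intro v w hvw
    have h4 : ∀ v : EuclideanSpace ℝ (Fin n),
        v = mfderiv (𝓡 n) (𝓡 n) e (e.symm x) (chartDeriv e x v) := fun v =>
      congrArg (fun L : EuclideanSpace ℝ (Fin n) →L[ℝ] EuclideanSpace ℝ (Fin n) => L v) h2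
    rw [h4 v, h4 w, hvw]
  let L : EuclideanSpace ℝ (Fin n) →L[ℝ] EuclideanSpace ℝ (Fin n) := chartDeriv e x
  exact ⟨hinj, (LinearMap.injective_iff_surjective (f := L.toLinearMap)).1 hinj⟩

theorem formOf_metricIn (g : Metric n M) (x v w : EuclideanSpace ℝ (Fin n)) :
    formOf (metricIn g e x) v w = g.inner (e.symm x) (chartDeriv e x v) (chartDeriv e x w) := by
  refine eq_of_eq_single (f := fun v => formOf (metricIn g e x) v w)
    (f' := fun v => g.inner (e.symm x) (chartDeriv e x v) (chartDeriv e x w)) (fun X X' t => by simp)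
    (fun X X' t => by simp) (fun α => ?_) v
  refine eq_of_eq_single (f := fun w => formOf (metricIn g e x) _ w)
    (f' := fun w => g.inner (e.symm x) (chartDeriv e x _) (chartDeriv e x w)) (fun X X' t => by simp)
    (fun X X' t => by simp) (fun β => ?_) w
  exact formOf_single _ _ _

theorem isMetricOn_metricIn (g : Metric n M) (he : e ∈ charts n M) :
    IsMetricOn e.target (metricIn g e) := by
  refine ⟨contDiffOn_metricIn g he, fun x hx => ?_⟩
  refine Matrix.posDef_iff_dotProduct_mulVec.2 ⟨?_, fun v hv => ?_⟩
  · ext α β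
    exact g.symm _ _ _
  · have : star v ⬝ᵥ (metricIn g e x).mulVec v
        = formOf (metricIn g e x) (WithLp.toLp 2 v) (WithLp.toLp 2 v) := by
      rw [formOf_apply]
      simp only [dotProduct, Matrix.mulVec, Finset.mul_sum, Pi.star_apply, star_trivial]
      exact Finset.sum_congr rfl fun i _ => Finset.sum_congr rfl fun j _ => by ring
    rw [this, formOf_metricIn]
    refine g.pos _ _ fun h0 => hv ?_
    have := (chartDeriv_bijective he hx).1 (h0.trans (map_zero (chartDeriv e x)).symm)
    simpa using this

theorem covectorIn_ne (A B : Covector n M) (he : e ∈ charts n M) {p : M} (hp : p ∈ e.source)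
    (h : (A - B) p ≠ 0) : covectorIn A e (e p) ≠ covectorIn B e (e p) := by
  intro hAB
  apply h
  obtain ⟨x, hx, rfl⟩ : ∃ x ∈ e.target, e.symm x = p := ⟨e p, e.map_source hp, e.left_inv hp⟩
  rw [e.right_inv hx] at hAB
  have h1 : ∀ v : EuclideanSpace ℝ (Fin n), (A - B) (e.symm x) (chartDeriv e x v) = 0 := fun v => by
    refine eq_of_eq_single (f := fun v => (A - B) (e.symm x) (chartDeriv e x v))
      (f' := fun _ => (0 : ℝ)) (fun X X' t => by simp; ring) (fun X X' t => by simp) (fun i => ?_) v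
    have := congrFun hAB i
    exact sub_eq_zero.2 this
  ext X
  obtain ⟨v, rfl⟩ := (chartDeriv_bijective he hx).2 X
  exact h1 v

omit [IsManifold (𝓡 n) ∞ M] in
/-- Composing a chart with a local diffeomorphism of `ℝⁿ` gives a chart. -/
theorem trans_mem_charts (he : e ∈ charts n M)
    {Φ : OpenPartialHomeomorph (EuclideanSpace ℝ (Fin n)) (EuclideanSpace ℝ (Fin n))}
    (hΦ : ContDiffOn ℝ ∞ Φ Φ.source) (hΦs : ContDiffOn ℝ ∞ Φ.symm Φ.target) :
    e.trans Φ ∈ charts n M := by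
  have hg : Φ ∈ contDiffGroupoid ∞ (𝓡 n) := by
    refine mem_groupoid_of_pregroupoid.2 ⟨?_, ?_⟩
    · change ContDiffOn ℝ ∞ Φ (Φ.source ∩ Set.range id)
      simpa using hΦ
    · change ContDiffOn ℝ ∞ Φ.symm (Φ.target ∩ Set.range id)
      simpa using hΦs
  have he' : e ∈ (contDiffGroupoid ∞ (𝓡 n)).maximalAtlas M := he
  refine mem_maximalAtlas_iff.2 fun f hf => ?_
  obtain ⟨h1, h2⟩ := mem_maximalAtlas_iff.1 he' f hf
  refine ⟨?_, ?_⟩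
  · have := StructureGroupoid.trans _ (StructureGroupoid.symm _ hg) h1
    rwa [← OpenPartialHomeomorph.trans_assoc,
      ← OpenPartialHomeomorph.trans_symm_eq_symm_trans_symm] at this
  · have := StructureGroupoid.trans _ h2 hg
    rwa [OpenPartialHomeomorph.trans_assoc] at this

/-- The components of the metric in a chart obtained by a coordinate transformation. -/
theorem metricIn_trans (g : Metric n M) (he : e ∈ charts n M)
    {Φ : OpenPartialHomeomorph (EuclideanSpace ℝ (Fin n)) (EuclideanSpace ℝ (Fin n))}
    (hΦe : Φ.source ⊆ e.target) (hΦs : ContDiffOn ℝ ∞ Φ.symm Φ.target)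
    {y : EuclideanSpace ℝ (Fin n)} (hy : y ∈ Φ.target) (i j : Fin n) :
    metricIn g (e.trans Φ) y i j = formOf (metricIn g e (Φ.symm y))
      (fderiv ℝ Φ.symm y (EuclideanSpace.single i 1))
      (fderiv ℝ Φ.symm y (EuclideanSpace.single j 1)) := by
  have hd : MDifferentiableAt (𝓡 n) (𝓡 n) Φ.symm y :=
    (differentiableAt_of_smoothOn Φ.open_target hΦs hy).mdifferentiableAt
  have h1 := mfderiv_comp y (mdifferentiableAt_symm_chart he (hΦe (Φ.map_target hy))) hd
  rw [mfderiv_eq_fderiv] at h1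
  rw [formOf_metricIn]
  have h2 : ∀ i, coordVec (e.trans Φ) y i
      = chartDeriv e (Φ.symm y) (fderiv ℝ Φ.symm y (EuclideanSpace.single i 1)) := fun i =>
    congrArg (fun L : EuclideanSpace ℝ (Fin n) →L[ℝ] EuclideanSpace ℝ (Fin n) =>
      L (EuclideanSpace.single i 1)) h1
  rw [metricIn, h2, h2]
  rfl

end Charts

/-! ### Charts adapted to a concircular field -/

section Conclusion

variable {m : ℕ} {M : Type*} [TopologicalSpace M]
  [ChartedSpace (EuclideanSpace ℝ (Fin (m + 1))) M] [IsManifold (𝓡 (m + 1)) ∞ M]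
  (g : Metric (m + 1) M) {e : OpenPartialHomeomorph M (EuclideanSpace ℝ (Fin (m + 1)))}
  (he : e ∈ charts (m + 1) M) (hm : 3 < m + 1) {p : M} (hp : p ∈ e.source)
  {Ω : Set (EuclideanSpace ℝ (Fin (m + 1)))} (hpΩ : e p ∈ Ω) (hΩe : Ω ⊆ e.target)
  (h : IsLeviCivita Ω (fun x => formOf (metricIn g e x)) (connOf (metricIn g e)))
  {U : EuclideanSpace ℝ (Fin (m + 1)) → EuclideanSpace ℝ (Fin (m + 1))}
  {H a b : EuclideanSpace ℝ (Fin (m + 1)) → ℝ}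
  (c : IsConcircular Ω (fun x => formOf (metricIn g e x)) (connOf (metricIn g e)) U H a b)
include he hm hp hpΩ hΩe h c

theorem isWarpedEinsteinNear_of_isConcircular : IsWarpedEinsteinNear g p := by
  obtain ⟨Φ, hpΦ, hΦΩ, hΦ, hΦs, t₁, t₂, V, q, G, hV, hΦt, hq, hG, hGE, hy⟩ :=
    exists_warped_coordinates h c hm hpΩ
  have hΦe := hΦΩ.trans hΩe
  have ht : (e.trans Φ).target = Φ.target := by
    rw [OpenPartialHomeomorph.trans_target]
    exact Set.inter_eq_left.2 fun y hy => hΦe (Φ.map_target hy)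
  refine ⟨e.trans Φ, trans_mem_charts he hΦ hΦs, ⟨hp, hpΦ⟩, t₁, t₂, V, q, G, hV, ht.trans hΦt, hq,
    hG, hGE, fun y hyt => ?_⟩
  rw [ht] at hyt
  obtain ⟨h1, h2, h3⟩ := hy y hyt
  have hcomp := metricIn_trans g he hΦe hΦs hyt
  have hsymm := (isMetricOn_metricIn g (trans_mem_charts he hΦ hΦs)).symm (ht.symm ▸ hyt)
  refine ⟨(hcomp 0 0).trans h1, fun α => ?_, fun α β => (hcomp _ _).trans (h3 α β)⟩
  have h0 := (hcomp 0 α.succ).trans (h2 α)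
  exact ⟨h0, (hsymm _ _).trans h0⟩

theorem isSubprojectiveNear_of_isConcircular : IsSubprojectiveNear g p := by
  obtain ⟨Φ, hpΦ, hΦΩ, hΦ, hΦs, hP⟩ := exists_subprojective_coordinates h c hm hpΩ
  have hΦe := hΦΩ.trans hΩe
  have he' := trans_mem_charts he hΦ hΦs
  have ht : (e.trans Φ).target = Φ.target := by
    rw [OpenPartialHomeomorph.trans_target]
    exact Set.inter_eq_left.2 fun y hy => hΦe (Φ.map_target hy)
  refine ⟨e.trans Φ, he', ⟨hp, hpΦ⟩, fun J γ hJo hJ hγt hγ => ?_⟩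
  rw [ht] at hγt
  have h' := (isMetricOn_metricIn g he').isLeviCivita (e.trans Φ).open_target
  rw [ht] at h'
  have hmaps : Set.MapsTo Φ.symm Φ.target Ω := fun y hy => hΦΩ (Φ.map_target hy)
  have hiso : ∀ y ∈ Φ.target, ∀ v w, formOf (metricIn g (e.trans Φ) y) v w =
      formOf (metricIn g e (Φ.symm y)) (fderiv ℝ Φ.symm y v) (fderiv ℝ Φ.symm y w) := by
    intro y hy v w
    refine eq_of_eq_single (f := fun v => formOf (metricIn g (e.trans Φ) y) v w)
      (f' := fun v => formOf (metricIn g e (Φ.symm y)) (fderiv ℝ Φ.symm y v) (fderiv ℝ Φ.symm y w))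
      (fun X X' t => by simp) (fun X X' t => by simp) (fun i => ?_) v
    refine eq_of_eq_single (f := fun w => formOf (metricIn g (e.trans Φ) y) _ w)
      (f' := fun w => formOf (metricIn g e (Φ.symm y)) _ (fderiv ℝ Φ.symm y w))
      (fun X X' t => by simp) (fun X X' t => by simp) (fun j => ?_) w
    beta_reduce
    rw [formOf_single, metricIn_trans g he hΦe hΦs hy]
  have hsurj : ∀ y ∈ Φ.target, Function.Surjective (fderiv ℝ Φ.symm y) := by
    intro y hy
    refine LinearMap.injective_iff_surjective.1 ((injective_iff_map_eq_zero _).2 fun v hv => ?_)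
    by_contra hne
    have := h'.pos y hy v hne
    rw [hiso y hy] at this
    exact this.ne' (by rw [show fderiv ℝ Φ.symm y v = 0 from hv]; simp)
  have hγd : ∀ t ∈ J, HasDerivAt γ (deriv γ t) t := fun t ht =>
    ((hγ.1.differentiableOn (by simp)).differentiableAt (hJo.mem_nhds ht)).hasDerivAt
  have hγd2 : ∀ t ∈ J, HasDerivAt (deriv γ)
      (-(connOf (metricIn g (e.trans Φ)) (γ t) (deriv γ t) (deriv γ t))) t := by
    intro t ht
    have hd : DifferentiableAt ℝ (deriv γ) t :=
      ((hγ.1.deriv_of_isOpen (m := 1) hJo (by norm_num)).differentiableOn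
        (by simp)).differentiableAt (hJo.mem_nhds ht)
    refine hd.hasDerivAt.congr_deriv ?_
    ext k
    have := hγ.2 t ht k
    rw [PiLp.neg_apply, connOf_apply, eq_neg_iff_add_eq_zero, ← this]
    simp only [mul_assoc]
  obtain ⟨P, hP2, hPm⟩ := hP J (fun t => Φ.symm (γ t))
    (fun t => fderiv ℝ Φ.symm (γ t) (deriv γ t)) hJ (fun t ht => Φ.map_target (hγt t ht))
    (fun t ht => (differentiableAt_of_smoothOn Φ.open_target hΦs
      (hγt t ht)).hasFDerivAt.comp_hasDerivAt t (hγd t ht))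
    (fun t ht => by
      have d1 := (differentiableAt_fderiv_of_smoothOn Φ.open_target hΦs
        (hγt t ht)).hasFDerivAt.comp_hasDerivAt t (hγd t ht)
      refine (d1.clm_apply (hγd2 t ht)).congr_deriv ?_
      have := nablaMap_of_isometry hΦs h hmaps h' hiso (hγt t ht) (hsurj _ (hγt t ht))
        (deriv γ t) (deriv γ t)
      rw [Function.comp_apply, map_neg, ← this, nablaMap]
      abel)
  refine ⟨P, hP2, fun t ht => ?_⟩
  have := hPm t ht
  rwa [Φ.right_inv (hγt t ht)] at this

end Conclusion
end WeaklyZ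

end

theorem theorem5p5 (m : ℕ) (hm : 3 < m + 1) {M : Type*} [TopologicalSpace M]
    [ChartedSpace (EuclideanSpace ℝ (Fin (m + 1))) M] [IsManifold (𝓡 (m + 1)) ∞ M]
    (g : WeaklyZ.Metric (m + 1) M)
    (φ : M → ℝ) (hφ : ContMDiff (𝓡 (m + 1)) 𝓘(ℝ, ℝ) ∞ φ)
    (A B D : WeaklyZ.Covector (m + 1) M)
    (hWZS : WeaklyZ.IsWeaklyZSymmetric g φ A B D)
    (hflat : WeaklyZ.IsConformallyFlat g)
    (hZ : WeaklyZ.ZNonsingular g φ)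
    (hω : WeaklyZ.GradientParallel (A - B) φ)
    (p : M) (hp : (A - B) p ≠ 0) :
    WeaklyZ.IsWarpedEinsteinNear g p ∧ WeaklyZ.IsSubprojectiveNear g p := by
  have he : chartAt (EuclideanSpace ℝ (Fin (m + 1))) p ∈ WeaklyZ.charts (m + 1) M :=
    IsManifold.chart_mem_maximalAtlas p
  set e := chartAt (EuclideanSpace ℝ (Fin (m + 1))) p
  have hpe : p ∈ e.source := mem_chart_source _ p
  have hG := WeaklyZ.isMetricOn_metricIn g he
  obtain ⟨r, hr, hrΩ, U, H, a, b, hc⟩ := hG.exists_isConcircular e.open_target hm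
    (hflat e he) (WeaklyZ.contDiffOn_scalarIn hφ he) (hZ e he)
    (WeaklyZ.contDiffOn_covectorIn A he) (WeaklyZ.contDiffOn_covectorIn B he) (hWZS e he)
    (e.map_source hpe) (WeaklyZ.covectorIn_ne A B he hpe hp)
  have hL := (hG.isLeviCivita e.open_target).mono Metric.isOpen_ball hrΩ
  have hmem : e p ∈ Metric.ball (e p) r := Metric.mem_ball_self hr
  exact ⟨WeaklyZ.isWarpedEinsteinNear_of_isConcircular g he hm hpe hmem hrΩ hL hc,
    WeaklyZ.isSubprojectiveNear_of_isConcircular g he hm hpe hmem hrΩ hL hc⟩
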